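/- **Setting.** Let $m\ge 0$ be an integer and let $\Gamma\subset\mathbb R^2$ be a closed Jordan curve with a regular parametrization $\mathbf g:\mathbb R\to\mathbb R^2$ that is $T$-periodic ($T>0$), injective on $[0,T)$, of class $C^{\max(2,m+1)}$, with $\mathbf g'\neq 0$ everywhere. Put $\boldsymbol\tau=\mathbf g'/\|\mathbf g'\|$, $\mathbf n=(\tau_2,-\tau_1)$, $\kappa=\det(\mathbf g',\mathbf g'')/\|\mathbf g'\|^3$, $P(\eta,\xi)=\mathbf g(\xi)+\eta\,\mathbf n(\xi)$, $\rho=\|\mathbf g'(\xi)\|(1+\eta\kappa(\xi))$, and let $\mathcal L\varphi=\rho^{-1}\big(\partial_\eta(\rho\,\partial_\eta\varphi)+\partial_\xi(\rho^{-1}\partial_\xi\varphi)\big)$ be the Laplacian in the coordinates $(\eta,\xi)$, i.e. $\mathcal L(u\circ P)=(\Delta u)\circ P$. Let $\Omega\supset\Gamma$ be an open axis-parallel rectangle, split by $\Gamma$ into two subdomains $\Omega^\pm$ with $\partial\Omega^+\cap\partial\Omega^-=\Gamma$ and $\mathbf n$ pointing from $\Omega^-$ towards $\Omega^+$. Let $\beta=\beta^\pm$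 on $\Omega^\pm$ with constants $\beta^+\ge\beta^->0$, and put $\gamma=(\beta^+)^2/\beta^-$. Let $\mathcal T_h$ be a uniform rectangular mesh of $\Omega$, $h$ the diameter of each element, $\mathcal E_h$ its set of edges. An element is an interface element if its interior meets $\Gamma$. For an interface element $K$ (and $h$ small) let $[\xi_0,\xi_1]$ be the smallest interval with $K\subset P([-h,h]\times[\xi_0,\xi_1])$ (unique up to multiples of $T$), and let $R$ be the inverse of $P$ on $K$ with values in $[-h,h]\times[\xi_0,\xi_1]$. Let $Q^m$ be the polynomials of degree at most $m$ in each variable, and let $\mathcal V^m_\beta(K)$ be the set of functions $\hat\phi\circ R$ on $K$, where $\hat\phi=p^+$ for $\eta>0$ and $\hat\phi=p^-$ for $\eta<0$ with $p^\pm\in Q^m$ such that, on $\{0\}\times[\xi_0,\xi_1]$, $p^+=p^-$, $\beta^+p^+_\eta=\beta^-p^-_\eta$, and $$\int_{\xi_0}^{\xi_1}\big(\beta^+\partial_\eta^j\mathcal L(p^+)-\beta^-\partial_\eta^j\mathcal L(p^-)\big)(0,\xi)\,v(\xi)\,d\xi=0$$ for all polynomials $v$ of degree at most $m$ and all integers $0\le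 j\le m-2$. The global Frenet IFE space $\mathcal V^m_\beta(\mathcal T_h)$ consists of the functions $\phi$ with $\phi|_K\in Q^m$ on each non-interface element and $\phi|_K\in\mathcal V^m_\beta(K)$ on each interface element (no continuity across edges). On an interior edge $e$ shared by $K_1,K_2$, with unit normal $\mathbf n$ from $K_1$ to $K_2$, let $[\![v]\!]=v|_{K_1}-v|_{K_2}$ and $\{\!\{v\}\!\}=\frac12(v|_{K_1}+v|_{K_2})$; on a boundary edge both are $v$ and $\mathbf n$ is the outward normal. For $\sigma_0>0$ let $$a_h(u,v)=\sum_{K\in\mathcal T_h}\int_K\beta\nabla u\cdot\nabla v-\sum_{e\in\mathcal E_h}\int_e\Big(\{\!\{\beta\nabla u\cdot\mathbf n\}\!\}[\![v]\!]+\{\!\{\beta\nabla v\cdot\mathbf n\}\!\}[\![u]\!]-\frac{\sigma_0\gamma}{h}[\![u]\!][\![v]\!]\Big),$$ $$|||v|||_h^2=\sum_{K\in\mathcal T_h}\|\sqrt\beta\,\nabla v\|_{L^2(K)}^2+\frac{\gamma\sigma_0}{h}\sum_{e\in\mathcal E_h}\|[\![v]\!]\|_{L^2(e)}^2+\frac{h}{\sigma_0\gamma}\sum_{e\in\mathcal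 E_h}\|\{\!\{\beta\nabla v\cdot\mathbf n\}\!\}\|_{L^2(e)}^2 .$$ **Theorem.** For every such $m$ and $\mathbf g$ and every bound $\varrho$ on the aspect ratio of the mesh elements there are constants $C_t>0$ and $h_0>0$, depending only on $m$, $\mathbf g$ and $\varrho$ (hence independent of the mesh size, of the position of the interface relative to the mesh and of $\beta^\pm$), such that for all $\Omega$, $\Omega^\pm$, $\beta^\pm$ and $\mathcal T_h$ as above with aspect ratio at most $\varrho$ and $h<h_0$ the following hold. 1. $\displaystyle\|\beta\nabla\phi\|_{L^2(\partial K)}\le C_t\,\frac{\beta^+}{\sqrt{\beta^-}}\,h^{-1/2}\,\|\sqrt\beta\,\nabla\phi\|_{L^2(K)}$ for all $\phi\in\mathcal V^m_\beta(\mathcal T_h)$ and all $K\in\mathcal T_h$. 2. If $\sigma_0>C_t^2+\frac12$, then $a_h(u_h,u_h)\ge\frac14\,|||u_h|||_h^2$ for all $u_h\in\mathcal V^m_\beta(\mathcal T_h)$. -/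

import Mathlib

open Set Filter Topology MeasureTheory

noncomputable section

namespace FrenetIFE

/-! ### The interface curve and Frenet coordinates

Points of the plane and pairs `(η, ξ)` of Frenet coordinates are elements of `ℝ × ℝ`; the Euclidean
length is always written out, so the sup norm of `ℝ × ℝ` plays no role. -/

/-- Euclidean length of a planar vector. -/
def euclLength (v : ℝ × ℝ) : ℝ := Real.sqrt (v.1 ^ 2 + v.2 ^ 2)

/-- `g` is a regular `C^k` parametrization of a closed Jordan curve, extended `T`-periodically. -/
structure IsRegularJordanCurve (k : ℕ) (T : ℝ) (g : ℝ → ℝ × ℝ) : Prop where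
  period_pos : 0 < T
  periodic : Function.Periodic g T
  contDiff : ContDiff ℝ k g
  regular : ∀ ξ, deriv g ξ ≠ 0
  injOn : InjOn g (Ico 0 T)

/-- The speed `‖g'(ξ)‖`. -/
def speed (g : ℝ → ℝ × ℝ) (ξ : ℝ) : ℝ := euclLength (deriv g ξ)

/-- The unit tangent `τ = g' / ‖g'‖`. -/
def tangent (g : ℝ → ℝ × ℝ) (ξ : ℝ) : ℝ × ℝ := (speed g ξ)⁻¹ • deriv g ξ

/-- The unit normal `n`, the tangent rotated clockwise by a right angle. -/
def normal (g : ℝ → ℝ × ℝ) (ξ : ℝ) : ℝ × ℝ := ((tangent g ξ).2, -(tangent g ξ).1)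

/-- The signed curvature `κ = det (g', g'') / ‖g'‖³`. -/
def curvature (g : ℝ → ℝ × ℝ) (ξ : ℝ) : ℝ :=
  ((deriv g ξ).1 * (deriv (deriv g) ξ).2 - (deriv g ξ).2 * (deriv (deriv g) ξ).1) / speed g ξ ^ 3

/-- The Frenet transformation `P (η, ξ) = g(ξ) + η n(ξ)`. -/
def frenetMap (g : ℝ → ℝ × ℝ) (z : ℝ × ℝ) : ℝ × ℝ := g z.2 + z.1 • normal g z.2

/-- First partial derivative of a function of two variables. -/
def pd1 (f : ℝ × ℝ → ℝ) (z : ℝ × ℝ) : ℝ := deriv (fun s => f (s, z.2)) z.1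

/-- Second partial derivative of a function of two variables. -/
def pd2 (f : ℝ × ℝ → ℝ) (z : ℝ × ℝ) : ℝ := deriv (fun s => f (z.1, s)) z.2

/-- The Jacobian `ρ = ‖g'(ξ)‖ (1 + η κ(ξ))` of the Frenet transformation. -/
def frenetJacobian (g : ℝ → ℝ × ℝ) (z : ℝ × ℝ) : ℝ := speed g z.2 * (1 + z.1 * curvature g z.2)

/-- The Laplacian in Frenet coordinates, `L φ = ρ⁻¹ (∂_η (ρ ∂_η φ) + ∂_ξ (ρ⁻¹ ∂_ξ φ))`. Since
`∂_η P = n` and `∂_ξ P = ρ τ`, the Euclidean metric is `dη² + ρ² dξ²` in these coordinates, and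
`L` is the differential operator with `L (u ∘ P) = (Δ u) ∘ P`. -/
def frenetLaplacian (g : ℝ → ℝ × ℝ) (φ : ℝ × ℝ → ℝ) (z : ℝ × ℝ) : ℝ :=
  (frenetJacobian g z)⁻¹ *
    (pd1 (fun w => frenetJacobian g w * pd1 φ w) z +
      pd2 (fun w => (frenetJacobian g w)⁻¹ * pd2 φ w) z)

/-- The space `Q^m` of tensor-product polynomials of degree at most `m` in each variable. -/
def tensorPoly (m : ℕ) : Set (ℝ × ℝ → ℝ) :=
  {f | ∃ c : ℕ → ℕ → ℝ, f = fun z =>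
    ∑ i ∈ Finset.range (m + 1), ∑ j ∈ Finset.range (m + 1), c i j * z.1 ^ i * z.2 ^ j}

/-! ### Uniform rectangular meshes -/

/-- A uniform rectangular mesh: `nx × ny` translates of a rectangle of sides `hx`, `hy`, the lower
left corner of the whole domain being `(x₀, y₀)`. -/
structure RectMesh where
  x₀ : ℝ
  y₀ : ℝ
  hx : ℝ
  hy : ℝ
  nx : ℕ
  ny : ℕ
  hx_pos : 0 < hx
  hy_pos : 0 < hy
  nx_pos : 0 < nx
  ny_pos : 0 < ny

namespace RectMesh

/-- Abscissa of the `i`-th vertical grid line. -/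
def gx (M : RectMesh) (i : ℕ) : ℝ := M.x₀ + i * M.hx

/-- Ordinate of the `j`-th horizontal grid line. -/
def gy (M : RectMesh) (j : ℕ) : ℝ := M.y₀ + j * M.hy

/-- The mesh size: the diameter of each element. -/
def h (M : RectMesh) : ℝ := Real.sqrt (M.hx ^ 2 + M.hy ^ 2)

/-- Shape regularity: the aspect ratio of the elements is at most `ϱ`. -/
def ShapeRegular (M : RectMesh) (ϱ : ℝ) : Prop := M.hx ≤ ϱ * M.hy ∧ M.hy ≤ ϱ * M.hx

/-- The open rectangle `Ω`. -/
def domain (M : RectMesh) : Set (ℝ × ℝ) :=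
  Ioo (M.gx 0) (M.gx M.nx) ×ˢ Ioo (M.gy 0) (M.gy M.ny)

/-- The closed element with indices `i < nx`, `j < ny`. -/
def elem (M : RectMesh) (i j : ℕ) : Set (ℝ × ℝ) :=
  Icc (M.gx i) (M.gx (i + 1)) ×ˢ Icc (M.gy j) (M.gy (j + 1))

/-- The centre of an element. -/
def center (M : RectMesh) (i j : ℕ) : ℝ × ℝ :=
  ((M.gx i + M.gx (i + 1)) / 2, (M.gy j + M.gy (j + 1)) / 2)

/-- An interface element is one whose interior meets the interface `Γ = range g`. -/
def IsInterfaceElem (M : RectMesh) (g : ℝ → ℝ × ℝ) (i j : ℕ) : Prop :=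
  (interior (M.elem i j) ∩ range g).Nonempty

/-- `Ω` is split by the interface `Γ = range g ⊆ Ω` into the subdomains `Ω⁺` and `Ω⁻`, and the
normal of `Γ` points from `Ω⁻` towards `Ω⁺`. -/
structure IsSplit (M : RectMesh) (g : ℝ → ℝ × ℝ) (Ωp Ωm : Set (ℝ × ℝ)) : Prop where
  range_subset : range g ⊆ M.domain
  isOpen_p : IsOpen Ωp
  isOpen_m : IsOpen Ωm
  isConnected_p : IsConnected Ωp
  isConnected_m : IsConnected Ωm
  disjoint : Disjoint Ωp Ωm
  union_eq : Ωp ∪ Ωm = M.domain \ range g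
  frontier_inter : frontier Ωp ∩ frontier Ωm = range g
  normal_dir : ∀ ξ, ∀ᶠ t in 𝓝[>] (0 : ℝ), g ξ + t • normal g ξ ∈ Ωp ∧ g ξ - t • normal g ξ ∈ Ωm

end RectMesh

/-! ### The Frenet IFE spaces

A side is a Boolean: `true` stands for `+` and `false` for `-`. -/

/-- `[ξ₀, ξ₁]` is the parameter interval of the fictitious element of `K`: the rectangle
`[-h, h] × [ξ₀, ξ₁]` is mapped by `P` onto a superset of `K`, and both end points are attained on
`K`, so that `[ξ₀, ξ₁]` is the smallest such interval. As `g` is periodic, the interval is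
determined up to a translation by a multiple of the period `T`. -/
structure IsFictitious (T : ℝ) (g : ℝ → ℝ × ℝ) (h : ℝ) (K : Set (ℝ × ℝ)) (ξ₀ ξ₁ : ℝ) : Prop where
  length_lt : ξ₁ - ξ₀ < T
  cover : K ⊆ frenetMap g '' (Icc (-h) h ×ˢ Icc ξ₀ ξ₁)
  left_attained : ∃ η ∈ Icc (-h) h, frenetMap g (η, ξ₀) ∈ K
  right_attained : ∃ η ∈ Icc (-h) h, frenetMap g (η, ξ₁) ∈ K

/-- The Frenet interface element `K̂`, the set of Frenet coordinates of the points of `K`. -/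
def frenetElem (g : ℝ → ℝ × ℝ) (h : ℝ) (K : Set (ℝ × ℝ)) (ξ₀ ξ₁ : ℝ) : Set (ℝ × ℝ) :=
  (Icc (-h) h ×ˢ Icc ξ₀ ξ₁) ∩ frenetMap g ⁻¹' K

/-- The local space in Frenet coordinates: piecewise polynomials, given by the polynomial `p true`
for `η > 0` and the polynomial `p false` for `η < 0`, that satisfy the interface conditions
on the segment `{0} × [ξ₀, ξ₁]`. -/
structure IsLocalIFE (m : ℕ) (g : ℝ → ℝ × ℝ) (β : Bool → ℝ) (ξ₀ ξ₁ : ℝ)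
    (p : Bool → ℝ × ℝ → ℝ) : Prop where
  poly : ∀ s, p s ∈ tensorPoly m
  jump : ∀ ξ ∈ Icc ξ₀ ξ₁, p true (0, ξ) - p false (0, ξ) = 0
  flux : ∀ ξ ∈ Icc ξ₀ ξ₁, β true * pd1 (p true) (0, ξ) - β false * pd1 (p false) (0, ξ) = 0
  extended : ∀ j : ℕ, j + 2 ≤ m → ∀ q : Polynomial ℝ, q.natDegree ≤ m →
    ∫ ξ in ξ₀..ξ₁,
      (β true * iteratedDeriv j (fun η => frenetLaplacian g (p true) (η, ξ)) 0 -
        β false * iteratedDeriv j (fun η => frenetLaplacian g (p false) (η, ξ)) 0) * q.eval ξ = 0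

/-- A broken function: `u i j s` is the branch on the part of the element `(i, j)` that lies in
`Ω^s`, smoothly continued to a neighbourhood of the element. -/
abbrev BrokenFun := ℕ → ℕ → Bool → ℝ × ℝ → ℝ

/-- The global discontinuous Frenet IFE space: on a non-interface element a single polynomial in
`Q^m`; on an interface element a function `φ` with `φ ∘ P = φ̂` for some `φ̂` in the local space. -/
def ifeSpace (m : ℕ) (T : ℝ) (g : ℝ → ℝ × ℝ) (M : RectMesh) (β : Bool → ℝ) : Set BrokenFun :=
  {u | ∀ i < M.nx, ∀ j < M.ny,
    (¬ M.IsInterfaceElem g i j →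
      ∃ p ∈ tensorPoly m, ∀ s, ∀ᶠ x in 𝓝ˢ (M.elem i j), u i j s x = p x) ∧
    (M.IsInterfaceElem g i j →
      ∃ ξ₀ ξ₁ : ℝ, ∃ p : Bool → ℝ × ℝ → ℝ,
        IsFictitious T g M.h (M.elem i j) ξ₀ ξ₁ ∧ IsLocalIFE m g β ξ₀ ξ₁ p ∧
        ∀ s, ∀ᶠ z in 𝓝ˢ (frenetElem g M.h (M.elem i j) ξ₀ ξ₁),
          u i j s (frenetMap g z) = p s z)}

/-! ### The discrete bilinear form and the norms -/

open Classical in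
/-- The side on which a point `x` of the element `(i, j)` lies, as seen from inside the element:
`+` if all points slightly closer to the centre of the element are in `Ω⁺`. For points off the
interface this is the side of `x`; at points of the boundary of the element it selects
the branch whose one-sided limit is the trace from the element. -/
def sideAt (M : RectMesh) (Ωp : Set (ℝ × ℝ)) (i j : ℕ) (x : ℝ × ℝ) : Bool :=
  decide (∀ᶠ t in 𝓝[>] (0 : ℝ), x + t • (M.center i j - x) ∈ Ωp)

/-- Value (or trace) at `x` of `u` from the element `(i, j)`. -/
def val (M : RectMesh) (Ωp : Set (ℝ × ℝ)) (u : BrokenFun) (i j : ℕ) (x : ℝ × ℝ) : ℝ :=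
  u i j (sideAt M Ωp i j x) x

/-- The coefficient `β` at `x` from the element `(i, j)`. -/
def coef (M : RectMesh) (Ωp : Set (ℝ × ℝ)) (β : Bool → ℝ) (i j : ℕ) (x : ℝ × ℝ) : ℝ :=
  β (sideAt M Ωp i j x)

/-- The gradient of `u` at `x` from the element `(i, j)`. -/
def grad (M : RectMesh) (Ωp : Set (ℝ × ℝ)) (u : BrokenFun) (i j : ℕ) (x : ℝ × ℝ) : ℝ × ℝ :=
  (pd1 (u i j (sideAt M Ωp i j x)) x, pd2 (u i j (sideAt M Ωp i j x)) x)

/-- Sum over all elements. -/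
def elemSum (M : RectMesh) (F : ℕ → ℕ → ℝ × ℝ → ℝ) : ℝ :=
  ∑ i ∈ Finset.range M.nx, ∑ j ∈ Finset.range M.ny, ∫ x in M.elem i j, F i j x

/-- Sum over all edges: `V i j` is integrated over the edge `{gx i} × [gy j, gy (j+1)]` and
`H i j` over the edge `[gx i, gx (i+1)] × {gy j}`. -/
def edgeSum (M : RectMesh) (V H : ℕ → ℕ → ℝ × ℝ → ℝ) : ℝ :=
  (∑ i ∈ Finset.range (M.nx + 1), ∑ j ∈ Finset.range M.ny,
    ∫ y in (M.gy j)..(M.gy (j + 1)), V i j (M.gx i, y)) +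
  ∑ i ∈ Finset.range M.nx, ∑ j ∈ Finset.range (M.ny + 1),
    ∫ x in (M.gx i)..(M.gx (i + 1)), H i j (x, M.gy j)

/-- Jump on a vertical edge of a quantity `w` with traces from each element; the value itself on
boundary edges. -/
def jumpV (M : RectMesh) (w : ℕ → ℕ → ℝ × ℝ → ℝ) (i j : ℕ) (x : ℝ × ℝ) : ℝ :=
  if i = 0 then w 0 j x else if i = M.nx then w (i - 1) j x else w (i - 1) j x - w i j x

/-- Jump on a horizontal edge. -/
def jumpH (M : RectMesh) (w : ℕ → ℕ → ℝ × ℝ → ℝ) (i j : ℕ) (x : ℝ × ℝ) : ℝ :=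
  if j = 0 then w i 0 x else if j = M.ny then w i (j - 1) x else w i (j - 1) x - w i j x

/-- Average on a vertical edge; the value itself on boundary edges. -/
def avgV (M : RectMesh) (w : ℕ → ℕ → ℝ × ℝ → ℝ) (i j : ℕ) (x : ℝ × ℝ) : ℝ :=
  if i = 0 then w 0 j x else if i = M.nx then w (i - 1) j x else (w (i - 1) j x + w i j x) / 2

/-- Average on a horizontal edge. -/
def avgH (M : RectMesh) (w : ℕ → ℕ → ℝ × ℝ → ℝ) (i j : ℕ) (x : ℝ × ℝ) : ℝ :=
  if j = 0 then w i 0 x else if j = M.ny then w i (j - 1) x else (w i (j - 1) x + w i j x) / 2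

/-- The nonzero component of the unit normal of an edge on the `i`-th grid line: it points to the
right (or up), except on the first grid line, where the outward normal points to the left (down). -/
def edgeSign (i : ℕ) : ℝ := if i = 0 then -1 else 1

/-- The average `{{β ∇u · n}}` on a vertical edge. -/
def avgFluxV (M : RectMesh) (Ωp : Set (ℝ × ℝ)) (β : Bool → ℝ) (u : BrokenFun) (i j : ℕ)
    (x : ℝ × ℝ) : ℝ :=
  avgV M (fun k l x => coef M Ωp β k l x * ((grad M Ωp u k l x).1 * edgeSign i)) i j x

/-- The average `{{β ∇u · n}}` on a horizontal edge. -/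
def avgFluxH (M : RectMesh) (Ωp : Set (ℝ × ℝ)) (β : Bool → ℝ) (u : BrokenFun) (i j : ℕ)
    (x : ℝ × ℝ) : ℝ :=
  avgH M (fun k l x => coef M Ωp β k l x * ((grad M Ωp u k l x).2 * edgeSign j)) i j x

/-- The weight `γ = (β⁺)² / β⁻`. -/
def gam (β : Bool → ℝ) : ℝ := β true ^ 2 / β false

/-- The symmetric interior penalty bilinear form `a_h(u, v)`. -/
def bilin (M : RectMesh) (Ωp : Set (ℝ × ℝ)) (β : Bool → ℝ) (σ₀ : ℝ) (u v : BrokenFun) : ℝ :=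
  elemSum M (fun i j x => coef M Ωp β i j x *
    ((grad M Ωp u i j x).1 * (grad M Ωp v i j x).1 +
      (grad M Ωp u i j x).2 * (grad M Ωp v i j x).2)) -
  edgeSum M
    (fun i j x =>
      avgFluxV M Ωp β u i j x * jumpV M (val M Ωp v) i j x +
        avgFluxV M Ωp β v i j x * jumpV M (val M Ωp u) i j x -
        σ₀ * gam β / M.h * (jumpV M (val M Ωp u) i j x * jumpV M (val M Ωp v) i j x))
    (fun i j x =>
      avgFluxH M Ωp β u i j x * jumpH M (val M Ωp v) i j x +
        avgFluxH M Ωp β v i j x * jumpH M (val M Ωp u) i j x -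
        σ₀ * gam β / M.h * (jumpH M (val M Ωp u) i j x * jumpH M (val M Ωp v) i j x))

/-- The square of the norm `‖v‖_h`. -/
def normSq (M : RectMesh) (Ωp : Set (ℝ × ℝ)) (β : Bool → ℝ) (σ₀ : ℝ) (v : BrokenFun) : ℝ :=
  elemSum M (fun i j x => coef M Ωp β i j x * euclLength (grad M Ωp v i j x) ^ 2) +
  gam β * σ₀ / M.h * edgeSum M (fun i j x => jumpV M (val M Ωp v) i j x ^ 2)
    (fun i j x => jumpH M (val M Ωp v) i j x ^ 2)

/-- The square of the energy norm `|||v|||_h`. -/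
def energySq (M : RectMesh) (Ωp : Set (ℝ × ℝ)) (β : Bool → ℝ) (σ₀ : ℝ) (v : BrokenFun) : ℝ :=
  normSq M Ωp β σ₀ v +
  M.h / (σ₀ * gam β) * edgeSum M (fun i j x => avgFluxV M Ωp β v i j x ^ 2)
    (fun i j x => avgFluxH M Ωp β v i j x ^ 2)

/-- Integral over the boundary of an element. -/
def bdryIntegral (M : RectMesh) (i j : ℕ) (F : ℝ × ℝ → ℝ) : ℝ :=
  (∫ y in (M.gy j)..(M.gy (j + 1)), F (M.gx i, y)) +
  (∫ y in (M.gy j)..(M.gy (j + 1)), F (M.gx (i + 1), y)) +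
  (∫ x in (M.gx i)..(M.gx (i + 1)), F (x, M.gy j)) +
  ∫ x in (M.gx i)..(M.gx (i + 1)), F (x, M.gy (j + 1))

/-- The global trace inequality with constant `C`:
`‖β ∇φ‖_{L²(∂K)} ≤ C β⁺ (β⁻)^{-1/2} h^{-1/2} ‖√β ∇φ‖_{L²(K)}` for all `φ` in the global Frenet
IFE space and all elements `K`. -/
def TraceInequality (m : ℕ) (T : ℝ) (g : ℝ → ℝ × ℝ) (M : RectMesh) (Ωp : Set (ℝ × ℝ))
    (β : Bool → ℝ) (C : ℝ) : Prop :=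
  ∀ φ ∈ ifeSpace m T g M β, ∀ i < M.nx, ∀ j < M.ny,
    Real.sqrt (bdryIntegral M i j
        (fun x => (coef M Ωp β i j x * euclLength (grad M Ωp φ i j x)) ^ 2)) ≤
      C * (β true / Real.sqrt (β false)) * (Real.sqrt M.h)⁻¹ *
        Real.sqrt (∫ x in M.elem i j, coef M Ωp β i j x * euclLength (grad M Ωp φ i j x) ^ 2)

end FrenetIFE

end

noncomputable section

namespace FrenetIFE

/-! ### Inverse inequalities for polynomials -/

/-! Both claims rest on one pointwise fact, `HasGoodBox`: every element contains a square of side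
comparable with h at each point of which the energy density β|∇u|², multiplied by γ and a constant,
dominates the squared flux (β|∇u|)² at every point of the element. Integration over the square
bounds the flux by the energy of the element divided by h², and since ∂K has length at most 4h this
is the trace inequality with factor γ/h (`trace_of_goodBox`).

For a single polynomial such a square exists by finite dimension and scaling. Near a maximum point
of the gradient on a small box the gradient keeps half of its size, and this maximum controls the
gradient on any comparably larger box (`tensorPoly_good_box`). This settles the non-interface
elements.

On an interface element the argument runs in Frenet coordinates, where P is bi-Lipschitz near Γ
(`exists_tubularBounds`). The Frenet element contains a box of size r ~ h around its centre; a shift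
in η gives a box lying on one side s₀ only, however Γ cuts the element (`exists_side_box`). The
branch p^{s₀} is controlled from there, and the other branch has to be compared with it.

For this comparison put D = β⁺p⁺ − β⁻p⁻ = ∑ₖ ηᵏ eₖ(ξ). Continuity gives e₀ = (β⁺ − β⁻) p^{s₀}(0,·),
so |e₀'| is at most β⁺ times the tangential derivative of p^{s₀}; flux continuity gives e₁ = 0. The
j-th normal derivative of 𝓛D at η = 0 is (j+2)! e_{j+2} plus terms in e₀', e₀'' and in lower eₖ with
k ≥ 1, and it is orthogonal to polynomials of degree at most m. Testing with e_{j+2} itself bounds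
this coefficient by the lower ones (`moment_bound`, `fluxJump_coeff_step`), and the powers of r
balance so that |∇D| ≤ C β⁺ sup|∇p^{s₀}| (`fluxJump_grad_bound`). Hence β^s|∇p^s| ≤ C β⁺
sup|∇p^{s₀}| on both sides (`localIFE_grad_bound`), with C independent of β, and (β⁺)² = γβ⁻ ≤
γβ^{s₀} produces the weight γ.

Coercivity is the usual interior penalty argument: Young's inequality on each edge, with the
averaged fluxes absorbed by the trace inequality (`coercivity_of_trace`). -/

lemma poly_coeff_bound (m : ℕ) : ∃ C : ℝ, 0 < C ∧ ∀ q : Polynomial ℝ, q.natDegree ≤ m →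
    ∀ S : ℝ, (∀ t ∈ Icc (-1 : ℝ) 1, |q.eval t| ≤ S) → ∀ i, |q.coeff i| ≤ C * S := by
  -- At m + 1 distinct nodes in [0, 1) the coefficients are the inverse Vandermonde matrix applied
  -- to the values; the sum of its entries in absolute value serves as the constant.
  set x : Fin (m + 1) → ℝ := fun k => (k : ℝ) / (m + 1) with hx
  have hinj : Function.Injective x := by
    intro a b hab
    have h0 : ((m : ℝ) + 1) ≠ 0 := by positivity
    simp only [hx] at hab
    rw [div_left_inj' h0] at hab
    exact Fin.ext (by exact_mod_cast hab)
  set V := Matrix.vandermonde x with hV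
  have hdet : IsUnit V.det := (Matrix.det_vandermonde_ne_zero_iff.mpr hinj).isUnit
  refine ⟨∑ i, ∑ k, |V⁻¹ i k| + 1, by positivity, ?_⟩
  intro q hq S hS i
  have hS0 : 0 ≤ S := (abs_nonneg _).trans (hS 0 (by norm_num))
  by_cases hi : i < m + 1
  · set c : Fin (m + 1) → ℝ := fun k => q.coeff k with hc
    have hval : V.mulVec c = fun k => q.eval (x k) := by
      funext k
      rw [Polynomial.eval_eq_sum_range' (Nat.lt_succ_of_le hq), Finset.sum_range]
      simp only [Matrix.mulVec, dotProduct, hV, Matrix.vandermonde_apply, hc]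
      exact Finset.sum_congr rfl fun j _ => mul_comm _ _
    have hinv : c = V⁻¹.mulVec (fun k => q.eval (x k)) := by
      rw [← hval, Matrix.mulVec_mulVec, Matrix.nonsing_inv_mul _ hdet, Matrix.one_mulVec]
    have hci : q.coeff i = ∑ k, V⁻¹ ⟨i, hi⟩ k * q.eval (x k) := by
      have := congrFun hinv ⟨i, hi⟩
      simpa [hc, Matrix.mulVec, dotProduct] using this
    rw [hci]
    have hnode : ∀ k, |q.eval (x k)| ≤ S := by
      intro k
      apply hS
      have hk : (k : ℝ) ≤ m + 1 := by exact_mod_cast k.2.le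
      have h0 : (0 : ℝ) < m + 1 := by positivity
      have h1 : 0 ≤ x k := by simp only [hx]; positivity
      have h2 : x k ≤ 1 := by simp only [hx]; rw [div_le_one h0]; exact hk
      exact ⟨by linarith, h2⟩
    calc |∑ k, V⁻¹ ⟨i, hi⟩ k * q.eval (x k)| ≤ ∑ k, |V⁻¹ ⟨i, hi⟩ k * q.eval (x k)| :=
          Finset.abs_sum_le_sum_abs _ _
      _ ≤ ∑ k, |V⁻¹ ⟨i, hi⟩ k| * S := by
          refine Finset.sum_le_sum fun k _ => ?_
          rw [abs_mul]
          exact mul_le_mul_of_nonneg_left (hnode k) (abs_nonneg _)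
      _ = (∑ k, |V⁻¹ ⟨i, hi⟩ k|) * S := by rw [Finset.sum_mul]
      _ ≤ (∑ i, ∑ k, |V⁻¹ i k| + 1) * S := by
          refine mul_le_mul_of_nonneg_right ?_ hS0
          have := Finset.single_le_sum (f := fun i => ∑ k, |V⁻¹ i k|)
            (fun i _ => Finset.sum_nonneg fun k _ => abs_nonneg _) (Finset.mem_univ ⟨i, hi⟩)
          have h2 : ∑ k, |V⁻¹ ⟨i, hi⟩ k| ≤ ∑ i, ∑ k, |V⁻¹ i k| := this
          linarith
  · rw [Polynomial.coeff_eq_zero_of_natDegree_lt (by omega), abs_zero]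
    positivity

lemma poly_eval_bound {m : ℕ} {q : Polynomial ℝ} (hq : q.natDegree ≤ m) {A Λ t : ℝ}
    (hA : ∀ i, |q.coeff i| ≤ A) (hΛ : 1 ≤ Λ) (ht : |t| ≤ Λ) :
    |q.eval t| ≤ (m + 1) * A * Λ ^ m := by
  have hA0 : 0 ≤ A := (abs_nonneg _).trans (hA 0)
  rw [Polynomial.eval_eq_sum_range' (Nat.lt_succ_of_le hq)]
  calc |∑ i ∈ Finset.range (m + 1), q.coeff i * t ^ i|
      ≤ ∑ i ∈ Finset.range (m + 1), |q.coeff i * t ^ i| := Finset.abs_sum_le_sum_abs _ _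
    _ ≤ ∑ i ∈ Finset.range (m + 1), A * Λ ^ m := by
        refine Finset.sum_le_sum fun i hi => ?_
        rw [abs_mul, abs_pow]
        have : |t| ^ i ≤ Λ ^ m := (pow_le_pow_left₀ (abs_nonneg _) ht i).trans
          (pow_le_pow_right₀ hΛ (by simpa [Nat.lt_succ_iff] using hi))
        exact mul_le_mul (hA i) this (by positivity) hA0
    _ = (m + 1) * A * Λ ^ m := by simp; ring

/-- Extension and inverse inequality for univariate polynomials. -/
lemma poly_inverse (m : ℕ) (Λ : ℝ) : ∃ C : ℝ, 1 ≤ C ∧ ∀ q : Polynomial ℝ, q.natDegree ≤ m →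
    ∀ a r S : ℝ, 0 < r → (∀ t, |t - a| ≤ r → |q.eval t| ≤ S) →
      ∀ t, |t - a| ≤ Λ * r → |q.eval t| ≤ C * S ∧ |q.derivative.eval t| ≤ C * S / r := by
  obtain ⟨C₀, hC₀, hb⟩ := poly_coeff_bound m
  set Λ' := max 1 Λ
  have hΛ' : 1 ≤ Λ' := le_max_left _ _
  refine ⟨max 1 ((m + 1) * ((m + 1) * C₀) * Λ' ^ m), le_max_left _ _, ?_⟩
  intro q hq a r S hr hS t ht
  have hS0 : 0 ≤ S := (abs_nonneg _).trans (hS a (by simpa using hr.le))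
  -- The substitution t = a + r s reduces to the interval [-1, 1], so the constant does not depend
  -- on a and r, and a derivative costs one factor 1/r.
  set q' := q.comp (Polynomial.C a + Polynomial.C r * Polynomial.X) with hq'
  have hev : ∀ s, q'.eval s = q.eval (a + r * s) := by
    intro s; simp [hq', Polynomial.eval_comp]
  have hdev : ∀ s, q'.derivative.eval s = r * q.derivative.eval (a + r * s) := by
    intro s; simp [hq', Polynomial.derivative_comp, Polynomial.eval_comp]
  have hdeg : q'.natDegree ≤ m := by
    refine (Polynomial.natDegree_comp_le).trans ?_
    have : (Polynomial.C a + Polynomial.C r * Polynomial.X : Polynomial ℝ).natDegree ≤ 1 := by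
      compute_degree
    calc _ ≤ q.natDegree * 1 := Nat.mul_le_mul_left _ this
      _ ≤ m := by simpa using hq
  have hco : ∀ i, |q'.coeff i| ≤ C₀ * S := by
    refine hb q' hdeg S fun s hs => ?_
    rw [hev]
    apply hS
    rw [add_sub_cancel_left, abs_mul, abs_of_pos hr]
    exact mul_le_of_le_one_right hr.le (abs_le.mpr hs)
  have hdco : ∀ i, |q'.derivative.coeff i| ≤ (m + 1) * (C₀ * S) := by
    intro i
    rw [Polynomial.coeff_derivative, abs_mul]
    by_cases hi : i + 1 ≤ m
    · rw [mul_comm]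
      refine mul_le_mul ?_ (hco _) (abs_nonneg _) (by positivity)
      rw [abs_of_nonneg (by positivity)]
      have : ((i + 1 : ℕ) : ℝ) ≤ m := by exact_mod_cast hi
      push_cast at this; linarith
    · rw [Polynomial.coeff_eq_zero_of_natDegree_lt (by omega), abs_zero, zero_mul]
      positivity
  have hs : |(t - a) / r| ≤ Λ' := by
    rw [abs_div, abs_of_pos hr, div_le_iff₀ hr]
    exact ht.trans (mul_le_mul_of_nonneg_right (le_max_right _ _) hr.le)
  have hts : a + r * ((t - a) / r) = t := by field_simp; ring
  have h1 := poly_eval_bound hdeg hco hΛ' hs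
  have h2 := poly_eval_bound ((Polynomial.natDegree_derivative_le _).trans
    ((Nat.sub_le _ _).trans hdeg)) hdco hΛ' hs
  rw [hev, hts] at h1
  rw [hdev, hts, abs_mul, abs_of_pos hr] at h2
  have hmax : (m + 1) * ((m + 1) * C₀) * Λ' ^ m * S
      ≤ max 1 ((m + 1) * ((m + 1) * C₀) * Λ' ^ m) * S :=
    mul_le_mul_of_nonneg_right (le_max_right _ _) hS0
  constructor
  · refine h1.trans (le_trans ?_ hmax)
    have : (m + 1) * (C₀ * S) * Λ' ^ m * 1 ≤ (m + 1) * (C₀ * S) * Λ' ^ m * ((m : ℝ) + 1) :=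
      mul_le_mul_of_nonneg_left (by linarith [(Nat.cast_nonneg m : (0 : ℝ) ≤ m)]) (by positivity)
    linarith [this]
  · rw [le_div_iff₀ hr, mul_comm]
    refine h2.trans (le_trans (le_of_eq ?_) hmax)
    ring

/-! ### Tensor-product polynomials -/

/-- The expansion in powers of the normal variable η, with polynomial coefficients in ξ, is the form
in which the interface conditions become conditions on single coefficients. -/
lemma mem_tensorPoly_iff_expand {m : ℕ} {f : ℝ × ℝ → ℝ} :
    f ∈ tensorPoly m ↔ ∃ a : ℕ → Polynomial ℝ, (∀ k, (a k).natDegree ≤ m) ∧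
      f = fun z => ∑ k ∈ Finset.range (m + 1), z.1 ^ k * (a k).eval z.2 := by
  constructor
  · rintro ⟨c, rfl⟩
    refine ⟨fun k => ∑ j ∈ Finset.range (m + 1), Polynomial.C (c k j) * Polynomial.X ^ j, ?_, ?_⟩
    · intro k
      refine Polynomial.natDegree_sum_le_of_forall_le _ _ fun j hj => ?_
      exact (Polynomial.natDegree_C_mul_X_pow_le _ _).trans
        (by simpa [Nat.lt_succ_iff] using hj)
    · funext z
      refine Finset.sum_congr rfl fun k _ => ?_
      rw [Polynomial.eval_finsetSum, Finset.mul_sum]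
      refine Finset.sum_congr rfl fun j _ => ?_
      simp
      ring
  · rintro ⟨a, ha, rfl⟩
    refine ⟨fun i j => (a i).coeff j, ?_⟩
    funext z
    refine Finset.sum_congr rfl fun k _ => ?_
    rw [Polynomial.eval_eq_sum_range' (Nat.lt_succ_of_le (ha k)), Finset.mul_sum]
    refine Finset.sum_congr rfl fun j _ => ?_
    ring

lemma tensorPoly_swap {m : ℕ} {f : ℝ × ℝ → ℝ} (hf : f ∈ tensorPoly m) :
    (fun z : ℝ × ℝ => f (z.2, z.1)) ∈ tensorPoly m := by
  obtain ⟨c, rfl⟩ := hf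
  refine ⟨fun i j => c j i, ?_⟩
  funext z
  rw [Finset.sum_comm]
  refine Finset.sum_congr rfl fun k _ => Finset.sum_congr rfl fun j _ => ?_
  ring

lemma tensorPoly_slice2 {m : ℕ} {f : ℝ × ℝ → ℝ} (hf : f ∈ tensorPoly m) (x : ℝ) :
    ∃ q : Polynomial ℝ, q.natDegree ≤ m ∧ ∀ t, f (x, t) = q.eval t := by
  obtain ⟨a, ha, rfl⟩ := mem_tensorPoly_iff_expand.mp hf
  refine ⟨∑ k ∈ Finset.range (m + 1), Polynomial.C (x ^ k) * a k, ?_, ?_⟩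
  · exact Polynomial.natDegree_sum_le_of_forall_le _ _ fun j _ =>
      (Polynomial.natDegree_C_mul_le _ _).trans (ha j)
  · intro t
    simp [Polynomial.eval_finsetSum]

lemma tensorPoly_slice1 {m : ℕ} {f : ℝ × ℝ → ℝ} (hf : f ∈ tensorPoly m) (y : ℝ) :
    ∃ q : Polynomial ℝ, q.natDegree ≤ m ∧ ∀ t, f (t, y) = q.eval t :=
  tensorPoly_slice2 (tensorPoly_swap hf) y

lemma pd2_expand {m : ℕ} (a : ℕ → Polynomial ℝ) :
    pd2 (fun z => ∑ k ∈ Finset.range (m + 1), z.1 ^ k * (a k).eval z.2) =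
      fun z => ∑ k ∈ Finset.range (m + 1), z.1 ^ k * (a k).derivative.eval z.2 := by
  funext z
  unfold pd2
  apply HasDerivAt.deriv
  apply HasDerivAt.fun_sum
  intro k _
  exact ((a k).hasDerivAt z.2).const_mul (z.1 ^ k)

lemma pd2_mem_tensorPoly {m : ℕ} {f : ℝ × ℝ → ℝ} (hf : f ∈ tensorPoly m) :
    pd2 f ∈ tensorPoly m := by
  obtain ⟨a, ha, rfl⟩ := mem_tensorPoly_iff_expand.mp hf
  rw [pd2_expand]
  exact mem_tensorPoly_iff_expand.mpr ⟨fun k => (a k).derivative, fun k =>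
    (Polynomial.natDegree_derivative_le _).trans ((Nat.sub_le _ _).trans (ha k)), rfl⟩

lemma pd1_mem_tensorPoly {m : ℕ} {f : ℝ × ℝ → ℝ} (hf : f ∈ tensorPoly m) :
    pd1 f ∈ tensorPoly m :=
  tensorPoly_swap (pd2_mem_tensorPoly (tensorPoly_swap hf))

lemma tensorPoly_contDiff {m : ℕ} {f : ℝ × ℝ → ℝ} (hf : f ∈ tensorPoly m) {n : WithTop ℕ∞} :
    ContDiff ℝ n f := by
  obtain ⟨c, rfl⟩ := hf
  fun_prop

lemma abs_fst_sub_le (z w : ℝ × ℝ) : |z.1 - w.1| ≤ ‖z - w‖ := norm_fst_le (z - w)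

lemma abs_snd_sub_le (z w : ℝ × ℝ) : |z.2 - w.2| ≤ ‖z - w‖ := norm_snd_le (z - w)

/-- Extension and inverse inequality for tensor-product polynomials. -/
lemma tensorPoly_inverse (m : ℕ) (Λ : ℝ) : ∃ C : ℝ, 1 ≤ C ∧ ∀ f ∈ tensorPoly m,
    ∀ (b : ℝ × ℝ) (r S : ℝ), 0 < r → (∀ z, ‖z - b‖ ≤ r → |f z| ≤ S) →
      ∀ z, ‖z - b‖ ≤ Λ * r → |f z| ≤ C * S ∧ |pd1 f z| ≤ C * S / r ∧ |pd2 f z| ≤ C * S / r := by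
  obtain ⟨C, hC, hb⟩ := poly_inverse m Λ
  refine ⟨C * C, by nlinarith, ?_⟩
  intro f hf b r S hr hS z hz
  have hS0 : 0 ≤ S := (abs_nonneg _).trans (hS b (by simpa using hr.le))
  have hz1 := (abs_fst_sub_le z b).trans hz
  have hz2 := (abs_snd_sub_le z b).trans hz
  -- The bound is extended along slices, one variable at a time, which squares the constant. The
  -- derivatives are those of the last slice.
  have hfst : ∀ s t, |s - b.1| ≤ Λ * r → |t - b.2| ≤ r → |f (s, t)| ≤ C * S := by
    intro s t hs ht
    obtain ⟨q, hq, hqe⟩ := tensorPoly_slice1 hf t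
    rw [hqe]
    refine (hb q hq b.1 r S hr ?_ s hs).1
    intro u hu
    rw [← hqe]
    exact hS _ (by rw [Prod.norm_def]; exact max_le hu ht)
  have hsnd : ∀ s t, |s - b.1| ≤ r → |t - b.2| ≤ Λ * r → |f (s, t)| ≤ C * S := by
    intro s t hs ht
    obtain ⟨q, hq, hqe⟩ := tensorPoly_slice2 hf s
    rw [hqe]
    refine (hb q hq b.2 r S hr ?_ t ht).1
    intro u hu
    rw [← hqe]
    exact hS _ (by rw [Prod.norm_def]; exact max_le hs hu)
  obtain ⟨q, hq, hqe⟩ := tensorPoly_slice2 hf z.1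
  obtain ⟨q', hq', hqe'⟩ := tensorPoly_slice1 hf z.2
  have h1 := hb q hq b.2 r (C * S) hr (fun t ht => by rw [← hqe]; exact hfst _ _ hz1 ht) z.2 hz2
  have h2 := hb q' hq' b.1 r (C * S) hr (fun t ht => by rw [← hqe']; exact hsnd _ _ ht hz2)
    z.1 hz1
  have e1 : pd1 f z = q'.derivative.eval z.1 := by
    unfold pd1
    rw [funext hqe']
    exact q'.deriv
  have e2 : pd2 f z = q.derivative.eval z.2 := by
    unfold pd2
    rw [funext hqe]
    exact q.deriv
  rw [e1, e2, mul_assoc C C S]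
  refine ⟨?_, h2.2, h1.2⟩
  have : f z = q.eval z.2 := hqe z.2
  rw [this]
  exact h1.1

lemma pd_eq_fderiv {f : ℝ × ℝ → ℝ} {z : ℝ × ℝ} (hf : DifferentiableAt ℝ f z) :
    pd1 f z = fderiv ℝ f z (1, 0) ∧ pd2 f z = fderiv ℝ f z (0, 1) := by
  constructor
  · have h1 : HasDerivAt (fun s : ℝ => (s, z.2)) (1, 0) z.1 :=
      (hasDerivAt_id z.1).prodMk (hasDerivAt_const _ _)
    exact (HasFDerivAt.comp_hasDerivAt (f := fun s : ℝ => (s, z.2)) z.1 hf.hasFDerivAt h1).deriv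
  · have h1 : HasDerivAt (fun s : ℝ => (z.1, s)) (0, 1) z.2 :=
      (hasDerivAt_const _ _).prodMk (hasDerivAt_id z.2)
    exact (HasFDerivAt.comp_hasDerivAt (f := fun s : ℝ => (z.1, s)) z.2 hf.hasFDerivAt h1).deriv

lemma fderiv_apply_eq_pd {f : ℝ × ℝ → ℝ} {z : ℝ × ℝ} (hf : DifferentiableAt ℝ f z) (v : ℝ × ℝ) :
    fderiv ℝ f z v = v.1 * pd1 f z + v.2 * pd2 f z := by
  obtain ⟨h1, h2⟩ := pd_eq_fderiv hf
  have : v = v.1 • ((1, 0) : ℝ × ℝ) + v.2 • ((0, 1) : ℝ × ℝ) := by ext <;> simp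
  conv_lhs => rw [this]
  rw [map_add, map_smul, map_smul, h1, h2]
  simp

/-- The `ℓ¹` size of the gradient. -/
def gradSize (f : ℝ × ℝ → ℝ) (z : ℝ × ℝ) : ℝ := |pd1 f z| + |pd2 f z|

lemma gradSize_nonneg (f : ℝ × ℝ → ℝ) (z : ℝ × ℝ) : 0 ≤ gradSize f z := by
  unfold gradSize; positivity

/-- Around a suitable point of a box the gradient of a tensor-product polynomial controls the
gradient everywhere on a larger box. -/
lemma tensorPoly_good_box (m : ℕ) (Λ : ℝ) (hΛ : 1 ≤ Λ) : ∃ C ε : ℝ, 1 ≤ C ∧ 0 < ε ∧ ε ≤ 1 ∧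
    ∀ f ∈ tensorPoly m, ∀ (b : ℝ × ℝ) (r : ℝ), 0 < r → ∃ zs : ℝ × ℝ, ‖zs - b‖ ≤ r ∧
      ∀ z, ‖z - zs‖ ≤ ε * r → ∀ w, ‖w - b‖ ≤ Λ * r → gradSize f w ≤ C * gradSize f z := by
  -- The radius 2Λr ≥ 2r leaves room for a ball of radius r about the maximum point `zs`, which may
  -- lie on the boundary of the ball about b.
  obtain ⟨C, hC, hinv⟩ := tensorPoly_inverse m (2 * Λ)
  have hC0 : 0 < C := by linarith
  refine ⟨4 * C, 1 / (8 * C), by linarith, by positivity, ?_, ?_⟩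
  · rw [div_le_one (by positivity)]; linarith
  intro f hf b r hr
  have h1 := pd1_mem_tensorPoly hf
  have h2 := pd2_mem_tensorPoly hf
  have hcont : Continuous (gradSize f) := by
    unfold gradSize
    exact ((tensorPoly_contDiff h1 (n := 0)).continuous.abs).add
      ((tensorPoly_contDiff h2 (n := 0)).continuous.abs)
  obtain ⟨zs, hzs, hmax⟩ := (isCompact_closedBall b r).exists_isMaxOn
    ⟨b, Metric.mem_closedBall_self hr.le⟩ hcont.continuousOn
  set S := gradSize f zs with hS
  have hS0 : 0 ≤ S := gradSize_nonneg _ _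
  have hb1 : ∀ z, ‖z - b‖ ≤ r → gradSize f z ≤ S := fun z hz =>
    hmax (mem_closedBall_iff_norm.mpr hz)
  have i1 := hinv _ h1 b r S hr (fun z hz => (le_add_of_nonneg_right (abs_nonneg _)).trans
    (hb1 z hz))
  have i2 := hinv _ h2 b r S hr (fun z hz => (le_add_of_nonneg_left (abs_nonneg _)).trans
    (hb1 z hz))
  have hzsb : ‖zs - b‖ ≤ r := mem_closedBall_iff_norm.mp hzs
  -- The derivatives of each gradient component are at most CS/r. Within distance r/(8C) of `zs` a
  -- component therefore changes by at most 2(CS/r)·r/(8C) = S/4, and the ℓ¹ size of the gradient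
  -- stays above S/2.
  have hlip : ∀ q ∈ tensorPoly m, (∀ z, ‖z - b‖ ≤ 2 * Λ * r → |q z| ≤ C * S ∧
      |pd1 q z| ≤ C * S / r ∧ |pd2 q z| ≤ C * S / r) → ∀ z, ‖z - zs‖ ≤ 1 / (8 * C) * r →
      |q z - q zs| ≤ S / 4 := by
    intro q hq hqb z hz
    have hdiff : ∀ w, DifferentiableAt ℝ q w := fun w =>
      (tensorPoly_contDiff hq (n := 1)).differentiable (by norm_num) w
    have hε : 1 / (8 * C) ≤ 1 := by rw [div_le_one (by positivity)]; linarith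
    have hzb : ‖z - zs‖ ≤ r := hz.trans (by nlinarith)
    have := (convex_closedBall zs r).norm_image_sub_le_of_norm_fderiv_le (𝕜 := ℝ) (f := q)
      (C := 2 * (C * S / r)) (fun w _ => hdiff w) ?_ (x := zs) (y := z)
      (Metric.mem_closedBall_self hr.le) (mem_closedBall_iff_norm.mpr hzb)
    · refine this.trans ?_
      calc 2 * (C * S / r) * ‖z - zs‖ ≤ 2 * (C * S / r) * (1 / (8 * C) * r) :=
            mul_le_mul_of_nonneg_left hz (by positivity)
        _ = S / 4 := by field_simp; ring
    · intro w hw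
      have hwz : ‖w - zs‖ ≤ r := mem_closedBall_iff_norm.mp hw
      have hwb : ‖w - b‖ ≤ 2 * Λ * r := by
        calc ‖w - b‖ ≤ ‖w - zs‖ + ‖zs - b‖ := norm_sub_le_norm_sub_add_norm_sub _ _ _
          _ ≤ 2 * Λ * r := by nlinarith
      obtain ⟨-, hp1, hp2⟩ := hqb w hwb
      refine ContinuousLinearMap.opNorm_le_bound _ (by positivity) fun v => ?_
      rw [fderiv_apply_eq_pd (hdiff w), Real.norm_eq_abs]
      have hv1 : |v.1| ≤ ‖v‖ := norm_fst_le v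
      have hv2 : |v.2| ≤ ‖v‖ := norm_snd_le v
      calc |v.1 * pd1 q w + v.2 * pd2 q w| ≤ |v.1| * |pd1 q w| + |v.2| * |pd2 q w| := by
            rw [← abs_mul, ← abs_mul]; exact abs_add_le _ _
        _ ≤ ‖v‖ * (C * S / r) + ‖v‖ * (C * S / r) := by gcongr
        _ = 2 * (C * S / r) * ‖v‖ := by ring
  refine ⟨zs, hzsb, fun z hz w hw => ?_⟩
  have hw' : ‖w - b‖ ≤ 2 * Λ * r := hw.trans (by nlinarith)
  have l1 := hlip _ h1 i1 z hz
  have l2 := hlip _ h2 i2 z hz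
  have hz' : S / 2 ≤ gradSize f z := by
    have e1 := abs_sub_abs_le_abs_sub (pd1 f zs) (pd1 f z)
    have e2 := abs_sub_abs_le_abs_sub (pd2 f zs) (pd2 f z)
    rw [abs_sub_comm] at e1 e2
    have : S = |pd1 f zs| + |pd2 f zs| := rfl
    unfold gradSize
    linarith
  have hw2 : gradSize f w ≤ 2 * C * S := by
    unfold gradSize
    linarith [(i1 w hw').1, (i2 w hw').1]
  nlinarith

/-! ### Regularity and periodicity of the Frenet transformation -/

lemma IsRegularJordanCurve.of_le {k l : ℕ} {T : ℝ} {g : ℝ → ℝ × ℝ}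
    (hg : IsRegularJordanCurve k T g) (h : l ≤ k) : IsRegularJordanCurve l T g :=
  ⟨hg.period_pos, hg.periodic, hg.contDiff.of_le (by exact_mod_cast h), hg.regular, hg.injOn⟩

lemma sq_add_sq_pos {v : ℝ × ℝ} (hv : v ≠ 0) : 0 < v.1 ^ 2 + v.2 ^ 2 := by
  by_contra h
  have h1 : v.1 ^ 2 = 0 := by nlinarith [sq_nonneg v.1, sq_nonneg v.2]
  have h2 : v.2 ^ 2 = 0 := by nlinarith [sq_nonneg v.1, sq_nonneg v.2]
  exact hv (Prod.ext (by simpa using h1) (by simpa using h2))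

section Regularity

variable {n : ℕ} {T : ℝ} {g : ℝ → ℝ × ℝ}

lemma contDiff_deriv_curve (hg : IsRegularJordanCurve (n + 1) T g) : ContDiff ℝ n (deriv g) := by
  have := hg.contDiff
  push_cast at this
  exact this.deriv'

lemma speed_pos {k : ℕ} (hg : IsRegularJordanCurve k T g) (ξ : ℝ) : 0 < speed g ξ :=
  Real.sqrt_pos.mpr (sq_add_sq_pos (hg.regular ξ))

lemma contDiff_speed (hg : IsRegularJordanCurve (n + 1) T g) : ContDiff ℝ n (speed g) := by
  have h := contDiff_deriv_curve hg
  have h1 : ContDiff ℝ n (fun ξ => (deriv g ξ).1 ^ 2 + (deriv g ξ).2 ^ 2) :=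
    (h.fst.pow 2).add (h.snd.pow 2)
  exact h1.sqrt fun ξ => (sq_add_sq_pos (hg.regular ξ)).ne'

lemma contDiff_normal (hg : IsRegularJordanCurve (n + 1) T g) : ContDiff ℝ n (normal g) := by
  have h : ContDiff ℝ n (tangent g) :=
    ((contDiff_speed hg).inv fun ξ => (speed_pos hg ξ).ne').smul (contDiff_deriv_curve hg)
  exact h.snd.prodMk h.fst.neg

lemma contDiff_curvature (hg : IsRegularJordanCurve (n + 2) T g) :
    ContDiff ℝ n (curvature g) := by
  have hd : ContDiff ℝ (n + 1 : ℕ) (deriv g) := contDiff_deriv_curve hg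
  have hdd : ContDiff ℝ n (deriv (deriv g)) := by push_cast at hd; exact hd.deriv'
  have hd' : ContDiff ℝ n (deriv g) := hd.of_le (by exact_mod_cast Nat.le_succ n)
  have hs : ContDiff ℝ n (speed g) := contDiff_speed (hg.of_le (Nat.le_succ _))
  exact ((hd'.fst.mul hdd.snd).sub (hd'.snd.mul hdd.fst)).div (hs.pow 3)
    fun ξ => pow_ne_zero _ (speed_pos hg ξ).ne'

lemma contDiff_frenetMap (hg : IsRegularJordanCurve 2 T g) : ContDiff ℝ 1 (frenetMap g) := by
  have h1 : ContDiff ℝ 1 g := hg.contDiff.of_le (by norm_num)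
  have h2 : ContDiff ℝ 1 (normal g) := by exact_mod_cast contDiff_normal (n := 1) hg
  exact (h1.comp contDiff_snd).add (contDiff_fst.smul (h2.comp contDiff_snd))

lemma deriv_periodic {E : Type*} [NormedAddCommGroup E] [NormedSpace ℝ E] {f : ℝ → E} {c : ℝ}
    (hf : Function.Periodic f c) : Function.Periodic (deriv f) c := by
  intro x
  rw [← deriv_comp_add_const, funext hf]

lemma speed_periodic (hg : Function.Periodic g T) : Function.Periodic (speed g) T := by
  intro x; simp [speed, deriv_periodic hg x]

lemma curvature_periodic (hg : Function.Periodic g T) : Function.Periodic (curvature g) T := by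
  intro x
  simp [curvature, speed_periodic hg x, deriv_periodic hg x, deriv_periodic (deriv_periodic hg) x]

lemma frenetMap_add_zsmul (hg : Function.Periodic g T) (η ξ : ℝ) (k : ℤ) :
    frenetMap g (η, ξ + k • T) = frenetMap g (η, ξ) := by
  have h := hg.zsmul k
  simp [frenetMap, normal, tangent, h ξ, speed_periodic h ξ, deriv_periodic h ξ,
    -zsmul_eq_mul]

lemma exists_shift (hT : 0 < T) (x : ℝ) : ∃ k : ℤ, x + k • T ∈ Ico 0 T := by
  obtain ⟨k, hk, -⟩ := existsUnique_add_zsmul_mem_Ico hT x 0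
  exact ⟨k, by simpa using hk⟩

lemma exists_shift_near (hT : 0 < T) (x y : ℝ) : ∃ k : ℤ, |x - (y + k • T)| ≤ T / 2 := by
  obtain ⟨k, hk, -⟩ := existsUnique_add_zsmul_mem_Ico hT y (x - T / 2)
  exact ⟨k, abs_le.mpr ⟨by linarith [hk.2], by linarith [hk.1]⟩⟩

lemma abs_int_mul_lt {k : ℤ} (hT : 0 < T) (h : |(k : ℝ) * T| < T) : k = 0 := by
  rw [abs_mul, abs_of_pos hT] at h
  have : |(k : ℝ)| < 1 := by
    by_contra h'
    push Not at h'
    nlinarith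
  have h3 : |k| < 1 := by exact_mod_cast this
  simpa using h3

lemma curve_inj {k : ℕ} (hg : IsRegularJordanCurve k T g) {x y : ℝ} (h : g x = g y)
    (hxy : |x - y| < T) : x = y := by
  obtain ⟨a, ha⟩ := exists_shift hg.period_pos x
  obtain ⟨b, hb⟩ := exists_shift hg.period_pos y
  have := hg.injOn ha hb (by rw [hg.periodic.zsmul a, hg.periodic.zsmul b, h])
  simp only [zsmul_eq_mul] at this
  have h2 : x - y = ((b - a : ℤ) : ℝ) * T := by push_cast; linarith
  rw [h2] at hxy
  rw [abs_int_mul_lt hg.period_pos hxy] at h2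
  simp at h2
  linarith

/-! ### Bi-Lipschitz bounds near the interface -/

/-- In finite dimension an injective linear map is bounded below. Strict differentiability makes the
remainder at most half of this bound for all pairs of points near x, not only for pairs containing
x. -/
lemma exists_lower_bound_of_injective {f : ℝ × ℝ → ℝ × ℝ} {A : ℝ × ℝ →L[ℝ] ℝ × ℝ} {x : ℝ × ℝ}
    (hf : HasStrictFDerivAt f A x) (hA : Function.Injective A) :
    ∃ c > 0, ∀ᶠ p : (ℝ × ℝ) × (ℝ × ℝ) in 𝓝 (x, x), c * ‖p.1 - p.2‖ ≤ ‖f p.1 - f p.2‖ := by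
  obtain ⟨K, hK, hanti⟩ := LinearMap.exists_antilipschitzWith (A : ℝ × ℝ →ₗ[ℝ] ℝ × ℝ)
    (LinearMap.ker_eq_bot.mpr hA)
  have hK' : (0 : ℝ) < K := hK
  refine ⟨(K : ℝ)⁻¹ / 2, by positivity, ?_⟩
  have ho := hf.isLittleO.def (c := (K : ℝ)⁻¹ / 2) (by positivity)
  filter_upwards [ho] with p hp
  have h1 : ‖p.1 - p.2‖ ≤ K * ‖A (p.1 - p.2)‖ := by
    have := hanti.le_mul_dist (p.1 - p.2) 0
    simpa using this
  have h2 : (K : ℝ)⁻¹ * ‖p.1 - p.2‖ ≤ ‖A (p.1 - p.2)‖ := by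
    rw [inv_mul_le_iff₀ hK']; exact h1
  have h3 : ‖A (p.1 - p.2)‖ ≤ ‖f p.1 - f p.2‖ + ‖f p.1 - f p.2 - A (p.1 - p.2)‖ := by
    have := norm_sub_le (f p.1 - f p.2) (f p.1 - f p.2 - A (p.1 - p.2))
    simpa using this
  linarith

/-- At η = 0 the columns of the derivative are n and g', which are orthogonal and nonzero. The
identities `k3` and `k4` are, up to factors, the scalar products with these columns. -/
lemma fderiv_frenetMap_injective (hg : IsRegularJordanCurve 2 T g) (ξ : ℝ) :
    Function.Injective (fderiv ℝ (frenetMap g) (0, ξ)) := by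
  have hd : DifferentiableAt ℝ (frenetMap g) (0, ξ) :=
    (contDiff_frenetMap hg).differentiable (by norm_num) _
  have e1 : fderiv ℝ (frenetMap g) (0, ξ) (1, 0) = normal g ξ := by
    have h1 : HasDerivAt (fun s : ℝ => (s, ξ)) (1, 0) 0 :=
      (hasDerivAt_id (0 : ℝ)).prodMk (hasDerivAt_const _ _)
    have h2 := (HasFDerivAt.comp_hasDerivAt (f := fun s : ℝ => (s, ξ)) 0 hd.hasFDerivAt h1).deriv
    rw [← h2]
    have h3 : HasDerivAt (fun s : ℝ => g ξ + s • normal g ξ) ((1 : ℝ) • normal g ξ) 0 :=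
      ((hasDerivAt_id (0 : ℝ)).smul_const (normal g ξ)).const_add (g ξ)
    rw [one_smul] at h3
    exact h3.deriv
  have e2 : fderiv ℝ (frenetMap g) (0, ξ) (0, 1) = deriv g ξ := by
    have h1 : HasDerivAt (fun s : ℝ => ((0 : ℝ), s)) (0, 1) ξ :=
      (hasDerivAt_const _ _).prodMk (hasDerivAt_id ξ)
    have h2 := (HasFDerivAt.comp_hasDerivAt (f := fun s : ℝ => ((0 : ℝ), s)) ξ
      hd.hasFDerivAt h1).deriv
    rw [← h2]
    congr 1
    funext s
    simp [frenetMap]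
  rw [injective_iff_map_eq_zero]
  intro v hv
  have hsplit : v = v.1 • ((1, 0) : ℝ × ℝ) + v.2 • ((0, 1) : ℝ × ℝ) := by ext <;> simp
  rw [hsplit, map_add, map_smul, map_smul, e1, e2] at hv
  have hs := speed_pos hg ξ
  have hs2 : speed g ξ ^ 2 = (deriv g ξ).1 ^ 2 + (deriv g ξ).2 ^ 2 := Real.sq_sqrt (by positivity)
  have hv1 := congrArg Prod.fst hv
  have hv2 := congrArg Prod.snd hv
  simp only [normal, tangent, Prod.fst_add, Prod.snd_add, Prod.smul_fst, Prod.smul_snd,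
    smul_eq_mul, Prod.fst_zero, Prod.snd_zero] at hv1 hv2
  set x := (deriv g ξ).1
  set y := (deriv g ξ).2
  set s := speed g ξ
  have k1 : v.1 * y + v.2 * x * s = 0 := by
    have : s * (v.1 * (s⁻¹ * y) + v.2 * x) = 0 := by rw [hv1, mul_zero]
    field_simp at this
    linarith
  have k2 : -(v.1 * x) + v.2 * y * s = 0 := by
    have : s * (v.1 * -(s⁻¹ * x) + v.2 * y) = 0 := by rw [hv2, mul_zero]
    field_simp at this
    linarith
  have k3 : v.1 * s ^ 2 = 0 := by rw [hs2]; linear_combination y * k1 - x * k2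
  have k4 : v.2 * s ^ 3 = 0 := by
    have : v.2 * s * s ^ 2 = 0 := by rw [hs2]; linear_combination x * k1 + y * k2
    linarith
  have := hs.ne'
  ext
  · simpa [this] using k3
  · simpa [this] using k4

/-- `P` satisfies a lower Lipschitz bound with constant `c` for `|η| ≤ h₁` and an upper one with
constant `L` for `|η| ≤ 2`, at points whose parameters differ by at most half a period. -/
structure TubularBounds (T : ℝ) (g : ℝ → ℝ × ℝ) (c L h₁ : ℝ) : Prop where
  c_pos : 0 < c
  L_pos : 1 ≤ L
  h₁_pos : 0 < h₁
  h₁_le : h₁ ≤ 1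
  lower : ∀ z w : ℝ × ℝ, |z.1| ≤ h₁ → |w.1| ≤ h₁ → |z.2 - w.2| ≤ T / 2 →
    c * ‖z - w‖ ≤ ‖frenetMap g z - frenetMap g w‖
  upper : ∀ z w : ℝ × ℝ, |z.1| ≤ 2 → |w.1| ≤ 2 → |z.2 - w.2| ≤ T / 2 →
    ‖frenetMap g z - frenetMap g w‖ ≤ L * ‖z - w‖

/-- By compactness: if the bound fails for every c = 1/(n+1), the offending pairs have η tending to
0 and accumulate at two points of the interface with the same image. As their parameters differ by
at most T/2 < T, injectivity of g makes the limits equal, and the local lower bound at that point is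
contradicted. The single c is both the Lipschitz constant and the half-width of the strip. -/
lemma exists_lower_lipschitz (hg : IsRegularJordanCurve 2 T g) :
    ∃ c : ℝ, 0 < c ∧ ∀ z w : ℝ × ℝ, z.2 ∈ Icc 0 T → |z.1| ≤ c → |w.1| ≤ c →
      |z.2 - w.2| ≤ T / 2 → c * ‖z - w‖ ≤ ‖frenetMap g z - frenetMap g w‖ := by
  by_contra hcon
  push Not at hcon
  have hT := hg.period_pos
  have hn : ∀ n : ℕ, (0 : ℝ) < 1 / ((n : ℝ) + 1) := fun n => by positivity
  choose z w hz2 hz1 hw1 hzw hlt using fun n : ℕ => hcon _ (hn n)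
  have hle1 : ∀ n : ℕ, 1 / ((n : ℝ) + 1) ≤ 1 := fun n => by
    rw [div_le_one (by positivity)]; linarith [(Nat.cast_nonneg n : (0 : ℝ) ≤ n)]
  have hcpt : IsCompact ((Icc (-1 : ℝ) 1 ×ˢ Icc 0 T) ×ˢ (Icc (-1 : ℝ) 1 ×ˢ Icc (-T) (2 * T))) :=
    (isCompact_Icc.prod isCompact_Icc).prod (isCompact_Icc.prod isCompact_Icc)
  have hmem : ∀ n, (z n, w n) ∈
      (Icc (-1 : ℝ) 1 ×ˢ Icc 0 T) ×ˢ (Icc (-1 : ℝ) 1 ×ˢ Icc (-T) (2 * T)) := by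
    intro n
    have a := abs_le.mp ((hz1 n).trans (hle1 n))
    have b := abs_le.mp ((hw1 n).trans (hle1 n))
    have c := abs_le.mp (hzw n)
    have d := hz2 n
    exact ⟨⟨a, d⟩, ⟨b, ⟨by linarith [d.1], by linarith [d.2]⟩⟩⟩
  obtain ⟨⟨a, b⟩, -, φ, hφ, hlim⟩ := hcpt.tendsto_subseq hmem
  have hza : Tendsto (fun n => z (φ n)) atTop (𝓝 a) := (continuous_fst.tendsto _).comp hlim
  have hwb : Tendsto (fun n => w (φ n)) atTop (𝓝 b) := (continuous_snd.tendsto _).comp hlim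
  have h0 : Tendsto (fun n => 1 / ((φ n : ℝ) + 1)) atTop (𝓝 0) :=
    tendsto_one_div_add_atTop_nhds_zero_nat.comp hφ.tendsto_atTop
  have ha1 : a.1 = 0 := by
    have h1 : Tendsto (fun n => (z (φ n)).1) atTop (𝓝 0) :=
      squeeze_zero_norm (fun n => hz1 (φ n)) h0
    exact tendsto_nhds_unique ((continuous_fst.tendsto _).comp hza) h1
  have hb1 : b.1 = 0 := by
    have h1 : Tendsto (fun n => (w (φ n)).1) atTop (𝓝 0) :=
      squeeze_zero_norm (fun n => hw1 (φ n)) h0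
    exact tendsto_nhds_unique ((continuous_fst.tendsto _).comp hwb) h1
  have hab : |a.2 - b.2| ≤ T / 2 := by
    have h1 : Tendsto (fun n => |(z (φ n)).2 - (w (φ n)).2|) atTop (𝓝 |a.2 - b.2|) :=
      (((continuous_snd.tendsto _).comp hza).sub ((continuous_snd.tendsto _).comp hwb)).abs
    exact le_of_tendsto h1 (Eventually.of_forall fun n => hzw (φ n))
  have hP := (contDiff_frenetMap hg).continuous
  have hlimP : Tendsto (fun n => ‖frenetMap g (z (φ n)) - frenetMap g (w (φ n))‖) atTop
      (𝓝 ‖frenetMap g a - frenetMap g b‖) :=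
    (((hP.tendsto _).comp hza).sub ((hP.tendsto _).comp hwb)).norm
  have hlimR : Tendsto (fun n => 1 / ((φ n : ℝ) + 1) * ‖z (φ n) - w (φ n)‖) atTop (𝓝 0) := by
    simpa using h0.mul (hza.sub hwb).norm
  have hPab : frenetMap g a = frenetMap g b := by
    have := le_of_tendsto_of_tendsto' hlimP hlimR fun n => (hlt (φ n)).le
    exact sub_eq_zero.mp (norm_le_zero_iff.mp this)
  have hab' : a = b := by
    simp only [frenetMap, ha1, hb1, zero_smul, add_zero] at hPab
    exact Prod.ext (by rw [ha1, hb1]) (curve_inj hg hPab (by linarith))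
  subst hab'
  have ha : a = (0, a.2) := Prod.ext ha1 rfl
  obtain ⟨c, hc, hev⟩ := exists_lower_bound_of_injective
    ((contDiff_frenetMap hg).contDiffAt.hasStrictFDerivAt (by norm_num))
    (fderiv_frenetMap_injective hg a.2)
  rw [← ha] at hev
  have hev' := hlim.eventually hev
  have hsmall := h0.eventually (gt_mem_nhds hc)
  obtain ⟨n, hn1, hn2⟩ := (hev'.and hsmall).exists
  have h1 := hlt (φ n)
  simp only [Function.comp] at hn1
  have h2 : 1 / ((φ n : ℝ) + 1) * ‖z (φ n) - w (φ n)‖ ≤ c * ‖z (φ n) - w (φ n)‖ :=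
    mul_le_mul_of_nonneg_right hn2.le (norm_nonneg _)
  linarith

lemma exists_upper_lipschitz (hg : IsRegularJordanCurve 2 T g) :
    ∃ L : ℝ, 1 ≤ L ∧ ∀ z w : ℝ × ℝ, z.2 ∈ Icc 0 T → |z.1| ≤ 2 → |w.1| ≤ 2 →
      |z.2 - w.2| ≤ T / 2 → ‖frenetMap g z - frenetMap g w‖ ≤ L * ‖z - w‖ := by
  have hP := contDiff_frenetMap hg
  have hT := hg.period_pos
  have hcpt : IsCompact (Icc (-2 : ℝ) 2 ×ˢ Icc (-T) (2 * T)) := isCompact_Icc.prod isCompact_Icc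
  obtain ⟨L, hL⟩ := hcpt.exists_bound_of_continuousOn
    (hP.continuous_fderiv (by norm_num)).continuousOn
  refine ⟨max 1 L, le_max_left _ _, fun z w hz hz1 hw1 hzw => ?_⟩
  have hd := abs_le.mp hzw
  have hconv : Convex ℝ (Icc (-2 : ℝ) 2 ×ˢ Icc (-T) (2 * T)) :=
    (convex_Icc _ _).prod (convex_Icc _ _)
  refine hconv.norm_image_sub_le_of_norm_fderiv_le (𝕜 := ℝ)
    (fun x _ => hP.differentiable (by norm_num) x) (fun x hx => (hL x hx).trans (le_max_right _ _))
    ⟨abs_le.mp hw1, ⟨by linarith [hz.1], by linarith [hz.2]⟩⟩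
    ⟨abs_le.mp hz1, ⟨by linarith [hz.1], by linarith [hz.2]⟩⟩

/-- A common translation of both points by a multiple of the period brings the first parameter into
[0, T) without changing differences or images. -/
lemma exists_tubularBounds (hg : IsRegularJordanCurve 2 T g) :
    ∃ c L h₁ : ℝ, TubularBounds T g c L h₁ := by
  obtain ⟨c, hc, hlow⟩ := exists_lower_lipschitz hg
  obtain ⟨L, hL, hup⟩ := exists_upper_lipschitz hg
  have hshift : ∀ z w : ℝ × ℝ, ∃ z' w' : ℝ × ℝ, z'.2 ∈ Icc 0 T ∧ z'.1 = z.1 ∧ w'.1 = w.1 ∧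
      z'.2 - w'.2 = z.2 - w.2 ∧ z' - w' = z - w ∧ frenetMap g z' = frenetMap g z ∧
      frenetMap g w' = frenetMap g w := by
    intro z w
    obtain ⟨k, hk⟩ := exists_shift hg.period_pos z.2
    refine ⟨(z.1, z.2 + k • T), (w.1, w.2 + k • T), Ico_subset_Icc_self hk, rfl, rfl, ?_, ?_,
      frenetMap_add_zsmul hg.periodic _ _ _, frenetMap_add_zsmul hg.periodic _ _ _⟩
    · simp
    · ext <;> simp
  refine ⟨c, L, min c 1, hc, hL, lt_min hc one_pos, min_le_right _ _, ?_, ?_⟩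
  · intro z w hz hw hzw
    obtain ⟨z', w', h1, h2, h3, h4, h5, h6, h7⟩ := hshift z w
    have := hlow z' w' h1 (by rw [h2]; exact hz.trans (min_le_left _ _))
      (by rw [h3]; exact hw.trans (min_le_left _ _)) (by rwa [h4])
    rwa [h5, h6, h7] at this
  · intro z w hz hw hzw
    obtain ⟨z', w', h1, h2, h3, h4, h5, h6, h7⟩ := hshift z w
    have := hup z' w' h1 (by rwa [h2]) (by rwa [h3]) (by rwa [h4])
    rwa [h5, h6, h7] at this

end Regularity

/-! ### Geometry of the mesh elements -/

namespace RectMesh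

variable {M : RectMesh}

lemma gx_succ (M : RectMesh) (i : ℕ) : M.gx (i + 1) = M.gx i + M.hx := by
  simp only [gx]; push_cast; ring

lemma gy_succ (M : RectMesh) (j : ℕ) : M.gy (j + 1) = M.gy j + M.hy := by
  simp only [gy]; push_cast; ring

lemma gx_mono (M : RectMesh) : Monotone M.gx :=
  monotone_nat_of_le_succ fun i => by rw [gx_succ]; linarith [M.hx_pos]

lemma gy_mono (M : RectMesh) : Monotone M.gy :=
  monotone_nat_of_le_succ fun i => by rw [gy_succ]; linarith [M.hy_pos]

lemma gx_le_succ (M : RectMesh) (i : ℕ) : M.gx i ≤ M.gx (i + 1) := M.gx_mono (Nat.le_succ i)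

lemma gy_le_succ (M : RectMesh) (j : ℕ) : M.gy j ≤ M.gy (j + 1) := M.gy_mono (Nat.le_succ j)

lemma hx_le_h (M : RectMesh) : M.hx ≤ M.h := Real.le_sqrt_of_sq_le (by nlinarith [sq_nonneg M.hy])

lemma hy_le_h (M : RectMesh) : M.hy ≤ M.h := Real.le_sqrt_of_sq_le (by nlinarith [sq_nonneg M.hx])

lemma h_pos (M : RectMesh) : 0 < M.h := M.hx_pos.trans_le M.hx_le_h

lemma ShapeRegular.h_le {ϱ : ℝ} (hM : M.ShapeRegular ϱ) :
    M.h ≤ (1 + |ϱ|) * M.hx ∧ M.h ≤ (1 + |ϱ|) * M.hy := by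
  have hx := M.hx_pos
  have hy := M.hy_pos
  have h1 : M.h ≤ M.hx + M.hy := Real.sqrt_le_iff.mpr ⟨by positivity, by nlinarith⟩
  have h2 : M.hx ≤ |ϱ| * M.hy := hM.1.trans (mul_le_mul_of_nonneg_right (le_abs_self _) hy.le)
  have h3 : M.hy ≤ |ϱ| * M.hx := hM.2.trans (mul_le_mul_of_nonneg_right (le_abs_self _) hx.le)
  constructor <;> linarith

lemma isCompact_elem (M : RectMesh) (i j : ℕ) : IsCompact (M.elem i j) :=
  isCompact_Icc.prod isCompact_Icc

lemma measurableSet_elem (M : RectMesh) (i j : ℕ) : MeasurableSet (M.elem i j) :=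
  (M.isCompact_elem i j).measurableSet

lemma convex_elem (M : RectMesh) (i j : ℕ) : Convex ℝ (M.elem i j) :=
  (convex_Icc _ _).prod (convex_Icc _ _)

lemma interior_elem (M : RectMesh) (i j : ℕ) : interior (M.elem i j) =
    Ioo (M.gx i) (M.gx (i + 1)) ×ˢ Ioo (M.gy j) (M.gy (j + 1)) := by
  rw [elem, interior_prod_eq, interior_Icc, interior_Icc]

lemma center_mem_interior (M : RectMesh) (i j : ℕ) : M.center i j ∈ interior (M.elem i j) := by
  rw [interior_elem]
  have hx := M.hx_pos
  have hy := M.hy_pos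
  simp only [center, gx_succ, gy_succ, mem_prod, mem_Ioo]
  refine ⟨⟨?_, ?_⟩, ?_, ?_⟩ <;> linarith

lemma interior_elem_subset_domain {i j : ℕ} (hi : i < M.nx) (hj : j < M.ny) :
    interior (M.elem i j) ⊆ M.domain := by
  rw [interior_elem]
  exact prod_mono (Ioo_subset_Ioo (M.gx_mono (Nat.zero_le _)) (M.gx_mono hi))
    (Ioo_subset_Ioo (M.gy_mono (Nat.zero_le _)) (M.gy_mono hj))

lemma norm_sub_le_of_mem_elem {i j : ℕ} {x y : ℝ × ℝ} (hx : x ∈ M.elem i j)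
    (hy : y ∈ M.elem i j) : ‖x - y‖ ≤ M.h := by
  obtain ⟨⟨a1, a2⟩, a3, a4⟩ := hx
  obtain ⟨⟨b1, b2⟩, b3, b4⟩ := hy
  rw [gx_succ] at a2 b2
  rw [gy_succ] at a4 b4
  rw [Prod.norm_def]
  refine max_le ?_ ?_
  · rw [Prod.fst_sub, Real.norm_eq_abs, abs_le]
    constructor <;> linarith [M.hx_le_h]
  · rw [Prod.snd_sub, Real.norm_eq_abs, abs_le]
    constructor <;> linarith [M.hy_le_h]

/-- Since h ≤ hx + hy, shape regularity bounds both sides below by h/(1 + |ϱ|); the absolute value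
avoids a sign condition on ϱ. -/
lemma mem_interior_elem_of_near {ϱ : ℝ} (hM : M.ShapeRegular ϱ) {i j : ℕ} {x : ℝ × ℝ}
    (hx : 2 * (1 + |ϱ|) * ‖x - M.center i j‖ < M.h) : x ∈ interior (M.elem i j) := by
  have hR : 0 < 1 + |ϱ| := by positivity
  obtain ⟨h1, h2⟩ := hM.h_le
  have e1 : (1 + |ϱ|) * (2 * ‖x - M.center i j‖) < (1 + |ϱ|) * M.hx := by linarith
  have e2 : (1 + |ϱ|) * (2 * ‖x - M.center i j‖) < (1 + |ϱ|) * M.hy := by linarith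
  have f1 := lt_of_mul_lt_mul_left e1 hR.le
  have f2 := lt_of_mul_lt_mul_left e2 hR.le
  have g1 := abs_le.mp (abs_fst_sub_le x (M.center i j))
  have g2 := abs_le.mp (abs_snd_sub_le x (M.center i j))
  rw [interior_elem]
  simp only [center, gx_succ, gy_succ] at g1 g2
  simp only [gx_succ, gy_succ, mem_prod, mem_Ioo]
  simp only [center, gx_succ, gy_succ] at f1 f2
  refine ⟨⟨?_, ?_⟩, ?_, ?_⟩ <;> linarith [g1.1, g1.2, g2.1, g2.2]

lemma convex_domain (M : RectMesh) : Convex ℝ M.domain := (convex_Ioo _ _).prod (convex_Ioo _ _)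

end RectMesh

/-! ### Interface elements in Frenet coordinates -/

section Fictitious

variable {T : ℝ} {g : ℝ → ℝ × ℝ} {c L h₁ : ℝ}

/-- A period shift of w brings the parameters within T/2, where the lower Lipschitz bound forces
equality. The shift is then trivial because the original parameters differ by less than T. -/
lemma tubular_injective (hg : IsRegularJordanCurve 2 T g) (tb : TubularBounds T g c L h₁)
    {z w : ℝ × ℝ} (hz : |z.1| ≤ h₁) (hw : |w.1| ≤ h₁) (hzw : |z.2 - w.2| < T)
    (h : frenetMap g z = frenetMap g w) : z = w := by
  obtain ⟨k, hk⟩ := exists_shift_near hg.period_pos z.2 w.2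
  have h1 := tb.lower z (w.1, w.2 + k • T) hz hw hk
  rw [frenetMap_add_zsmul hg.periodic] at h1
  rw [show frenetMap g (w.1, w.2) = frenetMap g z from h.symm, sub_self, norm_zero] at h1
  have h2 : ‖z - (w.1, w.2 + k • T)‖ ≤ 0 := by
    by_contra h'
    push Not at h'
    nlinarith [mul_pos tb.c_pos h']
  have h3 : z = (w.1, w.2 + k • T) := sub_eq_zero.mp (norm_le_zero_iff.mp h2)
  have h4 : z.2 = w.2 + k • T := congrArg Prod.snd h3
  have h5 : z.2 - w.2 = k * T := by rw [h4]; simp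
  rw [h5] at hzw
  have hk0 := abs_int_mul_lt hg.period_pos hzw
  rw [h3, hk0]
  simp

lemma abs_le_of_mem_Icc_neg {x h : ℝ} (hx : x ∈ Icc (-h) h) : |x| ≤ h := abs_le.mpr hx

/-- K is covered by the closed sets A and B of its points with parameter at most and at least ξ,
both nonempty since the end points are attained. Connectedness yields a common point, and
injectivity of P forces its parameter to be ξ. -/
lemma isFictitious_attained (hg : IsRegularJordanCurve 2 T g) (tb : TubularBounds T g c L h₁)
    {h ξ₀ ξ₁ : ℝ} {K : Set (ℝ × ℝ)} (hh : h ≤ h₁) (hf : IsFictitious T g h K ξ₀ ξ₁)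
    (hK : IsPreconnected K) (hKc : IsClosed K) {ξ : ℝ} (hξ : ξ ∈ Icc ξ₀ ξ₁) :
    ∃ η ∈ Icc (-h) h, frenetMap g (η, ξ) ∈ K := by
  have hP := (contDiff_frenetMap hg).continuous
  set A := frenetMap g '' ((Icc (-h) h ×ˢ Icc ξ₀ ξ) ∩ frenetMap g ⁻¹' K)
  set B := frenetMap g '' ((Icc (-h) h ×ˢ Icc ξ ξ₁) ∩ frenetMap g ⁻¹' K)
  have hA : IsClosed A := (((isCompact_Icc.prod isCompact_Icc).inter_right
    (hKc.preimage hP)).image hP).isClosed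
  have hB : IsClosed B := (((isCompact_Icc.prod isCompact_Icc).inter_right
    (hKc.preimage hP)).image hP).isClosed
  obtain ⟨ηl, hηl, hl⟩ := hf.left_attained
  obtain ⟨ηr, hηr, hr⟩ := hf.right_attained
  have hcov : K ⊆ A ∪ B := by
    intro x hx
    obtain ⟨z, ⟨hz1, hz2⟩, hzx⟩ := hf.cover hx
    rcases le_total z.2 ξ with hle | hle
    · exact Or.inl ⟨z, ⟨⟨hz1, ⟨hz2.1, hle⟩⟩, by rw [mem_preimage, hzx]; exact hx⟩, hzx⟩
    · exact Or.inr ⟨z, ⟨⟨hz1, ⟨hle, hz2.2⟩⟩, by rw [mem_preimage, hzx]; exact hx⟩, hzx⟩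
  obtain ⟨x, hxK, ⟨z, ⟨⟨hz1, hz2⟩, hzK⟩, hzx⟩, ⟨w, ⟨⟨hw1, hw2⟩, hwK⟩, hwx⟩⟩ :=
    isPreconnected_closed_iff.mp hK A B hA hB hcov
      ⟨_, hl, _, ⟨⟨hηl, ⟨le_rfl, hξ.1⟩⟩, hl⟩, rfl⟩ ⟨_, hr, _, ⟨⟨hηr, ⟨hξ.2, le_rfl⟩⟩, hr⟩, rfl⟩
  have hlen := hf.length_lt
  have hzw : z = w := by
    refine tubular_injective hg tb ((abs_le_of_mem_Icc_neg hz1).trans hh)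
      ((abs_le_of_mem_Icc_neg hw1).trans hh) ?_ (hzx.trans hwx.symm)
    rw [abs_lt]
    constructor <;> linarith [hz2.1, hz2.2, hw2.1, hw2.2]
  have hz : z.2 = ξ := le_antisymm hz2.2 (by rw [hzw]; exact hw2.1)
  exact ⟨z.1, hz1, by rw [← hz]; exact hzK⟩

/-- Every parameter of the interval is attained on K, whose diameter is at most h, so the lower
Lipschitz bound limits how far parameters can spread. -/
lemma isFictitious_length (hg : IsRegularJordanCurve 2 T g) (tb : TubularBounds T g c L h₁)
    {h ξ₀ ξ₁ : ℝ} {K : Set (ℝ × ℝ)} (hh : h ≤ h₁) (hhT : h < c * T / 4)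
    (hf : IsFictitious T g h K ξ₀ ξ₁) (hK : IsPreconnected K) (hKc : IsClosed K)
    (hdiam : ∀ x ∈ K, ∀ y ∈ K, ‖x - y‖ ≤ h) : c * (ξ₁ - ξ₀) ≤ h := by
  have hc := tb.c_pos
  have hT := hg.period_pos
  rcases lt_or_ge ξ₁ ξ₀ with hlt | hle
  · obtain ⟨η, hη, hl⟩ := hf.left_attained
    have := hdiam _ hl _ hl
    rw [sub_self, norm_zero] at this
    nlinarith
  obtain ⟨ηl, hηl, hl⟩ := hf.left_attained
  have key : ∀ ξ ∈ Icc ξ₀ ξ₁, ξ - ξ₀ ≤ T / 2 → c * (ξ - ξ₀) ≤ h := by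
    intro ξ hξ hξT
    obtain ⟨η, hη, hmem⟩ := isFictitious_attained hg tb hh hf hK hKc hξ
    have h1 := tb.lower (η, ξ) (ηl, ξ₀) ((abs_le_of_mem_Icc_neg hη).trans hh)
      ((abs_le_of_mem_Icc_neg hηl).trans hh)
      (by rw [abs_of_nonneg (by simpa using hξ.1)]; exact hξT)
    have h2 := abs_snd_sub_le (η, ξ) (ηl, ξ₀)
    rw [abs_of_nonneg (by simpa using hξ.1)] at h2
    calc c * (ξ - ξ₀) ≤ c * ‖((η, ξ) : ℝ × ℝ) - (ηl, ξ₀)‖ := mul_le_mul_of_nonneg_left h2 hc.le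
      _ ≤ _ := h1
      _ ≤ h := hdiam _ hmem _ hl
  rcases le_total (ξ₁ - ξ₀) (T / 2) with h2 | h2
  · exact key ξ₁ ⟨hle, le_rfl⟩ h2
  -- The lower bound only compares parameters within T/2. A longer interval would contain ξ₀ + T/2,
  -- giving cT/2 ≤ h and contradicting h < cT/4.
  · have := key (ξ₀ + T / 2) ⟨by linarith, by linarith⟩ (by linarith)
    nlinarith

/-- Mesh sizes that are small compared with the geometry of the interface. -/
structure IsSmall (T c h₁ h : ℝ) : Prop where
  le_h₁ : 2 * h ≤ h₁
  lt_c : h < c * T / 4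
  le_T : h ≤ T

variable {M : RectMesh} {i j : ℕ} {ξ₀ ξ₁ : ℝ}

lemma elem_frenet_length (hg : IsRegularJordanCurve 2 T g) (tb : TubularBounds T g c L h₁)
    (hs : IsSmall T c h₁ M.h) (hf : IsFictitious T g M.h (M.elem i j) ξ₀ ξ₁) :
    c * (ξ₁ - ξ₀) ≤ M.h ∧ ξ₁ - ξ₀ ≤ T / 4 := by
  have h1 := isFictitious_length hg tb (by linarith [hs.le_h₁, M.h_pos]) hs.lt_c hf
    (M.convex_elem i j).isPreconnected (M.isCompact_elem i j).isClosed
    (fun x hx y hy => RectMesh.norm_sub_le_of_mem_elem hx hy)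
  refine ⟨h1, ?_⟩
  have := hs.lt_c
  have h2 : c * (ξ₁ - ξ₀) ≤ c * (T / 4) := by linarith
  exact le_of_mul_le_mul_left h2 tb.c_pos

lemma exists_frenetElem {h : ℝ} {K : Set (ℝ × ℝ)} (hf : IsFictitious T g h K ξ₀ ξ₁) {x : ℝ × ℝ}
    (hx : x ∈ K) : ∃ z ∈ frenetElem g h K ξ₀ ξ₁, frenetMap g z = x := by
  obtain ⟨z, hz, hzx⟩ := hf.cover hx
  exact ⟨z, ⟨hz, by rw [mem_preimage, hzx]; exact hx⟩, hzx⟩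

lemma frenetElem_lower (hg : IsRegularJordanCurve 2 T g) (tb : TubularBounds T g c L h₁)
    (hs : IsSmall T c h₁ M.h) (hf : IsFictitious T g M.h (M.elem i j) ξ₀ ξ₁) {z w : ℝ × ℝ}
    (hz : z ∈ frenetElem g M.h (M.elem i j) ξ₀ ξ₁)
    (hw : w ∈ frenetElem g M.h (M.elem i j) ξ₀ ξ₁) :
    c * ‖z - w‖ ≤ ‖frenetMap g z - frenetMap g w‖ := by
  have hlen := (elem_frenet_length hg tb hs hf).2
  have hT := hg.period_pos
  have hh : M.h ≤ h₁ := by linarith [hs.le_h₁, M.h_pos]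
  refine tb.lower z w ((abs_le_of_mem_Icc_neg hz.1.1).trans hh)
    ((abs_le_of_mem_Icc_neg hw.1.1).trans hh) ?_
  rw [abs_le]
  constructor <;> linarith [hz.1.2.1, hz.1.2.2, hw.1.2.1, hw.1.2.2]

/-- A box of size comparable with `h` around the Frenet coordinates of the centre of an interface
element is contained in the Frenet element. -/
lemma frenetElem_center_box {ϱ : ℝ} (hg : IsRegularJordanCurve 2 T g)
    (tb : TubularBounds T g c L h₁) (hs : IsSmall T c h₁ M.h) (hM : M.ShapeRegular ϱ)
    (hf : IsFictitious T g M.h (M.elem i j) ξ₀ ξ₁) {zc : ℝ × ℝ}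
    (hzc : zc ∈ frenetElem g M.h (M.elem i j) ξ₀ ξ₁) (hc : frenetMap g zc = M.center i j)
    {z : ℝ × ℝ} (hz : 4 * L * (1 + |ϱ|) * ‖z - zc‖ ≤ M.h) :
    z ∈ frenetElem g M.h (M.elem i j) ξ₀ ξ₁ ∧ frenetMap g z ∈ interior (M.elem i j) ∧
      4 * (1 + |ϱ|) * ‖frenetMap g z - M.center i j‖ ≤ M.h := by
  have hL := tb.L_pos
  have hh := M.h_pos
  have hR : 1 ≤ 1 + |ϱ| := by linarith [abs_nonneg ϱ]
  have hLR : 1 ≤ L * (1 + |ϱ|) := by nlinarith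
  have hlen := (elem_frenet_length hg tb hs hf).2
  have hT := hg.period_pos
  have hn := norm_nonneg (z - zc)
  have hz4 : 4 * ‖z - zc‖ ≤ M.h := by nlinarith
  have hz1 := abs_le.mp (abs_fst_sub_le z zc)
  have hz2 := abs_le.mp (abs_snd_sub_le z zc)
  have hT' := hs.le_T
  have hη : |z.1| ≤ h₁ := by
    rw [abs_le]
    have := hs.le_h₁
    constructor <;> linarith [hzc.1.1.1, hzc.1.1.2, hz1.1, hz1.2]
  have hηc : |zc.1| ≤ h₁ := (abs_le_of_mem_Icc_neg hzc.1.1).trans (by linarith [hs.le_h₁])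
  have h1le := tb.h₁_le
  have hup := tb.upper z zc (by linarith) (by linarith)
    (by rw [abs_le]; constructor <;> linarith [hz2.1, hz2.2])
  rw [hc] at hup
  have hnear : 4 * (1 + |ϱ|) * ‖frenetMap g z - M.center i j‖ ≤ M.h := by
    refine le_trans ?_ hz
    calc 4 * (1 + |ϱ|) * ‖frenetMap g z - M.center i j‖ ≤ 4 * (1 + |ϱ|) * (L * ‖z - zc‖) :=
          mul_le_mul_of_nonneg_left hup (by positivity)
      _ = 4 * L * (1 + |ϱ|) * ‖z - zc‖ := by ring
  have hint : frenetMap g z ∈ interior (M.elem i j) :=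
    RectMesh.mem_interior_elem_of_near hM (by linarith)
  -- The image lies in K and so has Frenet coordinates w in the fictitious rectangle; injectivity
  -- identifies w with z, which places z itself there.
  obtain ⟨w, hw, hwz⟩ := exists_frenetElem hf (interior_subset hint)
  have hzw : z = w := by
    refine tubular_injective hg tb hη ((abs_le_of_mem_Icc_neg hw.1.1).trans
      (by linarith [hs.le_h₁])) ?_ hwz.symm
    rw [abs_lt]
    constructor <;>
      linarith [hw.1.2.1, hw.1.2.2, hzc.1.2.1, hzc.1.2.2, hz2.1, hz2.2]
  exact ⟨hzw ▸ hw, hint, hnear⟩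

/-- Off the interface, points of the normal segments stay on their side. -/
lemma frenetMap_mem_side {Ωp Ωm : Set (ℝ × ℝ)} (hg : IsRegularJordanCurve 2 T g)
    (tb : TubularBounds T g c L h₁) (hΩ : M.IsSplit g Ωp Ωm) {z : ℝ × ℝ} (hz : |z.1| ≤ h₁)
    (hdom : frenetMap g z ∈ M.domain) :
    (0 < z.1 → frenetMap g z ∈ Ωp) ∧ (z.1 < 0 → frenetMap g z ∈ Ωm) := by
  have hT := hg.period_pos
  have hg0 : g z.2 ∈ M.domain := hΩ.range_subset ⟨_, rfl⟩
  have hseg : ∀ t ∈ Ioc (0 : ℝ) 1, frenetMap g (t * z.1, z.2) ∈ M.domain := by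
    intro t ht
    have := M.convex_domain hg0 hdom (a := 1 - t) (b := t) (by linarith [ht.2]) ht.1.le (by ring)
    convert this using 1
    simp only [frenetMap, smul_add, smul_smul]
    rw [← add_assoc, ← add_smul, sub_add_cancel, one_smul]
  have hoff : z.1 ≠ 0 → ∀ t ∈ Ioc (0 : ℝ) 1, frenetMap g (t * z.1, z.2) ∉ range g := by
    rintro hz0 t ht ⟨ζ, hζ⟩
    obtain ⟨k, hk⟩ := exists_shift_near hT z.2 ζ
    have h1 : frenetMap g (0, ζ + k • T) = frenetMap g (t * z.1, z.2) := by
      rw [frenetMap_add_zsmul hg.periodic, ← hζ]; simp [frenetMap]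
    have h2 := tubular_injective hg tb (z := (t * z.1, z.2)) (w := (0, ζ + k • T))
      (by
        rw [abs_mul, abs_of_pos ht.1]
        exact (mul_le_of_le_one_left (abs_nonneg _) ht.2).trans hz)
      (by simpa using tb.h₁_pos.le) (by simp only; linarith) h1.symm
    have h3 : t * z.1 = 0 := congrArg Prod.fst h2
    rcases mul_eq_zero.mp h3 with h4 | h4
    · linarith [ht.1]
    · exact hz0 h4
  -- The normal segment without its foot on Γ lies in Ω by convexity and misses Γ by injectivity of
  -- P. Being connected, it stays in the subdomain where it starts, which `normal_dir` identifies.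
  have hsub : z.1 ≠ 0 → (fun t : ℝ => frenetMap g (t * z.1, z.2)) '' Ioc 0 1 ⊆ Ωp ∪ Ωm := by
    rintro hz0 _ ⟨t, ht, rfl⟩
    rw [hΩ.union_eq]
    exact ⟨hseg t ht, hoff hz0 t ht⟩
  have hcon : IsPreconnected ((fun t : ℝ => frenetMap g (t * z.1, z.2)) '' Ioc 0 1) := by
    refine isPreconnected_Ioc.image _ ?_
    have := (contDiff_frenetMap hg).continuous
    fun_prop
  have h1mem : frenetMap g z ∈ (fun t : ℝ => frenetMap g (t * z.1, z.2)) '' Ioc 0 1 :=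
    ⟨1, ⟨one_pos, le_rfl⟩, by simp⟩
  have hsmall : ∀ {a : ℝ}, 0 < a → ∀ {p : ℝ → Prop}, (∀ᶠ t in 𝓝[>] (0 : ℝ), p t) →
      ∃ t ∈ Ioc (0 : ℝ) 1, p (t * a) := by
    intro a ha p hp
    have hev : ∀ᶠ t in 𝓝[>] (0 : ℝ), t ∈ Ioc 0 a := Ioc_mem_nhdsGT ha
    obtain ⟨t, ht, hta⟩ := (hp.and hev).exists
    refine ⟨t / a, ⟨div_pos hta.1 ha, (div_le_one ha).mpr hta.2⟩, ?_⟩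
    rwa [div_mul_cancel₀ _ ha.ne']
  constructor
  · intro hpos
    refine hcon.subset_left_of_subset_union hΩ.isOpen_p hΩ.isOpen_m hΩ.disjoint
      (hsub hpos.ne') ?_ h1mem
    obtain ⟨t, ht, hp⟩ := hsmall hpos (hΩ.normal_dir z.2)
    exact ⟨_, ⟨t, ht, rfl⟩, hp.1⟩
  · intro hneg
    refine hcon.subset_right_of_subset_union hΩ.isOpen_p hΩ.isOpen_m hΩ.disjoint
      (hsub hneg.ne) ?_ h1mem
    obtain ⟨t, ht, hp⟩ := hsmall (neg_pos.mpr hneg) (hΩ.normal_dir z.2)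
    refine ⟨_, ⟨t, ht, rfl⟩, ?_⟩
    have h2 := hp.2
    rw [mul_neg, neg_smul, sub_neg_eq_add] at h2
    exact h2

lemma sideAt_eq_true_iff {Ωp : Set (ℝ × ℝ)} {x : ℝ × ℝ} : sideAt M Ωp i j x = true ↔
    ∀ᶠ t in 𝓝[>] (0 : ℝ), x + t • (M.center i j - x) ∈ Ωp := by
  classical
  unfold sideAt
  exact decide_eq_true_iff

lemma sideAt_eq_true {Ωp : Set (ℝ × ℝ)} (ho : IsOpen Ωp) {x : ℝ × ℝ} (hx : x ∈ Ωp) :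
    sideAt M Ωp i j x = true := by
  rw [sideAt_eq_true_iff]
  have hcont : Tendsto (fun t : ℝ => x + t • (M.center i j - x)) (𝓝[>] 0) (𝓝 x) := by
    have : Continuous (fun t : ℝ => x + t • (M.center i j - x)) := by fun_prop
    have h2 := this.tendsto 0
    simp only [zero_smul, add_zero] at h2
    exact h2.mono_left nhdsWithin_le_nhds
  exact hcont.eventually (ho.mem_nhds hx)

lemma sideAt_eq_false {Ωp Ωm : Set (ℝ × ℝ)} (ho : IsOpen Ωm) (hd : Disjoint Ωp Ωm) {x : ℝ × ℝ}
    (hx : x ∈ Ωm) : sideAt M Ωp i j x = false := by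
  rw [← Bool.not_eq_true, sideAt_eq_true_iff]
  intro hcon
  have hcont : Tendsto (fun t : ℝ => x + t • (M.center i j - x)) (𝓝[>] 0) (𝓝 x) := by
    have : Continuous (fun t : ℝ => x + t • (M.center i j - x)) := by fun_prop
    have h2 := this.tendsto 0
    simp only [zero_smul, add_zero] at h2
    exact h2.mono_left nhdsWithin_le_nhds
  obtain ⟨t, h1, h2⟩ := (hcon.and (hcont.eventually (ho.mem_nhds hx))).exists
  exact hd.le_bot ⟨h1, h2⟩

/-- On a non-interface element the side is constant. -/
lemma exists_sideAt_const {Ωp Ωm : Set (ℝ × ℝ)} (hΩ : M.IsSplit g Ωp Ωm) (hi : i < M.nx)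
    (hj : j < M.ny) (hni : ¬ M.IsInterfaceElem g i j) :
    ∃ s, ∀ x ∈ M.elem i j, sideAt M Ωp i j x = s := by
  have hsub : interior (M.elem i j) ⊆ Ωp ∪ Ωm := by
    rw [hΩ.union_eq]
    intro x hx
    exact ⟨RectMesh.interior_elem_subset_domain hi hj hx, fun hr => hni ⟨x, hx, hr⟩⟩
  -- Even from a boundary point, the segment towards the centre enters the interior at once, and the
  -- interior lies in a single subdomain.
  have hpath : ∀ x ∈ M.elem i j, ∀ᶠ t in 𝓝[>] (0 : ℝ),
      x + t • (M.center i j - x) ∈ interior (M.elem i j) := by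
    intro x hx
    filter_upwards [Ioc_mem_nhdsGT (zero_lt_one (α := ℝ))] with t ht
    exact (M.convex_elem i j).add_smul_sub_mem_interior hx (M.center_mem_interior i j) ht
  rcases (M.convex_elem i j).interior.isPreconnected.subset_or_subset hΩ.isOpen_p hΩ.isOpen_m
    hΩ.disjoint hsub with h | h
  · refine ⟨true, fun x hx => ?_⟩
    rw [sideAt_eq_true_iff]
    exact (hpath x hx).mono fun t ht => h ht
  · refine ⟨false, fun x hx => ?_⟩
    rw [← Bool.not_eq_true, sideAt_eq_true_iff]
    intro hcon
    obtain ⟨t, h1, h2⟩ := (hcon.and (hpath x hx)).exists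
    exact hΩ.disjoint.le_bot ⟨h1, h h2⟩

end Fictitious

/-! ### Normal derivatives of the Frenet Laplacian of a polynomial -/

lemma iteratedDeriv_affine_zpow (κ : ℝ) (a : ℤ) (i : ℕ) :
    iteratedDeriv i (fun η : ℝ => (1 + κ * η) ^ a) =
      fun η => κ ^ i * (∏ l ∈ Finset.range i, ((a : ℝ) - l)) * (1 + κ * η) ^ (a - i) := by
  induction i with
  | zero => simp
  | succ i ih =>
    rw [iteratedDeriv_succ, ih]
    funext η
    rw [deriv_const_mul_field]
    have h1 : deriv (fun η : ℝ => (1 + κ * η) ^ (a - (i : ℤ))) η =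
        κ * (((a : ℝ) - i) * (1 + κ * η) ^ (a - (i : ℤ) - 1)) := by
      have h2 := deriv_comp_mul_left κ (fun y : ℝ => (1 + y) ^ (a - (i : ℤ))) η
      have h3 := deriv_comp_const_add (fun y : ℝ => y ^ (a - (i : ℤ))) 1 (κ * η)
      rw [deriv_zpow] at h3
      rw [h2, h3]
      push_cast
      rfl
    rw [h1, Finset.prod_range_succ, pow_succ]
    push_cast
    rw [← sub_sub]
    ring

/-- The `j`-th derivative at `0` of `η ↦ η ^ k * (1 + κ η) ^ a`. -/
def powDerivZero (j k : ℕ) (a : ℤ) (κ : ℝ) : ℝ :=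
  if k ≤ j then j.choose k * k.factorial * (κ ^ (j - k) *
    ∏ l ∈ Finset.range (j - k), ((a : ℝ) - l)) else 0

lemma contDiffAt_affine_zpow (κ : ℝ) (a : ℤ) {n : WithTop ℕ∞} :
    ContDiffAt ℝ n (fun η : ℝ => (1 + κ * η) ^ a) 0 := by
  have h1 : ContDiffAt ℝ n (fun η : ℝ => 1 + κ * η) 0 := by fun_prop
  have h0 : (1 + κ * (0 : ℝ)) ≠ 0 := by simp
  cases a with
  | ofNat k => simpa using h1.pow k
  | negSucc k =>
    simp only [zpow_negSucc]
    exact (h1.pow (k + 1)).inv (pow_ne_zero _ h0)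

lemma iteratedDeriv_pow_mul_zpow (j k : ℕ) (a : ℤ) (κ : ℝ) :
    iteratedDeriv j (fun η : ℝ => η ^ k * (1 + κ * η) ^ a) 0 = powDerivZero j k a κ := by
  have h1 : ContDiffAt ℝ j (fun η : ℝ => η ^ k) 0 := by fun_prop
  rw [iteratedDeriv_fun_mul h1 (contDiffAt_affine_zpow κ a)]
  simp only [iteratedDeriv_fun_pow_zero, iteratedDeriv_affine_zpow]
  unfold powDerivZero
  split_ifs with hk
  · rw [Finset.sum_eq_single k]
    · simp
    · intro b _ hb; simp [hb]
    · intro h; exact absurd (Finset.mem_range.mpr (by omega)) h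
  · refine Finset.sum_eq_zero fun i hi => ?_
    have : i ≠ k := by rw [Finset.mem_range] at hi; omega
    simp [this]

/-- The polynomial `∑ₖ ηᵏ aₖ(ξ)`. -/
def expand (m : ℕ) (a : ℕ → Polynomial ℝ) (z : ℝ × ℝ) : ℝ :=
  ∑ k ∈ Finset.range (m + 1), z.1 ^ k * (a k).eval z.2

lemma pd2_expand_eq (m : ℕ) (a : ℕ → Polynomial ℝ) :
    pd2 (expand m a) = expand m (fun k => (a k).derivative) := pd2_expand a

lemma pd1_expand_eq (m : ℕ) (a : ℕ → Polynomial ℝ) : pd1 (expand m a) = fun z =>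
    ∑ k ∈ Finset.range (m + 1), (k * z.1 ^ (k - 1)) * (a k).eval z.2 := by
  funext z
  unfold pd1
  apply HasDerivAt.deriv
  apply HasDerivAt.fun_sum
  intro k _
  exact (hasDerivAt_pow k z.1).mul_const ((a k).eval z.2)

section Laplacian

variable {T : ℝ} {g : ℝ → ℝ × ℝ}

/-- Coefficient of `aₖ` in the `j`-th normal derivative of the Laplacian of `∑ₖ ηᵏ aₖ(ξ)`, apart
from the leading term. -/
def lapCoef0 (g : ℝ → ℝ × ℝ) (j k : ℕ) (ξ : ℝ) : ℝ :=
  k * curvature g ξ * powDerivZero j (k - 1) (-1) (curvature g ξ)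

/-- Coefficient of `aₖ'`. -/
def lapCoef1 (g : ℝ → ℝ × ℝ) (j k : ℕ) (ξ : ℝ) : ℝ :=
  -((speed g ξ)⁻¹ ^ 3 * deriv (speed g) ξ) * powDerivZero j k (-2) (curvature g ξ) -
    (speed g ξ)⁻¹ ^ 2 * deriv (curvature g) ξ * powDerivZero j (k + 1) (-3) (curvature g ξ)

/-- Coefficient of `aₖ''`. -/
def lapCoef2 (g : ℝ → ℝ × ℝ) (j k : ℕ) (ξ : ℝ) : ℝ :=
  (speed g ξ)⁻¹ ^ 2 * powDerivZero j k (-2) (curvature g ξ)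

/-- With ρ = s(1 + κη) one has 𝓛φ = φ_ηη + κ(1 + κη)⁻¹ φ_η + ρ⁻² φ_ξξ − ρ⁻³ρ_ξ φ_ξ, where ρ_ξ = s'(1
+ κη) + sηκ'. Grouping by powers of η and of 1 + κη makes the normal derivatives at 0 explicit. -/
lemma frenetLaplacian_expand (hg : IsRegularJordanCurve 3 T g) (m : ℕ) (a : ℕ → Polynomial ℝ)
    (ξ η : ℝ) (ht : 1 + curvature g ξ * η ≠ 0) :
    frenetLaplacian g (expand m a) (η, ξ) = ∑ k ∈ Finset.range (m + 1),
      ((k * ((k - 1 : ℕ) : ℝ) * (a k).eval ξ) * η ^ (k - 1 - 1) +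
        (k * curvature g ξ * (a k).eval ξ) * (η ^ (k - 1) * (1 + curvature g ξ * η) ^ (-1 : ℤ)) +
        ((speed g ξ)⁻¹ ^ 2 * (a k).derivative.derivative.eval ξ -
          (speed g ξ)⁻¹ ^ 3 * deriv (speed g) ξ * (a k).derivative.eval ξ) *
          (η ^ k * (1 + curvature g ξ * η) ^ (-2 : ℤ)) +
        (-((speed g ξ)⁻¹ ^ 2 * deriv (curvature g) ξ * (a k).derivative.eval ξ)) *
          (η ^ (k + 1) * (1 + curvature g ξ * η) ^ (-3 : ℤ))) := by
  have hs := (speed_pos hg ξ).ne'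
  have hsd : HasDerivAt (speed g) (deriv (speed g) ξ) ξ :=
    ((contDiff_speed (n := 2) hg).differentiable (by norm_num) ξ).hasDerivAt
  have hκd : HasDerivAt (curvature g) (deriv (curvature g) ξ) ξ :=
    ((contDiff_curvature (n := 1) hg).differentiable (by norm_num) ξ).hasDerivAt
  set s := speed g ξ with hs_def
  set κ := curvature g ξ with hκ_def
  have ht' : 1 + η * κ ≠ 0 := by rwa [mul_comm]
  have e1 : pd1 (fun w => frenetJacobian g w * pd1 (expand m a) w) (η, ξ) =
      s * κ * (∑ k ∈ Finset.range (m + 1), (k * η ^ (k - 1)) * (a k).eval ξ) +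
      s * (1 + η * κ) * ∑ k ∈ Finset.range (m + 1),
        (k * (((k - 1 : ℕ) : ℝ) * η ^ (k - 1 - 1))) * (a k).eval ξ := by
    rw [pd1_expand_eq]
    unfold pd1
    apply HasDerivAt.deriv
    have h1 : HasDerivAt (fun t : ℝ => speed g ξ * (1 + t * curvature g ξ))
        (s * (1 * κ)) η :=
      (((hasDerivAt_id η).mul_const (curvature g ξ)).const_add 1).const_mul (speed g ξ)
    have h2 : HasDerivAt (fun t : ℝ => ∑ k ∈ Finset.range (m + 1),
        (k * t ^ (k - 1)) * (a k).eval ξ) (∑ k ∈ Finset.range (m + 1),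
        (k * (((k - 1 : ℕ) : ℝ) * η ^ (k - 1 - 1))) * (a k).eval ξ) η := by
      apply HasDerivAt.fun_sum
      intro k _
      exact ((hasDerivAt_pow (k - 1) η).const_mul (k : ℝ)).mul_const ((a k).eval ξ)
    have h3 := h1.mul h2
    rw [one_mul] at h3
    exact h3
  have e2 : pd2 (fun w => (frenetJacobian g w)⁻¹ * pd2 (expand m a) w) (η, ξ) =
      -(deriv (speed g) ξ * (1 + η * κ) + s * (η * deriv (curvature g) ξ)) /
        (s * (1 + η * κ)) ^ 2 *
        (∑ k ∈ Finset.range (m + 1), η ^ k * (a k).derivative.eval ξ) +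
      (s * (1 + η * κ))⁻¹ *
        ∑ k ∈ Finset.range (m + 1), η ^ k * (a k).derivative.derivative.eval ξ := by
    rw [pd2_expand_eq]
    unfold pd2
    apply HasDerivAt.deriv
    have h1 : HasDerivAt (fun t : ℝ => speed g t * (1 + η * curvature g t))
        (deriv (speed g) ξ * (1 + η * κ) + s * (η * deriv (curvature g) ξ)) ξ :=
      hsd.mul ((hκd.const_mul η).const_add 1)
    have h2 := h1.inv (mul_ne_zero hs ht')
    have h3 : HasDerivAt (fun t : ℝ => ∑ k ∈ Finset.range (m + 1),
        η ^ k * (a k).derivative.eval t) (∑ k ∈ Finset.range (m + 1),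
        η ^ k * (a k).derivative.derivative.eval ξ) ξ := by
      apply HasDerivAt.fun_sum
      intro k _
      exact ((a k).derivative.hasDerivAt ξ).const_mul (η ^ k)
    have h4 := h2.mul h3
    exact h4
  unfold frenetLaplacian
  rw [e1, e2]
  simp only [Finset.mul_sum]
  rw [← Finset.sum_add_distrib, ← Finset.sum_add_distrib, ← Finset.sum_add_distrib, Finset.mul_sum]
  refine Finset.sum_congr rfl fun k _ => ?_
  have hJ : frenetJacobian g (η, ξ) = s * (1 + η * κ) := rfl
  rw [hJ, mul_comm κ η]
  simp only [zpow_neg, zpow_one]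
  rw [show ((1 + η * κ) ^ (2 : ℤ)) = (1 + η * κ) ^ 2 from by norm_cast,
    show ((1 + η * κ) ^ (3 : ℤ)) = (1 + η * κ) ^ 3 from by norm_cast]
  field_simp
  ring

/-- The coefficient of index j + 2 enters only through ∂_η², with the constant factor (j+2)!. The
j-th moment condition can therefore be solved for it. -/
lemma iteratedDeriv_laplacian_expand (hg : IsRegularJordanCurve 3 T g) (m : ℕ)
    (a : ℕ → Polynomial ℝ) (j : ℕ) (ξ : ℝ) :
    iteratedDeriv j (fun η => frenetLaplacian g (expand m a) (η, ξ)) 0 =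
      ∑ k ∈ Finset.range (m + 1), ((if k = j + 2 then ((j + 2).factorial : ℝ) else 0) *
        (a k).eval ξ + (lapCoef0 g j k ξ * (a k).eval ξ +
        lapCoef1 g j k ξ * (a k).derivative.eval ξ +
        lapCoef2 g j k ξ * (a k).derivative.derivative.eval ξ)) := by
  have h0 : ∀ᶠ η in 𝓝 (0 : ℝ), 1 + curvature g ξ * η ≠ 0 := by
    have hc : Continuous fun η : ℝ => 1 + curvature g ξ * η := by fun_prop
    exact hc.continuousAt.eventually_ne (by simp)
  rw [Filter.EventuallyEq.iteratedDeriv_eq j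
    (h0.mono fun η hη => frenetLaplacian_expand hg m a ξ η hη)]
  have hp : ∀ k : ℕ, ContDiffAt ℝ j (fun η : ℝ => η ^ k) 0 := fun k => by fun_prop
  have hz : ∀ (k : ℕ) (b : ℤ), ContDiffAt ℝ j
      (fun η : ℝ => η ^ k * (1 + curvature g ξ * η) ^ b) 0 :=
    fun k b => (hp k).mul (contDiffAt_affine_zpow _ _)
  have c1 : ∀ (x : ℝ) (k : ℕ), ContDiffAt ℝ j (fun η : ℝ => x * η ^ k) 0 :=
    fun x k => contDiffAt_const.mul (hp k)
  have c2 : ∀ (x : ℝ) (k : ℕ) (b : ℤ), ContDiffAt ℝ j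
      (fun η : ℝ => x * (η ^ k * (1 + curvature g ξ * η) ^ b)) 0 :=
    fun x k b => contDiffAt_const.mul (hz k b)
  rw [iteratedDeriv_fun_sum fun k _ => (((c1 _ _).add (c2 _ _ _)).add (c2 _ _ _)).add (c2 _ _ _)]
  refine Finset.sum_congr rfl fun k _ => ?_
  rw [iteratedDeriv_fun_add (((c1 _ _).add (c2 _ _ _)).add (c2 _ _ _)) (c2 _ _ _),
    iteratedDeriv_fun_add ((c1 _ _).add (c2 _ _ _)) (c2 _ _ _),
    iteratedDeriv_fun_add (c1 _ _) (c2 _ _ _)]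
  simp only [iteratedDeriv_const_mul_field, iteratedDeriv_pow_mul_zpow,
    iteratedDeriv_fun_pow_zero, Nat.cast_ite, Nat.cast_zero]
  -- For k = j + 2 the factor is (j+2)(j+1)·j!. The truncated exponent k − 1 − 1 is harmless at k =
  -- 0, 1, where k(k−1) vanishes.
  have hlead : (k * ((k - 1 : ℕ) : ℝ)) * (if j = k - 1 - 1 then ((k - 1 - 1).factorial : ℝ) else 0)
      = if k = j + 2 then ((j + 2).factorial : ℝ) else 0 := by
    rcases k with _ | _ | k
    · simp
    · simp
    · simp only [Nat.add_sub_cancel, Nat.add_right_cancel_iff]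
      by_cases h : j = k
      · subst h
        rw [if_pos rfl, if_pos rfl]
        rw [Nat.factorial_succ, Nat.factorial_succ]
        push_cast
        ring
      · rw [if_neg h, if_neg (Ne.symm h)]
        simp
  unfold lapCoef0 lapCoef1 lapCoef2
  rw [← hlead]
  ring

/-- The triangular structure behind the recursion: undifferentiated coefficients occur only for 1 ≤
k ≤ j + 1, differentiated ones only for k ≤ j. In particular a₀ enters only through its derivatives,
so no bound on values of the function is needed. -/
lemma lapCoef_vanish (g : ℝ → ℝ × ℝ) {j k : ℕ} (ξ : ℝ) :
    (k = 0 ∨ j + 1 < k → lapCoef0 g j k ξ = 0) ∧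
    (j < k → lapCoef1 g j k ξ = 0 ∧ lapCoef2 g j k ξ = 0) := by
  refine ⟨?_, fun h => ?_⟩
  · rintro (h | h)
    · simp [lapCoef0, h]
    · have : ¬ k - 1 ≤ j := by omega
      simp [lapCoef0, powDerivZero, this]
  · have h1 : ¬ k ≤ j := by omega
    have h2 : ¬ k + 1 ≤ j := by omega
    simp [lapCoef1, lapCoef2, powDerivZero, h1, h2]

lemma continuous_powDerivZero (j k : ℕ) (a : ℤ) : Continuous (powDerivZero j k a) := by
  unfold powDerivZero
  split_ifs <;> fun_prop

lemma continuous_lapCoef (hg : IsRegularJordanCurve 3 T g) (j k : ℕ) :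
    Continuous (lapCoef0 g j k) ∧ Continuous (lapCoef1 g j k) ∧ Continuous (lapCoef2 g j k) := by
  have hs : Continuous (speed g) := (contDiff_speed (n := 2) hg).continuous
  have hsi : Continuous fun ξ => (speed g ξ)⁻¹ := hs.inv₀ fun ξ => (speed_pos hg ξ).ne'
  have hκ : Continuous (curvature g) := (contDiff_curvature (n := 1) hg).continuous
  have hsd : Continuous (deriv (speed g)) :=
    (contDiff_speed (n := 2) hg).continuous_deriv (by norm_num)
  have hκd : Continuous (deriv (curvature g)) :=
    (contDiff_curvature (n := 1) hg).continuous_deriv (by norm_num)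
  have hw : ∀ k a, Continuous fun ξ => powDerivZero j k a (curvature g ξ) :=
    fun k a => (continuous_powDerivZero j k a).comp hκ
  refine ⟨?_, ?_, ?_⟩
  · exact (continuous_const.mul hκ).mul (hw _ _)
  · exact (((hsi.pow 3).mul hsd).neg.mul (hw _ _)).sub (((hsi.pow 2).mul hκd).mul (hw _ _))
  · exact (hsi.pow 2).mul (hw _ _)

lemma exists_bound_of_periodic (hT : 0 < T) {f : ℝ → ℝ} (hf : Continuous f)
    (hp : Function.Periodic f T) : ∃ B : ℝ, 0 ≤ B ∧ ∀ x, |f x| ≤ B := by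
  obtain ⟨B, hB⟩ := (isCompact_Icc (a := 0) (b := T)).exists_bound_of_continuousOn hf.continuousOn
  have hall : ∀ x, |f x| ≤ B := by
    intro x
    obtain ⟨k, hk⟩ := exists_shift hT x
    rw [← hp.zsmul k x]
    exact hB _ (Ico_subset_Icc_self hk)
  exact ⟨B, (abs_nonneg _).trans (hall 0), hall⟩

lemma exists_lapCoef_bound (hg : IsRegularJordanCurve 3 T g) (j m : ℕ) :
    ∃ B : ℝ, 0 ≤ B ∧ ∀ k ≤ m, ∀ ξ, |lapCoef0 g j k ξ| ≤ B ∧ |lapCoef1 g j k ξ| ≤ B ∧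
      |lapCoef2 g j k ξ| ≤ B := by
  have hT := hg.period_pos
  have hsp := speed_periodic hg.periodic
  have hκp := curvature_periodic hg.periodic
  have p0 : ∀ k, Function.Periodic (lapCoef0 g j k) T := fun k x => by
    simp only [lapCoef0, hκp x]
  have p1 : ∀ k, Function.Periodic (lapCoef1 g j k) T := fun k x => by
    simp only [lapCoef1, hκp x, hsp x, deriv_periodic hκp x, deriv_periodic hsp x]
  have p2 : ∀ k, Function.Periodic (lapCoef2 g j k) T := fun k x => by
    simp only [lapCoef2, hκp x, hsp x]
  choose B0 hB0 hB0' using fun k => exists_bound_of_periodic hT (continuous_lapCoef hg j k).1 (p0 k)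
  choose B1 hB1 hB1' using
    fun k => exists_bound_of_periodic hT (continuous_lapCoef hg j k).2.1 (p1 k)
  choose B2 hB2 hB2' using
    fun k => exists_bound_of_periodic hT (continuous_lapCoef hg j k).2.2 (p2 k)
  refine ⟨∑ k ∈ Finset.range (m + 1), (B0 k + B1 k + B2 k), Finset.sum_nonneg fun k _ => by
    linarith [hB0 k, hB1 k, hB2 k], fun k hk ξ => ?_⟩
  have hle : B0 k + B1 k + B2 k ≤ ∑ k ∈ Finset.range (m + 1), (B0 k + B1 k + B2 k) :=
    Finset.single_le_sum (f := fun k => B0 k + B1 k + B2 k)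
      (fun k _ => by linarith [hB0 k, hB1 k, hB2 k]) (Finset.mem_range.mpr (by omega))
  refine ⟨(hB0' k ξ).trans ?_, (hB1' k ξ).trans ?_, (hB2' k ξ).trans ?_⟩ <;>
    linarith [hB0 k, hB1 k, hB2 k]

end Laplacian

/-! ### The jump of the flux is controlled by the tangential derivative on the interface -/

/-- `[ξ₀, ξ₁]` is comparable with the interval of centre `b` and radius `r ≤ 1`. -/
structure IsComparable (Λ b r ξ₀ ξ₁ : ℝ) : Prop where
  r_pos : 0 < r
  r_le : r ≤ 1
  left_le : ξ₀ ≤ b - r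
  le_right : b + r ≤ ξ₁
  le_left : b - Λ * r ≤ ξ₀
  right_le : ξ₁ ≤ b + Λ * r

lemma IsComparable.one_le {Λ b r ξ₀ ξ₁ : ℝ} (h : IsComparable Λ b r ξ₀ ξ₁) : 1 ≤ Λ := by
  have := h.r_pos
  have h1 : r * 1 ≤ r * Λ := by linarith [h.left_le, h.le_left]
  exact le_of_mul_le_mul_left h1 this

lemma IsComparable.abs_le {Λ b r ξ₀ ξ₁ t : ℝ} (h : IsComparable Λ b r ξ₀ ξ₁)
    (ht : t ∈ Icc ξ₀ ξ₁) : |t - b| ≤ Λ * r := by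
  rw [_root_.abs_le]
  constructor <;> linarith [h.le_left, h.right_le, ht.1, ht.2]

/-- The orthogonality relation reads c∫e² = −∫Fe with c ≥ 1. If N is the maximum of |e| on the inner
interval, the inverse inequality keeps |e| ≥ N/2 on an interval of length δ = r/(2Cp), so ∫e² ≥
δN²/4. The right side is at most Q·(Cp N)·2Λr, and division by rN gives N ≤ 16ΛCp²Q. -/
lemma moment_bound (m : ℕ) (Λ : ℝ) : ∃ C : ℝ, 1 ≤ C ∧ ∀ e : Polynomial ℝ, e.natDegree ≤ m →
    ∀ b r ξ₀ ξ₁ : ℝ, IsComparable Λ b r ξ₀ ξ₁ → ∀ (F : ℝ → ℝ) (Q c : ℝ), Continuous F → 1 ≤ c →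
      (∀ t ∈ Icc ξ₀ ξ₁, |F t| ≤ Q) →
      ∫ t in ξ₀..ξ₁, (c * e.eval t + F t) * e.eval t = 0 →
        ∀ t, |t - b| ≤ r → |e.eval t| ≤ C * Q := by
  obtain ⟨Cp, hCp, hinv⟩ := poly_inverse m Λ
  have hCp0 : 0 < Cp := by linarith
  refine ⟨16 * max 1 Λ * Cp ^ 2, ?_, ?_⟩
  · have h1 := le_max_left 1 Λ
    have h2 : 1 ≤ Cp ^ 2 := one_le_pow₀ hCp
    nlinarith
  intro e he b r ξ₀ ξ₁ hI F Q c hF hc hFQ hint t ht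
  have hr := hI.r_pos
  have hΛ := hI.one_le
  have hec : Continuous fun t => e.eval t := e.continuous
  obtain ⟨t₀, ht₀, hmax⟩ := (isCompact_Icc (a := b - r) (b := b + r)).exists_isMaxOn
    ⟨b, by constructor <;> linarith⟩ (hec.abs.continuousOn)
  set N := |e.eval t₀| with hN
  have hN0 : 0 ≤ N := abs_nonneg _
  have hb : ∀ t, |t - b| ≤ r → |e.eval t| ≤ N := by
    intro t ht
    have := _root_.abs_le.mp ht
    exact hmax (⟨by linarith, by linarith⟩ : t ∈ Icc (b - r) (b + r))
  have hQ0 : 0 ≤ Q := (abs_nonneg _).trans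
    (hFQ b ⟨by linarith [hI.left_le], by linarith [hI.le_right]⟩)
  refine (hb t ht).trans ?_
  rcases hN0.eq_or_lt with hN' | hNpos
  · rw [← hN']; positivity
  have hbig := hinv e he b r N hr hb
  set δ := r / (2 * Cp) with hδ
  have hδ0 : 0 < δ := by positivity
  have hδr : δ ≤ r := by
    rw [hδ, div_le_iff₀ (by positivity)]; nlinarith
  have hlip : ∀ t ∈ Icc (b - r) (b + r), |t - t₀| ≤ δ → N / 2 ≤ |e.eval t| := by
    intro t htI htd
    have := (convex_Icc (b - r) (b + r)).norm_image_sub_le_of_norm_deriv_le (𝕜 := ℝ)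
      (f := fun t => e.eval t) (C := Cp * N / r) (fun x _ => e.differentiable x)
      (fun x hx => by
        rw [Polynomial.deriv, Real.norm_eq_abs]
        refine (hbig x ?_).2
        rw [_root_.abs_le]
        constructor <;> nlinarith [hx.1, hx.2]) ht₀ htI
    have h2 : Cp * N / r * ‖t - t₀‖ ≤ N / 2 := by
      calc Cp * N / r * ‖t - t₀‖ ≤ Cp * N / r * δ := by
            refine mul_le_mul_of_nonneg_left htd (by positivity)
        _ = N / 2 := by rw [hδ]; field_simp
    have h3 := abs_sub_abs_le_abs_sub (e.eval t₀) (e.eval t)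
    rw [abs_sub_comm] at h3
    rw [Real.norm_eq_abs] at this
    linarith
  -- The interval of length δ with end point t₀ is taken on the side pointing towards b, so that it
  -- stays inside [b − r, b + r].
  obtain ⟨α, hα1, hα2, hαd⟩ : ∃ α, b - r ≤ α ∧ α + δ ≤ b + r ∧
      ∀ t ∈ Icc α (α + δ), |t - t₀| ≤ δ := by
    rcases le_total t₀ b with h | h
    · refine ⟨t₀, ht₀.1, by linarith, fun t ht => ?_⟩
      rw [_root_.abs_le]; constructor <;> linarith [ht.1, ht.2]
    · refine ⟨t₀ - δ, by linarith, by linarith [ht₀.2], fun t ht => ?_⟩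
      rw [_root_.abs_le]; constructor <;> linarith [ht.1, ht.2]
  have hsq : Continuous fun t => e.eval t ^ 2 := hec.pow 2
  have hlow : δ * (N ^ 2 / 4) ≤ ∫ t in ξ₀..ξ₁, e.eval t ^ 2 := by
    calc δ * (N ^ 2 / 4) = ∫ _ in α..(α + δ), N ^ 2 / 4 := by simp; ring
      _ ≤ ∫ t in α..(α + δ), e.eval t ^ 2 := by
          refine intervalIntegral.integral_mono_on (by linarith) (by simp)
            (hsq.intervalIntegrable _ _) fun t ht => ?_
          have h1 := hlip t ⟨by linarith [ht.1], by linarith [ht.2]⟩ (hαd t ht)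
          rw [← sq_abs (e.eval t)]
          nlinarith
      _ ≤ ∫ t in ξ₀..ξ₁, e.eval t ^ 2 := by
          refine intervalIntegral.integral_mono_interval (by linarith [hI.left_le]) (by linarith)
            (by linarith [hI.le_right]) ?_ (hsq.intervalIntegrable _ _)
          exact Eventually.of_forall fun t => sq_nonneg _
  have hsplit : c * ∫ t in ξ₀..ξ₁, e.eval t ^ 2 = -∫ t in ξ₀..ξ₁, F t * e.eval t := by
    have h1 : ∫ t in ξ₀..ξ₁, (c * e.eval t + F t) * e.eval t =
        (∫ t in ξ₀..ξ₁, c * e.eval t ^ 2) + ∫ t in ξ₀..ξ₁, F t * e.eval t := by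
      have i1 : Continuous fun t => c * e.eval t ^ 2 := continuous_const.mul hsq
      have i2 : Continuous fun t => F t * e.eval t := hF.mul hec
      rw [← intervalIntegral.integral_add (i1.intervalIntegrable _ _) (i2.intervalIntegrable _ _)]
      congr 1
      funext t
      ring
    rw [hint, intervalIntegral.integral_const_mul] at h1
    linarith
  have hup : |∫ t in ξ₀..ξ₁, F t * e.eval t| ≤ Q * (Cp * N) * (2 * Λ * r) := by
    have hle : ξ₀ ≤ ξ₁ := by linarith [hI.left_le, hI.le_right]
    have h1 := intervalIntegral.norm_integral_le_of_norm_le_const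
      (f := fun t => F t * e.eval t) (a := ξ₀) (b := ξ₁) (C := Q * (Cp * N)) ?_
    · refine h1.trans (mul_le_mul_of_nonneg_left ?_ (by positivity))
      rw [abs_of_nonneg (by linarith)]
      linarith [hI.le_left, hI.right_le]
    · intro x hx
      rw [uIoc_of_le hle] at hx
      have hx' := Ioc_subset_Icc_self hx
      rw [Real.norm_eq_abs, abs_mul]
      exact mul_le_mul (hFQ x hx') (hbig x (hI.abs_le hx')).1 (abs_nonneg _) hQ0
  have hI0 : 0 ≤ ∫ t in ξ₀..ξ₁, e.eval t ^ 2 := le_trans (by positivity) hlow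
  have hfin : δ * (N ^ 2 / 4) ≤ Q * (Cp * N) * (2 * Λ * r) := by
    have h1 := neg_abs_le (∫ t in ξ₀..ξ₁, F t * e.eval t)
    nlinarith
  have hfin2 : (r * N) * N ≤ (r * N) * (16 * Λ * Cp ^ 2 * Q) := by
    have e1 : δ * (N ^ 2 / 4) * (8 * Cp) = (r * N) * N := by rw [hδ]; field_simp; ring
    rw [← e1]
    calc δ * (N ^ 2 / 4) * (8 * Cp) ≤ Q * (Cp * N) * (2 * Λ * r) * (8 * Cp) :=
          mul_le_mul_of_nonneg_right hfin (by positivity)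
      _ = _ := by ring
  have hfin3 := le_of_mul_le_mul_left hfin2 (by positivity)
  refine hfin3.trans ?_
  have := le_max_right 1 Λ
  gcongr

/-! ### Recursion for the normal Taylor coefficients of the flux jump -/

section Recursion

variable {T : ℝ} {g : ℝ → ℝ × ℝ}

/-- The hypotheses on the difference `D = ∑ₖ ηᵏ eₖ(ξ)` of the fluxes of the two branches: the
conormal derivative of `D` vanishes on the interface, and so do the moments of the normal
derivatives of its Laplacian; `S` bounds the tangential derivative on the interface. -/
structure IsFluxJump (m : ℕ) (g : ℝ → ℝ × ℝ) (Λ b r ξ₀ ξ₁ S : ℝ) (e : ℕ → Polynomial ℝ) :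
    Prop where
  comparable : IsComparable Λ b r ξ₀ ξ₁
  degree : ∀ k, (e k).natDegree ≤ m
  flux : 1 ≤ m → e 1 = 0
  moments : ∀ j : ℕ, j + 2 ≤ m → ∀ q : Polynomial ℝ, q.natDegree ≤ m →
    ∫ ξ in ξ₀..ξ₁,
      iteratedDeriv j (fun η => frenetLaplacian g (expand m e) (η, ξ)) 0 * q.eval ξ = 0
  tangential : ∀ t, |t - b| ≤ r → |(e 0).derivative.eval t| ≤ S

/-- The hypothesis says eₖ = O(S r^{1−k}) for 1 ≤ k ≤ j + 1, and e₀' = O(S). Each derivative costs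
1/r, so every lower term in the j-th derivative of the Laplacian is O(S r^{−j−1}), and
`moment_bound` passes this order on to e_{j+2}, which is again the required scaling. -/
lemma fluxJump_coeff_step (m : ℕ) (hg : IsRegularJordanCurve (max 2 (m + 1)) T g) (Λ : ℝ) (j : ℕ)
    (hj : j + 2 ≤ m) (C : ℝ) (hC : 1 ≤ C) : ∃ C' : ℝ, 1 ≤ C' ∧ ∀ b r ξ₀ ξ₁ S e,
      IsFluxJump m g Λ b r ξ₀ ξ₁ S e →
      (∀ k, 1 ≤ k → k ≤ j + 1 → ∀ t, |t - b| ≤ r → r ^ k * |(e k).eval t| ≤ C * r * S) →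
      ∀ t, |t - b| ≤ r → r ^ (j + 2) * |(e (j + 2)).eval t| ≤ C' * r * S := by
  have hg3 : IsRegularJordanCurve 3 T g := hg.of_le (by omega)
  obtain ⟨Cp, hCp, hinv⟩ := poly_inverse m Λ
  obtain ⟨B, hB0, hB⟩ := exists_lapCoef_bound hg3 j m
  obtain ⟨Cm, hCm, hmom⟩ := moment_bound m Λ
  refine ⟨max 1 (Cm * ((m + 1) * (3 * B * (Cp ^ 2 * C)))), le_max_left _ _, ?_⟩
  intro b r ξ₀ ξ₁ S e he hprev t ht
  have hI := he.comparable
  have hr := hI.r_pos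
  have hr1 := hI.r_le
  have hΛ := hI.one_le
  have hS0 : 0 ≤ S := (abs_nonneg _).trans (he.tangential b (by simpa using hr.le))
  have hCp0 : 0 < Cp := by linarith
  set F : ℝ → ℝ := fun ξ => ∑ k ∈ Finset.range (m + 1), (lapCoef0 g j k ξ * (e k).eval ξ +
        lapCoef1 g j k ξ * (e k).derivative.eval ξ +
        lapCoef2 g j k ξ * (e k).derivative.derivative.eval ξ) with hF
  have hFc : Continuous F := by
    refine continuous_finsetSum _ fun k _ => ?_
    obtain ⟨c0, c1, c2⟩ := continuous_lapCoef hg3 j k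
    exact ((c0.mul (e k).continuous).add (c1.mul (e k).derivative.continuous)).add
      (c2.mul (e k).derivative.derivative.continuous)
  have hdeg' : ∀ k, (e k).derivative.natDegree ≤ m := fun k =>
    (Polynomial.natDegree_derivative_le _).trans ((Nat.sub_le _ _).trans (he.degree k))
  set U := Cp ^ 2 * C * S / r ^ (j + 1) with hU
  have hrj : 0 < r ^ (j + 1) := by positivity
  -- Since r ≤ 1, all powers r^{−i} with i ≤ j + 1 are dominated by the worst one.
  have hbase : ∀ x y : ℝ, 0 ≤ x → x ≤ Cp ^ 2 * C → ∀ i, i ≤ j + 1 → |y| ≤ x * S / r ^ i →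
      |y| ≤ U := by
    intro x y hx0 hx i hi hy
    refine hy.trans ?_
    rw [hU]
    have h1 : r ^ (j + 1) ≤ r ^ i := pow_le_pow_of_le_one hr.le hr1 hi
    gcongr
  have hCpC : 1 ≤ Cp * C := by nlinarith
  have hterm : ∀ k ∈ Finset.range (m + 1), ∀ ξ ∈ Icc ξ₀ ξ₁,
      |lapCoef0 g j k ξ * (e k).eval ξ + lapCoef1 g j k ξ * (e k).derivative.eval ξ +
        lapCoef2 g j k ξ * (e k).derivative.derivative.eval ξ| ≤ 3 * B * U := by
    intro k hk ξ hξ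
    have hkm : k ≤ m := by simpa [Nat.lt_succ_iff] using hk
    obtain ⟨b0, b1, b2⟩ := hB k hkm ξ
    obtain ⟨v0, v12⟩ := lapCoef_vanish g (j := j) (k := k) ξ
    have hξb := hI.abs_le hξ
    have hU0 : 0 ≤ U := by rw [hU]; positivity
    have t0 : |lapCoef0 g j k ξ * (e k).eval ξ| ≤ B * U := by
      by_cases hk0 : k = 0 ∨ j + 1 < k
      · rw [v0 hk0]; simp; positivity
      · push Not at hk0
        rw [abs_mul]
        refine mul_le_mul b0 ?_ (abs_nonneg _) hB0
        have h1 := (hinv (e k) (he.degree k) b r (C * r * S / r ^ k) hr (fun s hs => by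
          rw [le_div_iff₀ (by positivity), mul_comm]
          exact hprev k (by omega) hk0.2 s hs) ξ hξb).1
        refine hbase (Cp * C) _ (by positivity) (by nlinarith) (k - 1) (by omega) (h1.trans_eq ?_)
        obtain ⟨l, rfl⟩ : ∃ l, k = l + 1 := ⟨k - 1, by omega⟩
        rw [Nat.add_sub_cancel, pow_succ]
        field_simp
    have t12 : |lapCoef1 g j k ξ * (e k).derivative.eval ξ| ≤ B * U ∧
        |lapCoef2 g j k ξ * (e k).derivative.derivative.eval ξ| ≤ B * U := by
      by_cases hkj : j < k
      · obtain ⟨v1, v2⟩ := v12 hkj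
        rw [v1, v2]; simp; positivity
      · push Not at hkj
        have hder : ∀ s, |s - b| ≤ r → |(e k).derivative.eval s| ≤ Cp * C * S / r ^ k := by
          intro s hs
          rcases Nat.eq_zero_or_pos k with rfl | hkpos
          · have := he.tangential s hs
            rw [pow_zero, div_one]
            nlinarith
          · have h1 := (hinv (e k) (he.degree k) b r (C * r * S / r ^ k) hr (fun s hs => by
              rw [le_div_iff₀ (by positivity), mul_comm]
              exact hprev k hkpos (by omega) s hs) s (hs.trans (by nlinarith))).2
            refine h1.trans_eq ?_
            field_simp
        have h2 := hinv _ (hdeg' k) b r _ hr hder ξ hξb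
        rw [abs_mul, abs_mul]
        refine ⟨mul_le_mul b1 ?_ (abs_nonneg _) hB0, mul_le_mul b2 ?_ (abs_nonneg _) hB0⟩
        · exact hbase (Cp ^ 2 * C) _ (by positivity) le_rfl k (by omega)
            (h2.1.trans_eq (by ring))
        · refine hbase (Cp ^ 2 * C) _ (by positivity) le_rfl (k + 1) (by omega)
            (h2.2.trans_eq ?_)
          field_simp
          ring
    calc _ ≤ |lapCoef0 g j k ξ * (e k).eval ξ| + |lapCoef1 g j k ξ * (e k).derivative.eval ξ| +
        |lapCoef2 g j k ξ * (e k).derivative.derivative.eval ξ| := abs_add_three _ _ _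
      _ ≤ B * U + B * U + B * U := add_le_add (add_le_add t0 t12.1) t12.2
      _ = 3 * B * U := by ring
  have hFQ : ∀ ξ ∈ Icc ξ₀ ξ₁, |F ξ| ≤ (m + 1) * (3 * B * U) := by
    intro ξ hξ
    calc |F ξ| ≤ ∑ k ∈ Finset.range (m + 1), _ := Finset.abs_sum_le_sum_abs _ _
      _ ≤ ∑ k ∈ Finset.range (m + 1), 3 * B * U := Finset.sum_le_sum fun k hk => hterm k hk ξ hξ
      _ = (m + 1) * (3 * B * U) := by simp
  have hfac : (1 : ℝ) ≤ ((j + 2).factorial : ℝ) := by exact_mod_cast Nat.factorial_pos _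
  -- The coefficient e_{j+2} has degree at most m and is thus an admissible test polynomial.
  have hzero : ∫ ξ in ξ₀..ξ₁, (((j + 2).factorial : ℝ) * (e (j + 2)).eval ξ + F ξ) *
      (e (j + 2)).eval ξ = 0 := by
    rw [← he.moments j hj _ (he.degree (j + 2))]
    congr 1
    funext ξ
    rw [iteratedDeriv_laplacian_expand hg3, Finset.sum_add_distrib]
    congr 2
    rw [Finset.sum_eq_single (j + 2)]
    · simp
    · intro k _ hk; simp [hk]
    · intro h; exact absurd (Finset.mem_range.mpr (by omega)) h
  have hres := hmom _ (he.degree (j + 2)) b r ξ₀ ξ₁ hI F _ _ hFc hfac hFQ hzero t ht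
  calc r ^ (j + 2) * |(e (j + 2)).eval t| ≤ r ^ (j + 2) * (Cm * ((m + 1) * (3 * B * U))) :=
        mul_le_mul_of_nonneg_left hres (by positivity)
    _ = Cm * ((m + 1) * (3 * B * (Cp ^ 2 * C))) * (r * S) := by
        rw [hU, show j + 2 = (j + 1) + 1 from rfl, pow_succ]; field_simp
    _ ≤ max 1 (Cm * ((m + 1) * (3 * B * (Cp ^ 2 * C)))) * (r * S) :=
        mul_le_mul_of_nonneg_right (le_max_right _ _) (by positivity)
    _ = _ := by ring

/-- Induction on the highest index: index 1 is trivial because e₁ = 0, and every later index j + 2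
has its own moment condition. The index 0 is excluded since only e₀' is controlled. -/
lemma fluxJump_coeff_bound (m : ℕ) (hg : IsRegularJordanCurve (max 2 (m + 1)) T g) (Λ : ℝ)
    (n : ℕ) : n ≤ m → ∃ C : ℝ, 1 ≤ C ∧ ∀ b r ξ₀ ξ₁ S e, IsFluxJump m g Λ b r ξ₀ ξ₁ S e →
      ∀ k, 1 ≤ k → k ≤ n → ∀ t, |t - b| ≤ r → r ^ k * |(e k).eval t| ≤ C * r * S := by
  induction n with
  | zero => exact fun _ => ⟨1, le_rfl, fun _ _ _ _ _ _ _ k h1 h2 => by omega⟩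
  | succ n ih =>
    intro hn
    obtain ⟨C, hC, hprev⟩ := ih (by omega)
    have hS : ∀ {b r ξ₀ ξ₁ S e}, IsFluxJump m g Λ b r ξ₀ ξ₁ S e → 0 ≤ r * S := by
      intro b r ξ₀ ξ₁ S e he
      exact mul_nonneg he.comparable.r_pos.le ((abs_nonneg _).trans
        (he.tangential b (by simpa using he.comparable.r_pos.le)))
    rcases n with _ | j
    · refine ⟨1, le_rfl, fun b r ξ₀ ξ₁ S e he k h1 h2 t ht => ?_⟩
      obtain rfl : k = 1 := by omega
      rw [he.flux hn]
      simpa using hS he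
    · obtain ⟨C', hC', hstep⟩ := fluxJump_coeff_step m hg Λ j hn C hC
      refine ⟨max C C', le_max_of_le_left hC, fun b r ξ₀ ξ₁ S e he k h1 h2 t ht => ?_⟩
      rw [mul_assoc]
      rcases Nat.lt_or_ge k (j + 2) with h3 | h3
      · refine (hprev b r ξ₀ ξ₁ S e he k h1 (by omega) t ht).trans ?_
        rw [mul_assoc]
        exact mul_le_mul_of_nonneg_right (le_max_left _ _) (hS he)
      · obtain rfl : k = j + 2 := by omega
        refine (hstep b r ξ₀ ξ₁ S e he (fun k h1 h2 => hprev b r ξ₀ ξ₁ S e he k h1 h2) t ht).trans ?_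
        rw [mul_assoc]
        exact mul_le_mul_of_nonneg_right (le_max_right _ _) (hS he)

/-- For |η| of order r the scaling eₖ = O(S r^{1−k}) makes every term of both partial derivatives
O(S): k η^{k−1}eₖ directly, and ηᵏeₖ' after one inverse inequality. -/
lemma fluxJump_grad_bound (m : ℕ) (hg : IsRegularJordanCurve (max 2 (m + 1)) T g) (Λ : ℝ) :
    ∃ C : ℝ, 1 ≤ C ∧ ∀ b r ξ₀ ξ₁ S e, IsFluxJump m g Λ b r ξ₀ ξ₁ S e →
      ∀ z : ℝ × ℝ, |z.1| ≤ Λ * r → |z.2 - b| ≤ Λ * r → gradSize (expand m e) z ≤ C * S := by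
  obtain ⟨Cp, hCp, hinv⟩ := poly_inverse m Λ
  obtain ⟨C, hC, hco⟩ := fluxJump_coeff_bound m hg Λ m le_rfl
  set Λ' := max 1 Λ
  have hΛ' : 1 ≤ Λ' := le_max_left _ _
  refine ⟨(m + 1) * ((m + 1) * (Λ' ^ m * (Cp * C))) + (m + 1) * (Λ' ^ m * (Cp * C)), ?_, ?_⟩
  · have h1 : 1 ≤ Λ' ^ m * (Cp * C) := one_le_mul_of_one_le_of_one_le (one_le_pow₀ hΛ')
      (one_le_mul_of_one_le_of_one_le hCp hC)
    have h2 : (0 : ℝ) ≤ m := Nat.cast_nonneg m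
    nlinarith [mul_nonneg h2 (by linarith : (0 : ℝ) ≤ Λ' ^ m * (Cp * C)),
      mul_nonneg h2 (mul_nonneg h2 (by linarith : (0 : ℝ) ≤ Λ' ^ m * (Cp * C)))]
  intro b r ξ₀ ξ₁ S e he z hz1 hz2
  have hI := he.comparable
  have hr := hI.r_pos
  have hΛ := hI.one_le
  have hS0 : 0 ≤ S := (abs_nonneg _).trans (he.tangential b (by simpa using hr.le))
  have hz1' : |z.1| ≤ Λ' * r := hz1.trans (mul_le_mul_of_nonneg_right (le_max_right _ _) hr.le)
  have hzp : ∀ k, k ≤ m → |z.1| ^ k ≤ Λ' ^ m * r ^ k := by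
    intro k hk
    calc |z.1| ^ k ≤ (Λ' * r) ^ k := pow_le_pow_left₀ (abs_nonneg _) hz1' k
      _ = Λ' ^ k * r ^ k := mul_pow _ _ _
      _ ≤ _ := mul_le_mul_of_nonneg_right (pow_le_pow_right₀ hΛ' hk) (by positivity)
  have hk1 : ∀ k, 1 ≤ k → k ≤ m → |(e k).eval z.2| ≤ Cp * C * S * (r / r ^ k) ∧
      |(e k).derivative.eval z.2| ≤ Cp * C * S / r ^ k := by
    intro k h1 h2
    have h3 := hinv (e k) (he.degree k) b r (C * r * S / r ^ k) hr (fun s hs => by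
      rw [le_div_iff₀ (by positivity), mul_comm]
      exact hco b r ξ₀ ξ₁ S e he k h1 h2 s hs) z.2 hz2
    exact ⟨h3.1.trans_eq (by ring), h3.2.trans_eq (by field_simp)⟩
  have hk0 : |(e 0).derivative.eval z.2| ≤ Cp * C * S := by
    have := (hinv _ ((Polynomial.natDegree_derivative_le _).trans
      ((Nat.sub_le _ _).trans (he.degree 0))) b r S hr he.tangential z.2 hz2).1
    refine this.trans ?_
    have : 0 ≤ Cp * S := by positivity
    nlinarith
  have hp1 : |pd1 (expand m e) z| ≤ (m + 1) * ((m + 1) * (Λ' ^ m * (Cp * C))) * S := by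
    rw [pd1_expand_eq]
    calc _ ≤ ∑ k ∈ Finset.range (m + 1), |(k * z.1 ^ (k - 1)) * (e k).eval z.2| :=
          Finset.abs_sum_le_sum_abs _ _
      _ ≤ ∑ k ∈ Finset.range (m + 1), (m + 1) * (Λ' ^ m * (Cp * C)) * S := by
          refine Finset.sum_le_sum fun k hk => ?_
          have hkm : k ≤ m := by simpa [Nat.lt_succ_iff] using hk
          rcases k with _ | k
          · simp; positivity
          rw [abs_mul, abs_mul, abs_pow, Nat.add_sub_cancel]
          have a1 : |((k + 1 : ℕ) : ℝ)| ≤ m + 1 := by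
            rw [abs_of_nonneg (by positivity)]
            have : ((k + 1 : ℕ) : ℝ) ≤ m := by exact_mod_cast hkm
            linarith
          have a2 := hzp k (by omega)
          have a3 := (hk1 (k + 1) (by omega) hkm).1
          calc _ ≤ ((m + 1) * (Λ' ^ m * r ^ k)) * (Cp * C * S * (r / r ^ (k + 1))) := by
                gcongr
            _ = _ := by rw [pow_succ]; field_simp
      _ = _ := by simp; ring
  have hp2 : |pd2 (expand m e) z| ≤ (m + 1) * (Λ' ^ m * (Cp * C)) * S := by
    rw [pd2_expand_eq]
    unfold expand
    calc _ ≤ ∑ k ∈ Finset.range (m + 1), |z.1 ^ k * (e k).derivative.eval z.2| :=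
          Finset.abs_sum_le_sum_abs _ _
      _ ≤ ∑ k ∈ Finset.range (m + 1), (Λ' ^ m * (Cp * C)) * S := by
          refine Finset.sum_le_sum fun k hk => ?_
          have hkm : k ≤ m := by simpa [Nat.lt_succ_iff] using hk
          have a3 : |(e k).derivative.eval z.2| ≤ Cp * C * S / r ^ k := by
            rcases k with _ | k
            · simpa using hk0
            · exact (hk1 (k + 1) (by omega) hkm).2
          rw [abs_mul, abs_pow]
          calc _ ≤ (Λ' ^ m * r ^ k) * (Cp * C * S / r ^ k) :=
                mul_le_mul (hzp k hkm) a3 (abs_nonneg _) (by positivity)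
            _ = _ := by field_simp
      _ = _ := by simp; ring
  unfold gradSize
  linarith

end Recursion

/-! ### Comparison of the two branches of a local IFE function -/

lemma polynomial_eq_zero_of_Icc {q : Polynomial ℝ} {a b : ℝ} (hab : a < b)
    (h : ∀ t ∈ Icc a b, q.eval t = 0) : q = 0 :=
  Polynomial.eq_zero_of_infinite_isRoot q ((Icc_infinite hab).mono fun t ht => h t ht)

section LocalIFE

variable {T : ℝ} {g : ℝ → ℝ × ℝ}

lemma expand_zero (m : ℕ) (a : ℕ → Polynomial ℝ) (t : ℝ) : expand m a (0, t) = (a 0).eval t := by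
  unfold expand
  rw [Finset.sum_eq_single 0]
  · simp
  · intro k _ hk; simp [hk]
  · intro h; simp at h

lemma pd2_expand_zero (m : ℕ) (a : ℕ → Polynomial ℝ) (t : ℝ) :
    pd2 (expand m a) (0, t) = (a 0).derivative.eval t := by
  rw [pd2_expand_eq, expand_zero]

lemma pd1_expand_zero {m : ℕ} (hm : 1 ≤ m) (a : ℕ → Polynomial ℝ) (t : ℝ) :
    pd1 (expand m a) (0, t) = (a 1).eval t := by
  rw [pd1_expand_eq]
  simp only
  rw [Finset.sum_eq_single 1]
  · simp
  · intro k _ hk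
    rcases k with _ | _ | k
    · simp
    · exact absurd rfl hk
    · simp
  · intro h; exact absurd (Finset.mem_range.mpr (by omega)) h

/-- The coefficients of the difference of the fluxes of the two branches. -/
def fluxDiff (β : Bool → ℝ) (a : Bool → ℕ → Polynomial ℝ) (k : ℕ) : Polynomial ℝ :=
  Polynomial.C (β true) * a true k - Polynomial.C (β false) * a false k

lemma pd1_expand_fluxDiff (m : ℕ) (β : Bool → ℝ) (a : Bool → ℕ → Polynomial ℝ) (z : ℝ × ℝ) :
    pd1 (expand m (fluxDiff β a)) z =
      β true * pd1 (expand m (a true)) z - β false * pd1 (expand m (a false)) z := by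
  simp only [pd1_expand_eq, Finset.mul_sum]
  rw [← Finset.sum_sub_distrib]
  refine Finset.sum_congr rfl fun k _ => ?_
  simp [fluxDiff]
  ring

lemma pd2_expand_fluxDiff (m : ℕ) (β : Bool → ℝ) (a : Bool → ℕ → Polynomial ℝ) (z : ℝ × ℝ) :
    pd2 (expand m (fluxDiff β a)) z =
      β true * pd2 (expand m (a true)) z - β false * pd2 (expand m (a false)) z := by
  simp only [pd2_expand_eq, expand, Finset.mul_sum]
  rw [← Finset.sum_sub_distrib]
  refine Finset.sum_congr rfl fun k _ => ?_
  simp [fluxDiff]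
  ring

/-- The conditions on the segment become polynomial identities, since the segment has positive
length. The two traces agree, so e₀ is β⁺ − β⁻ times the common trace, and 0 ≤ β⁺ − β⁻ ≤ β⁺ yields
the bound β⁺S whichever side s₀ is used. -/
lemma isFluxJump_of_isLocalIFE {m : ℕ} (hg : IsRegularJordanCurve (max 2 (m + 1)) T g)
    {Λ b r ξ₀ ξ₁ S : ℝ} {β : Bool → ℝ} (hβ : 0 < β false) (hβ' : β false ≤ β true)
    {a : Bool → ℕ → Polynomial ℝ} (hI : IsComparable Λ b r ξ₀ ξ₁)
    (ha : ∀ s k, (a s k).natDegree ≤ m)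
    (hp : IsLocalIFE m g β ξ₀ ξ₁ (fun s => expand m (a s))) (s₀ : Bool)
    (hS : ∀ t, |t - b| ≤ r → |pd2 (expand m (a s₀)) (0, t)| ≤ S) :
    IsFluxJump m g Λ b r ξ₀ ξ₁ (β true * S) (fluxDiff β a) := by
  have hlt : ξ₀ < ξ₁ := by linarith [hI.left_le, hI.le_right, hI.r_pos]
  have h00 : a true 0 = a false 0 := by
    refine sub_eq_zero.mp (polynomial_eq_zero_of_Icc hlt fun t ht => ?_)
    have := hp.jump t ht
    simp only [expand_zero] at this
    simpa using this
  refine ⟨hI, fun k => ?_, fun hm => ?_, fun j hj q hq => ?_, fun t ht => ?_⟩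
  · exact (Polynomial.natDegree_sub_le _ _).trans (max_le
      ((Polynomial.natDegree_C_mul_le _ _).trans (ha true k))
      ((Polynomial.natDegree_C_mul_le _ _).trans (ha false k)))
  · refine polynomial_eq_zero_of_Icc hlt fun t ht => ?_
    have := hp.flux t ht
    simp only [pd1_expand_zero hm] at this
    simpa [fluxDiff] using this
  · have hg3 : IsRegularJordanCurve 3 T g := hg.of_le (by omega)
    refine Eq.trans ?_ (hp.extended j hj q hq)
    congr 1
    funext ξ
    congr 1
    simp only [iteratedDeriv_laplacian_expand hg3, Finset.mul_sum]
    rw [← Finset.sum_sub_distrib]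
    refine Finset.sum_congr rfl fun k _ => ?_
    generalize (if k = j + 2 then ((j + 2).factorial : ℝ) else 0) = d
    simp [fluxDiff]
    ring
  · have h1 : (fluxDiff β a 0).derivative.eval t =
        (β true - β false) * (a s₀ 0).derivative.eval t := by
      have h2 : ∀ s, a s 0 = a s₀ 0 := by
        intro s; cases s <;> cases s₀ <;> simp [h00]
      simp [fluxDiff, h2 true, h2 false]
      ring
    have h3 := hS t ht
    rw [pd2_expand_zero] at h3
    rw [h1, abs_mul, abs_of_nonneg (by linarith)]
    exact mul_le_mul (by linarith) h3 (abs_nonneg _) (by linarith)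

/-- The flux of the other branch differs from that of s₀ by ±∇D, and ∇D is of size β⁺S. The
coefficients β enter through this bound only, so C is uniform in the contrast. -/
lemma localIFE_grad_bound (m : ℕ) (hg : IsRegularJordanCurve (max 2 (m + 1)) T g) (Λ : ℝ) :
    ∃ C : ℝ, 1 ≤ C ∧ ∀ β : Bool → ℝ, 0 < β false → β false ≤ β true → ∀ b r ξ₀ ξ₁ : ℝ,
      IsComparable Λ b r ξ₀ ξ₁ → ∀ p, IsLocalIFE m g β ξ₀ ξ₁ p → ∀ (s₀ : Bool) (S : ℝ),
      (∀ z : ℝ × ℝ, |z.1| ≤ Λ * r → |z.2 - b| ≤ Λ * r → gradSize (p s₀) z ≤ S) →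
      ∀ s, ∀ z : ℝ × ℝ, |z.1| ≤ Λ * r → |z.2 - b| ≤ Λ * r →
        β s * gradSize (p s) z ≤ C * β true * S := by
  obtain ⟨C, hC, hD⟩ := fluxJump_grad_bound m hg Λ
  refine ⟨C + 1, by linarith, ?_⟩
  intro β hβ hβ' b r ξ₀ ξ₁ hI p hp s₀ S hS s z hz1 hz2
  choose a ha hpa using fun s => mem_tensorPoly_iff_expand.mp (hp.poly s)
  have hpe : p = fun s => expand m (a s) := funext fun s => hpa s
  subst hpe
  have hr := hI.r_pos
  have hΛ := hI.one_le
  have hflux := isFluxJump_of_isLocalIFE hg hβ hβ' hI ha hp s₀ (S := S) fun t ht => by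
    refine le_trans ?_ (hS (0, t) (by simp; positivity) (ht.trans (by nlinarith)))
    exact le_add_of_nonneg_left (abs_nonneg _)
  have hDz := hD b r ξ₀ ξ₁ _ _ hflux z hz1 hz2
  have hSz := hS z hz1 hz2
  have hS0 : 0 ≤ S := (gradSize_nonneg _ _).trans hSz
  have hβt : 0 < β true := hβ.trans_le hβ'
  have hβs : ∀ s, 0 < β s ∧ β s ≤ β true := by
    intro s; cases s
    · exact ⟨hβ, hβ'⟩
    · exact ⟨hβt, le_rfl⟩
  have hbt : 0 ≤ β true * S := by positivity
  by_cases hs : s = s₀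
  · subst hs
    calc β s * gradSize (expand m (a s)) z ≤ β true * S :=
          mul_le_mul (hβs s).2 hSz (gradSize_nonneg _ _) hβt.le
      _ ≤ (C + 1) * β true * S := by nlinarith
  · have key : β s * gradSize (expand m (a s)) z ≤ gradSize (expand m (fluxDiff β a)) z +
        β s₀ * gradSize (expand m (a s₀)) z := by
      unfold gradSize
      rw [pd1_expand_fluxDiff, pd2_expand_fluxDiff, mul_add, mul_add]
      have habs : ∀ (s : Bool) (x : ℝ), β s * |x| = |β s * x| := fun s x => by
        rw [abs_mul, abs_of_pos (hβs s).1]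
      simp only [habs]
      have e1 : ∀ x y : ℝ, |x| ≤ |x - y| + |y| := fun x y => by
        have := abs_add_le (x - y) y
        simpa using this
      have e2 : ∀ x y : ℝ, |y| ≤ |x - y| + |x| := fun x y => by
        have := e1 y x
        rwa [abs_sub_comm] at this
      cases s <;> cases s₀
      · exact absurd rfl hs
      · linarith [e2 (β true * pd1 (expand m (a true)) z) (β false * pd1 (expand m (a false)) z),
          e2 (β true * pd2 (expand m (a true)) z) (β false * pd2 (expand m (a false)) z)]
      · linarith [e1 (β true * pd1 (expand m (a true)) z) (β false * pd1 (expand m (a false)) z),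
          e1 (β true * pd2 (expand m (a true)) z) (β false * pd2 (expand m (a false)) z)]
      · exact absurd rfl hs
    have h2 : β s₀ * gradSize (expand m (a s₀)) z ≤ β true * S :=
      mul_le_mul (hβs s₀).2 hSz (gradSize_nonneg _ _) hβt.le
    linarith

end LocalIFE

/-! ### Gradients in physical and in Frenet coordinates -/

section ChainRule

variable {T : ℝ} {g : ℝ → ℝ × ℝ} {c L h₁ : ℝ}

/-- Both bounds are limits of the Lipschitz bounds applied to difference quotients. -/
lemma fderiv_frenetMap_bounds (hg : IsRegularJordanCurve 2 T g) (tb : TubularBounds T g c L h₁)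
    {z : ℝ × ℝ} (hz : |z.1| < h₁) (v : ℝ × ℝ) :
    c * ‖v‖ ≤ ‖fderiv ℝ (frenetMap g) z v‖ ∧ ‖fderiv ℝ (frenetMap g) z v‖ ≤ L * ‖v‖ := by
  have hT := hg.period_pos
  have hd : HasFDerivAt (frenetMap g) (fderiv ℝ (frenetMap g) z) z :=
    ((contDiff_frenetMap hg).differentiable (by norm_num) z).hasFDerivAt
  have hlim := (hd.hasLineDerivAt v).tendsto_slope_zero.norm
  have hnear : ∀ᶠ t in 𝓝[≠] (0 : ℝ), |(z + t • v).1| < h₁ ∧ |z.2 - (z + t • v).2| < T / 2 := by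
    have c1 : Continuous fun t : ℝ => |(z + t • v).1| := by fun_prop
    have c2 : Continuous fun t : ℝ => |z.2 - (z + t • v).2| := by fun_prop
    have e1 : ∀ᶠ t in 𝓝 (0 : ℝ), |(z + t • v).1| < h₁ :=
      c1.continuousAt.eventually_lt continuousAt_const (by simpa using hz)
    have e2 : ∀ᶠ t in 𝓝 (0 : ℝ), |z.2 - (z + t • v).2| < T / 2 :=
      c2.continuousAt.eventually_lt continuousAt_const (by simpa using hT)
    exact (e1.and e2).filter_mono nhdsWithin_le_nhds
  have hne : ∀ᶠ t in 𝓝[≠] (0 : ℝ), t ≠ 0 := eventually_mem_nhdsWithin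
  have h1 := tb.h₁_le
  constructor
  · refine ge_of_tendsto hlim ?_
    filter_upwards [hnear, hne] with t ht ht0
    have := tb.lower (z + t • v) z ht.1.le hz.le (by rw [abs_sub_comm]; exact ht.2.le)
    rw [add_sub_cancel_left, norm_smul] at this
    rw [norm_smul, norm_inv, le_inv_mul_iff₀ (norm_pos_iff.mpr ht0)]
    linarith
  · refine le_of_tendsto hlim ?_
    filter_upwards [hnear, hne] with t ht ht0
    have := tb.upper (z + t • v) z (by linarith [ht.1]) (by linarith)
      (by rw [abs_sub_comm]; exact ht.2.le)
    rw [add_sub_cancel_left, norm_smul] at this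
    rw [norm_smul, norm_inv, inv_mul_le_iff₀ (norm_pos_iff.mpr ht0)]
    linarith

lemma abs_fderiv_apply_le {f : ℝ × ℝ → ℝ} {z : ℝ × ℝ} (hf : DifferentiableAt ℝ f z)
    (v : ℝ × ℝ) : |fderiv ℝ f z v| ≤ ‖v‖ * gradSize f z := by
  rw [fderiv_apply_eq_pd hf]
  have hv1 : |v.1| ≤ ‖v‖ := norm_fst_le v
  have hv2 : |v.2| ≤ ‖v‖ := norm_snd_le v
  calc |v.1 * pd1 f z + v.2 * pd2 f z| ≤ |v.1| * |pd1 f z| + |v.2| * |pd2 f z| := by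
        rw [← abs_mul, ← abs_mul]; exact abs_add_le _ _
    _ ≤ ‖v‖ * |pd1 f z| + ‖v‖ * |pd2 f z| := by gcongr
    _ = ‖v‖ * gradSize f z := by unfold gradSize; ring

/-- The branch u is known only through u ∘ P = p. As P is a local diffeomorphism, u is locally p
composed with a C¹ inverse, and the chain rule with the bounds c and L on the derivative of P gives
the two comparisons; the factor 2 comes from adding two partial derivatives. -/
lemma branch_regular (hg : IsRegularJordanCurve 2 T g) (tb : TubularBounds T g c L h₁)
    {z : ℝ × ℝ} (hz : |z.1| < h₁) {u p : ℝ × ℝ → ℝ} (hp : ContDiff ℝ 1 p)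
    (hup : ∀ᶠ w in 𝓝 z, u (frenetMap g w) = p w) :
    ContDiffAt ℝ 1 u (frenetMap g z) ∧
      gradSize u (frenetMap g z) ≤ 2 / c * gradSize p z ∧
      gradSize p z ≤ 2 * L * gradSize u (frenetMap g z) := by
  have hc := tb.c_pos
  have hP := contDiff_frenetMap hg
  set A := fderiv ℝ (frenetMap g) z with hA
  have hbd := fderiv_frenetMap_bounds hg tb hz
  have hinj : Function.Injective (A : ℝ × ℝ →ₗ[ℝ] ℝ × ℝ) := by
    rw [injective_iff_map_eq_zero]
    intro v hv
    have h1 := (hbd v).1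
    have hv' : fderiv ℝ (frenetMap g) z v = 0 := hv
    rw [hv', norm_zero] at h1
    exact norm_le_zero_iff.mp (nonpos_of_mul_nonpos_right h1 hc)
  set E : (ℝ × ℝ) ≃L[ℝ] (ℝ × ℝ) :=
    (LinearEquiv.ofInjectiveEndo (A : ℝ × ℝ →ₗ[ℝ] ℝ × ℝ) hinj).toContinuousLinearEquiv with hE
  have hEA : (E : ℝ × ℝ →L[ℝ] ℝ × ℝ) = A := by ext <;> rfl
  have hd : HasFDerivAt (frenetMap g) (E : ℝ × ℝ →L[ℝ] ℝ × ℝ) z := by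
    rw [hEA]; exact (hP.differentiable (by norm_num) z).hasFDerivAt
  have hPz : ContDiffAt ℝ 1 (frenetMap g) z := hP.contDiffAt
  have hs : HasStrictFDerivAt (frenetMap g) (E : ℝ × ℝ →L[ℝ] ℝ × ℝ) z :=
    hPz.hasStrictFDerivAt' hd (by norm_num)
  have hR : ContDiffAt ℝ 1 (hs.localInverse (frenetMap g) E z) (frenetMap g z) :=
    hPz.to_localInverse hd (by norm_num)
  have hRz : hs.localInverse (frenetMap g) E z (frenetMap g z) = z := hs.localInverse_apply_image
  have hu : ContDiffAt ℝ 1 u (frenetMap g z) := by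
    have h1 : ContDiffAt ℝ 1 (fun x => p (hs.localInverse (frenetMap g) E z x)) (frenetMap g z) :=
      hp.contDiffAt.comp _ hR
    refine h1.congr_of_eventuallyEq ?_
    filter_upwards [hs.eventually_right_inverse, hs.localInverse_tendsto.eventually hup]
      with x hx1 hx2
    rw [hx1] at hx2
    exact hx2
  have hud : DifferentiableAt ℝ u (frenetMap g z) := hu.differentiableAt (by norm_num)
  have hpd : DifferentiableAt ℝ p z := hp.differentiable (by norm_num) z
  have hchain : ∀ v, fderiv ℝ p z v = fderiv ℝ u (frenetMap g z) (A v) := by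
    intro v
    have h1 : HasFDerivAt (u ∘ frenetMap g) ((fderiv ℝ u (frenetMap g z)).comp A) z :=
      hud.hasFDerivAt.comp z (hP.differentiable (by norm_num) z).hasFDerivAt
    have h2 : (u ∘ frenetMap g) =ᶠ[𝓝 z] p := hup
    have h3 := h1.congr_of_eventuallyEq h2.symm
    rw [h3.fderiv]
    rfl
  refine ⟨hu, ?_, ?_⟩
  · obtain ⟨e1, e2⟩ := pd_eq_fderiv hud
    have key : ∀ v : ℝ × ℝ, ‖v‖ ≤ 1 → |fderiv ℝ u (frenetMap g z) v| ≤ 1 / c * gradSize p z := by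
      intro v hv
      have hAv : A (E.symm v) = v := by rw [← hEA]; exact E.apply_symm_apply v
      have h1 := (hbd (E.symm v)).1
      rw [← hA, hAv] at h1
      rw [← hAv, ← hchain]
      refine (abs_fderiv_apply_le hpd _).trans (mul_le_mul_of_nonneg_right ?_ (gradSize_nonneg _ _))
      rw [le_div_iff₀ hc]
      linarith
    have k1 := key (1, 0) (by simp [Prod.norm_def])
    have k2 := key (0, 1) (by simp [Prod.norm_def])
    rw [← e1] at k1
    rw [← e2] at k2
    calc gradSize u (frenetMap g z) ≤ 1 / c * gradSize p z + 1 / c * gradSize p z :=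
          add_le_add k1 k2
      _ = _ := by ring
  · obtain ⟨e1, e2⟩ := pd_eq_fderiv hpd
    have key : ∀ v : ℝ × ℝ, ‖v‖ ≤ 1 → |fderiv ℝ p z v| ≤ L * gradSize u (frenetMap g z) := by
      intro v hv
      rw [hchain]
      refine (abs_fderiv_apply_le hud _).trans (mul_le_mul_of_nonneg_right ?_ (gradSize_nonneg _ _))
      have h1 := (hbd v).2
      have := tb.L_pos
      exact h1.trans (by nlinarith)
    have k1 := key (1, 0) (by simp [Prod.norm_def])
    have k2 := key (0, 1) (by simp [Prod.norm_def])
    rw [← e1] at k1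
    rw [← e2] at k2
    calc gradSize p z ≤ L * gradSize u (frenetMap g z) + L * gradSize u (frenetMap g z) :=
          add_le_add k1 k2
      _ = _ := by ring

end ChainRule

/-! ### Pointwise control of the flux on an element -/

/-- The `ℓ¹` size at `x` of the gradient of `u` from the element `(i, j)`. -/
def brokenGradSize (M : RectMesh) (Ωp : Set (ℝ × ℝ)) (u : BrokenFun) (i j : ℕ) (x : ℝ × ℝ) : ℝ :=
  gradSize (u i j (sideAt M Ωp i j x)) x

/-- The element contains a box of size comparable with `h` on each point of which the energy
density controls the flux at every point of the element. -/
def HasGoodBox (M : RectMesh) (Ωp : Set (ℝ × ℝ)) (β : Bool → ℝ) (u : BrokenFun) (C δ : ℝ)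
    (i j : ℕ) : Prop :=
  ∃ xs : ℝ × ℝ, ∀ x, ‖x - xs‖ ≤ δ * M.h → x ∈ M.elem i j ∧ ∀ y ∈ M.elem i j,
    (coef M Ωp β i j y * brokenGradSize M Ωp u i j y) ^ 2 ≤
      C * gam β * (coef M Ωp β i j x * brokenGradSize M Ωp u i j x ^ 2)

/-! ### Elementary inequalities for the weights β and γ -/

section Weights

variable {β : Bool → ℝ}

lemma weight_pos (hβ : 0 < β false) (hβ' : β false ≤ β true) (s : Bool) : 0 < β s := by
  cases s
  · exact hβ
  · exact hβ.trans_le hβ'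

lemma weight_le (hβ' : β false ≤ β true) (s : Bool) : β s ≤ β true := by
  cases s
  · exact hβ'
  · exact le_rfl

lemma le_weight (hβ' : β false ≤ β true) (s : Bool) : β false ≤ β s := by
  cases s
  · exact le_rfl
  · exact hβ'

lemma gam_pos (hβ : 0 < β false) (hβ' : β false ≤ β true) : 0 < gam β := by
  have := hβ.trans_le hβ'
  unfold gam; positivity

/-- The only place where γ is forced: (β⁺)² = γβ⁻, and β⁻ is the smallest weight. -/
lemma sq_le_gam_mul (hβ : 0 < β false) (hβ' : β false ≤ β true) (s : Bool) :
    β true ^ 2 ≤ gam β * β s := by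
  unfold gam
  rw [div_mul_eq_mul_div, le_div_iff₀ hβ]
  exact mul_le_mul_of_nonneg_left (le_weight hβ' s) (sq_nonneg _)

lemma flux_sq_le (hβ : 0 < β false) (hβ' : β false ≤ β true) {s : Bool} {F A G : ℝ}
    (hF0 : 0 ≤ F) (hF : F ≤ A * (β true * G)) : F ^ 2 ≤ A ^ 2 * gam β * (β s * G ^ 2) := by
  calc F ^ 2 ≤ (A * (β true * G)) ^ 2 := pow_le_pow_left₀ hF0 hF 2
    _ = A ^ 2 * G ^ 2 * β true ^ 2 := by ring
    _ ≤ A ^ 2 * G ^ 2 * (gam β * β s) :=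
        mul_le_mul_of_nonneg_left (sq_le_gam_mul hβ hβ' s) (by positivity)
    _ = _ := by ring

end Weights

/-! ### Good boxes on non-interface and on interface elements -/

section GoodBox

variable {m : ℕ} {T : ℝ} {g : ℝ → ℝ × ℝ}

lemma HasGoodBox.mono {M : RectMesh} {Ωp : Set (ℝ × ℝ)} {β : Bool → ℝ} {u : BrokenFun}
    {C C' δ δ' : ℝ} {i j : ℕ} (hβ : 0 < β false) (hβ' : β false ≤ β true)
    (h : HasGoodBox M Ωp β u C δ i j) (hC : C ≤ C') (hδ : δ' ≤ δ) :
    HasGoodBox M Ωp β u C' δ' i j := by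
  obtain ⟨xs, hxs⟩ := h
  refine ⟨xs, fun x hx => ?_⟩
  obtain ⟨h1, h2⟩ := hxs x (hx.trans (mul_le_mul_of_nonneg_right hδ M.h_pos.le))
  refine ⟨h1, fun y hy => (h2 y hy).trans ?_⟩
  have hγ := gam_pos hβ hβ'
  have hs : 0 < coef M Ωp β i j x := weight_pos hβ hβ' _
  gcongr

lemma gradSize_congr {f f' : ℝ × ℝ → ℝ} {x : ℝ × ℝ} (h : f =ᶠ[𝓝 x] f') :
    gradSize f x = gradSize f' x := by
  have h1 : (fun s => f (s, x.2)) =ᶠ[𝓝 x.1] fun s => f' (s, x.2) :=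
    (by fun_prop : Continuous fun s : ℝ => (s, x.2)).continuousAt.tendsto.eventually h
  have h2 : (fun s => f (x.1, s)) =ᶠ[𝓝 x.2] fun s => f' (x.1, s) :=
    (by fun_prop : Continuous fun s : ℝ => (x.1, s)).continuousAt.tendsto.eventually h
  unfold gradSize pd1 pd2
  rw [h1.deriv_eq, h2.deriv_eq]

lemma eventually_nhds_of_nhdsSet {K : Set (ℝ × ℝ)} {p : ℝ × ℝ → Prop} (h : ∀ᶠ x in 𝓝ˢ K, p x)
    {x : ℝ × ℝ} (hx : x ∈ K) : ∀ᶠ y in 𝓝 x, p y :=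
  h.filter_mono (nhds_le_nhdsSet hx)

lemma exists_goodBox_of_not_interface (m : ℕ) (g : ℝ → ℝ × ℝ) (ϱ : ℝ) : ∃ C δ : ℝ, 1 ≤ C ∧ 0 < δ ∧
    ∀ M : RectMesh, M.ShapeRegular ϱ → ∀ Ωp Ωm : Set (ℝ × ℝ), M.IsSplit g Ωp Ωm →
    ∀ β : Bool → ℝ, 0 < β false → β false ≤ β true → ∀ u : BrokenFun, ∀ i < M.nx, ∀ j < M.ny,
    ¬ M.IsInterfaceElem g i j →
    (∃ p ∈ tensorPoly m, ∀ s, ∀ᶠ x in 𝓝ˢ (M.elem i j), u i j s x = p x) →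
      HasGoodBox M Ωp β u C δ i j := by
  set R := 1 + |ϱ| with hR
  have hR1 : 1 ≤ R := by rw [hR]; linarith [abs_nonneg ϱ]
  -- The small box has radius r = h/(8R): then 2r = h/(4R) keeps the good box inside the element,
  -- while 8R·r = h covers the whole element.
  obtain ⟨C, ε, hC, hε, hε1, hbox⟩ := tensorPoly_good_box m (8 * R) (by linarith)
  refine ⟨C ^ 2, ε / (8 * R), one_le_pow₀ hC, by positivity, ?_⟩
  rintro M hM Ωp Ωm hΩ β hβ hβ' u i hi j hj hni ⟨p, hp, hup⟩
  obtain ⟨s, hs⟩ := exists_sideAt_const hΩ hi hj hni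
  have hh := M.h_pos
  have hr : 0 < M.h / (8 * R) := by positivity
  obtain ⟨xs, hxs, hgood⟩ := hbox p hp (M.center i j) _ hr
  refine ⟨xs, fun x hx => ?_⟩
  have hx' : ‖x - xs‖ ≤ ε * (M.h / (8 * R)) := hx.trans_eq (by ring)
  have hxK : x ∈ M.elem i j := by
    refine interior_subset (RectMesh.mem_interior_elem_of_near hM ?_)
    have h1 : ‖x - M.center i j‖ ≤ 2 * (M.h / (8 * R)) := by
      calc _ ≤ ‖x - xs‖ + ‖xs - M.center i j‖ := norm_sub_le_norm_sub_add_norm_sub _ _ _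
        _ ≤ M.h / (8 * R) + M.h / (8 * R) := add_le_add (hx'.trans (by nlinarith)) hxs
        _ = _ := by ring
    calc 2 * R * ‖x - M.center i j‖ ≤ 2 * R * (2 * (M.h / (8 * R))) := by gcongr
      _ = M.h / 2 := by field_simp; norm_num
      _ < M.h := by linarith
  refine ⟨hxK, fun y hy => ?_⟩
  have hgx : brokenGradSize M Ωp u i j x = gradSize p x :=
    gradSize_congr (eventually_nhds_of_nhdsSet (hup _) hxK)
  have hgy : brokenGradSize M Ωp u i j y = gradSize p y :=
    gradSize_congr (eventually_nhds_of_nhdsSet (hup _) hy)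
  have hgr := hgood x hx' y (by
    calc ‖y - M.center i j‖ ≤ M.h :=
          RectMesh.norm_sub_le_of_mem_elem hy (interior_subset (M.center_mem_interior i j))
      _ = 8 * R * (M.h / (8 * R)) := by field_simp)
  have hβs := weight_pos hβ hβ' s
  unfold coef
  rw [hs x hxK, hs y hy, hgx, hgy]
  refine flux_sq_le hβ hβ' (mul_nonneg hβs.le (gradSize_nonneg _ _)) ?_
  calc β s * gradSize p y ≤ β true * (C * gradSize p x) :=
        mul_le_mul (weight_le hβ' s) hgr (gradSize_nonneg _ _) (hβs.le.trans (weight_le hβ' s))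
    _ = _ := by ring

/-- A box in Frenet coordinates inside the Frenet element, on one side of the interface. -/
lemma exists_side_box {c L h₁ ϱ : ℝ} (hg : IsRegularJordanCurve 2 T g)
    (tb : TubularBounds T g c L h₁) {M : RectMesh} (hs : IsSmall T c h₁ M.h)
    (hM : M.ShapeRegular ϱ) {Ωp Ωm : Set (ℝ × ℝ)} (hΩ : M.IsSplit g Ωp Ωm) {i j : ℕ}
    (hi : i < M.nx) (hj : j < M.ny) {ξ₀ ξ₁ : ℝ} (hf : IsFictitious T g M.h (M.elem i j) ξ₀ ξ₁)
    {r : ℝ} (hr : 0 < r) (hrh : 32 * L * (1 + |ϱ|) * r = M.h) :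
    ∃ (zc b : ℝ × ℝ) (s₀ : Bool), zc ∈ frenetElem g M.h (M.elem i j) ξ₀ ξ₁ ∧
      ξ₀ ≤ zc.2 - r ∧ zc.2 + r ≤ ξ₁ ∧ ‖b - zc‖ ≤ 4 * r ∧
      ∀ z, ‖z - b‖ ≤ 2 * r → z ∈ frenetElem g M.h (M.elem i j) ξ₀ ξ₁ ∧
        4 * (1 + |ϱ|) * ‖frenetMap g z - M.center i j‖ ≤ M.h ∧
        sideAt M Ωp i j (frenetMap g z) = s₀ := by
  obtain ⟨zc, hzc, hPc⟩ := exists_frenetElem hf (interior_subset (M.center_mem_interior i j))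
  have hL := tb.L_pos
  have hR : 0 < 1 + |ϱ| := by positivity
  -- The radius 8r is the largest admissible in `frenetElem_center_box`, because 4LR·8r = h with R =
  -- 1 + |ϱ|.
  have hcb : ∀ z, ‖z - zc‖ ≤ 8 * r → z ∈ frenetElem g M.h (M.elem i j) ξ₀ ξ₁ ∧
      frenetMap g z ∈ interior (M.elem i j) ∧
      4 * (1 + |ϱ|) * ‖frenetMap g z - M.center i j‖ ≤ M.h := fun z hz =>
    frenetElem_center_box hg tb hs hM hf hzc hPc (by
      rw [← hrh]
      calc 4 * L * (1 + |ϱ|) * ‖z - zc‖ ≤ 4 * L * (1 + |ϱ|) * (8 * r) := by gcongr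
        _ = _ := by ring)
  have hl : ξ₀ ≤ zc.2 - r := by
    have := (hcb (zc.1, zc.2 - r) (by
      rw [Prod.norm_def]; refine max_le ?_ ?_ <;> simp [abs_of_pos hr] <;> linarith)).1.1.2.1
    exact this
  have hrr : zc.2 + r ≤ ξ₁ := by
    have := (hcb (zc.1, zc.2 + r) (by
      rw [Prod.norm_def]; refine max_le ?_ ?_ <;> simp [abs_of_pos hr] <;> linarith)).1.1.2.2
    exact this
  have hside : ∀ z, ‖z - zc‖ ≤ 8 * r →
      (0 < z.1 → sideAt M Ωp i j (frenetMap g z) = true) ∧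
      (z.1 < 0 → sideAt M Ωp i j (frenetMap g z) = false) := by
    intro z hz
    obtain ⟨h1, h2, -⟩ := hcb z hz
    obtain ⟨k1, k2⟩ := frenetMap_mem_side hg tb hΩ (z := z)
      ((abs_le_of_mem_Icc_neg h1.1.1).trans (by linarith [hs.le_h₁, M.h_pos]))
      (RectMesh.interior_elem_subset_domain hi hj h2)
    exact ⟨fun h => sideAt_eq_true hΩ.isOpen_p (k1 h),
      fun h => sideAt_eq_false hΩ.isOpen_m hΩ.disjoint (k2 h)⟩
  have htri : ∀ {b : ℝ × ℝ}, ‖b - zc‖ ≤ 4 * r → ∀ z, ‖z - b‖ ≤ 2 * r → ‖z - zc‖ ≤ 8 * r := by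
    intro b hb z hz
    calc ‖z - zc‖ ≤ ‖z - b‖ + ‖b - zc‖ := norm_sub_le_norm_sub_add_norm_sub _ _ _
      _ ≤ 8 * r := by linarith
  -- The box is shifted by 4r in η, away from the interface on the side of the centre. With radius
  -- 2r it stays within 6r of `zc` and at distance at least 2r from η = 0.
  rcases le_or_gt 0 zc.1 with h0 | h0
  · have hb : ‖((zc.1 + 4 * r, zc.2) : ℝ × ℝ) - zc‖ ≤ 4 * r := by
      rw [Prod.norm_def]; simp [abs_of_pos hr]; linarith
    refine ⟨zc, (zc.1 + 4 * r, zc.2), true, hzc, hl, hrr, hb, fun z hz => ?_⟩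
    obtain ⟨h1, -, h3⟩ := hcb z (htri hb z hz)
    refine ⟨h1, h3, (hside z (htri hb z hz)).1 ?_⟩
    have := (abs_le.mp ((abs_fst_sub_le z _).trans hz)).1
    simp only at this
    linarith
  · have hb : ‖((zc.1 - 4 * r, zc.2) : ℝ × ℝ) - zc‖ ≤ 4 * r := by
      rw [Prod.norm_def]; simp [abs_of_pos hr]; linarith
    refine ⟨zc, (zc.1 - 4 * r, zc.2), false, hzc, hl, hrr, hb, fun z hz => ?_⟩
    obtain ⟨h1, -, h3⟩ := hcb z (htri hb z hz)
    refine ⟨h1, h3, (hside z (htri hb z hz)).2 ?_⟩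
    have := (abs_le.mp ((abs_fst_sub_le z _).trans hz)).2
    simp only at this
    linarith

/-- The chain is: gradient of u at y, gradient of its branch in Frenet coordinates, gradient of the
branch s₀ at a point of the good Frenet box, gradient of u at the corresponding x. The four factors
multiply to A = (2/c)·Cl·Cg·(2L). -/
lemma exists_goodBox_of_interface (hg : IsRegularJordanCurve (max 2 (m + 1)) T g) (ϱ : ℝ)
    {c L h₁ : ℝ} (tb : TubularBounds T g c L h₁) : ∃ C δ : ℝ, 1 ≤ C ∧ 0 < δ ∧
    ∀ M : RectMesh, M.ShapeRegular ϱ → IsSmall T c h₁ M.h →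
    ∀ Ωp Ωm : Set (ℝ × ℝ), M.IsSplit g Ωp Ωm →
    ∀ β : Bool → ℝ, 0 < β false → β false ≤ β true → ∀ u : BrokenFun, ∀ i < M.nx, ∀ j < M.ny,
    (∃ ξ₀ ξ₁ : ℝ, ∃ p : Bool → ℝ × ℝ → ℝ,
        IsFictitious T g M.h (M.elem i j) ξ₀ ξ₁ ∧ IsLocalIFE m g β ξ₀ ξ₁ p ∧
        ∀ s, ∀ᶠ z in 𝓝ˢ (frenetElem g M.h (M.elem i j) ξ₀ ξ₁),
          u i j s (frenetMap g z) = p s z) →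
      HasGoodBox M Ωp β u C δ i j := by
  have hg2 : IsRegularJordanCurve 2 T g := hg.of_le (le_max_left _ _)
  have hc := tb.c_pos
  have hL := tb.L_pos
  set R := 1 + |ϱ| with hR
  have hR1 : 1 ≤ R := by rw [hR]; linarith [abs_nonneg ϱ]
  -- Chosen so that Λr dominates both h, which bounds |η|, and h/c, which bounds ξ₁ − ξ₀.
  set Λ := 32 * L * R * (1 + 1 / c) with hΛ
  have hLR : 1 ≤ L * R := one_le_mul_of_one_le_of_one_le hL hR1
  have hΛ1 : 32 * L * R ≤ Λ := by
    rw [hΛ]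
    have : 0 < 1 / c := by positivity
    nlinarith
  have hΛc : 32 * L * R * (1 / c) ≤ Λ := by
    rw [hΛ]; nlinarith
  -- Points of the large box are within 2Λr of `zc`, and `zc` is within 4r of the centre b of the
  -- one-sided box.
  obtain ⟨Cg, ε, hCg, hε, hε1, hbox⟩ := tensorPoly_good_box m (2 * Λ + 4) (by nlinarith)
  obtain ⟨Cl, hCl, hloc⟩ := localIFE_grad_bound m hg Λ
  set A := 2 / c * (Cl * Cg) * (2 * L) with hA
  -- The first entry keeps the physical square inside the element; the second, through the lower
  -- Lipschitz bound, puts its Frenet coordinates within εr of `zs`.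
  set δ := min (1 / (8 * R)) (c * ε / (32 * L * R)) with hδ
  refine ⟨max 1 (A ^ 2), δ, le_max_left _ _, by rw [hδ]; positivity, ?_⟩
  rintro M hM hs Ωp Ωm hΩ β hβ hβ' u i hi j hj ⟨ξ₀, ξ₁, p, hf, hp, hup⟩
  refine HasGoodBox.mono hβ hβ' (C := A ^ 2) (δ := δ) ?_ (le_max_right _ _) le_rfl
  have hh := M.h_pos
  set r := M.h / (32 * L * R) with hr_def
  have hr : 0 < r := by rw [hr_def]; positivity
  have hrh : 32 * L * R * r = M.h := by rw [hr_def]; field_simp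
  obtain ⟨zc, b, s₀, hzc, hl, hrr, hbz, hB⟩ := exists_side_box hg2 tb hs hM hΩ hi hj hf hr hrh
  have hlen := (elem_frenet_length hg2 tb hs hf).1
  have hlenΛ : ξ₁ - ξ₀ ≤ Λ * r := by
    calc ξ₁ - ξ₀ ≤ M.h / c := by rw [le_div_iff₀ hc]; linarith
      _ = 32 * L * R * (1 / c) * r := by rw [← hrh]; ring
      _ ≤ Λ * r := mul_le_mul_of_nonneg_right hΛc hr.le
  have hhΛ : M.h ≤ Λ * r := by rw [← hrh]; exact mul_le_mul_of_nonneg_right hΛ1 hr.le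
  have hI : IsComparable Λ zc.2 r ξ₀ ξ₁ := by
    refine ⟨hr, ?_, hl, hrr, ?_, ?_⟩
    · have h2 := hs.le_h₁
      have h3 := tb.h₁_le
      nlinarith
    · linarith [hzc.1.2.1, hzc.1.2.2]
    · linarith [hzc.1.2.1, hzc.1.2.2]
  have hW : ∀ w ∈ frenetElem g M.h (M.elem i j) ξ₀ ξ₁, |w.1| ≤ Λ * r ∧ |w.2 - zc.2| ≤ Λ * r :=
    fun w hw => ⟨(abs_le_of_mem_Icc_neg hw.1.1).trans hhΛ, hI.abs_le hw.1.2⟩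
  obtain ⟨zs, hzs, hgood⟩ := hbox (p s₀) (hp.poly s₀) b r hr
  obtain ⟨hzsK, hzsc, -⟩ := hB zs (by linarith)
  have hreg : ∀ s, ∀ w ∈ frenetElem g M.h (M.elem i j) ξ₀ ξ₁, _ := fun s w hw =>
    branch_regular hg2 tb (z := w) (u := u i j s)
      ((abs_le_of_mem_Icc_neg hw.1.1).trans_lt (by linarith [hs.le_h₁]))
      (tensorPoly_contDiff (hp.poly s)) (eventually_nhds_of_nhdsSet (hup s) hw)
  refine ⟨frenetMap g zs, fun x hx => ?_⟩
  have hxK : x ∈ M.elem i j := by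
    refine interior_subset (RectMesh.mem_interior_elem_of_near hM ?_)
    have h1 : ‖x - M.center i j‖ ≤ ‖x - frenetMap g zs‖ + ‖frenetMap g zs - M.center i j‖ :=
      norm_sub_le_norm_sub_add_norm_sub _ _ _
    have h2 : ‖x - frenetMap g zs‖ ≤ 1 / (8 * R) * M.h :=
      hx.trans (mul_le_mul_of_nonneg_right (min_le_left _ _) hh.le)
    have h3 : 2 * R * ‖x - frenetMap g zs‖ ≤ M.h / 4 := by
      calc 2 * R * ‖x - frenetMap g zs‖ ≤ 2 * R * (1 / (8 * R) * M.h) := by gcongr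
        _ = M.h / 4 := by field_simp; norm_num
    have h4 : 2 * R * ‖x - M.center i j‖ ≤
        2 * R * (‖x - frenetMap g zs‖ + ‖frenetMap g zs - M.center i j‖) := by gcongr
    linarith
  refine ⟨hxK, fun y hy => ?_⟩
  obtain ⟨z, hz, hzx⟩ := exists_frenetElem hf hxK
  obtain ⟨w, hw, hwy⟩ := exists_frenetElem hf hy
  have hznear : ‖z - zs‖ ≤ ε * r := by
    have h1 := frenetElem_lower hg2 tb hs hf hz hzsK
    rw [hzx] at h1
    have h2 : ‖x - frenetMap g zs‖ ≤ c * ε / (32 * L * R) * M.h :=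
      hx.trans (mul_le_mul_of_nonneg_right (min_le_right _ _) hh.le)
    have h3 : c * ε / (32 * L * R) * M.h = c * (ε * r) := by rw [hr_def]; ring
    exact le_of_mul_le_mul_left (by linarith) hc
  have hzb : ‖z - b‖ ≤ 2 * r := by
    calc ‖z - b‖ ≤ ‖z - zs‖ + ‖zs - b‖ := norm_sub_le_norm_sub_add_norm_sub _ _ _
      _ ≤ 2 * r := by nlinarith
  have hxs : sideAt M Ωp i j x = s₀ := by rw [← hzx]; exact (hB z hzb).2.2
  have hS : ∀ v : ℝ × ℝ, |v.1| ≤ Λ * r → |v.2 - zc.2| ≤ Λ * r →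
      gradSize (p s₀) v ≤ Cg * gradSize (p s₀) z := by
    intro v hv1 hv2
    refine hgood z hznear v ?_
    have hzc1 := (hW zc hzc).1
    have hv : ‖v - zc‖ ≤ 2 * Λ * r := by
      rw [Prod.norm_def]
      refine max_le ?_ ?_
      · have := abs_sub v.1 zc.1
        rw [Prod.fst_sub, Real.norm_eq_abs]
        linarith
      · rw [Prod.snd_sub, Real.norm_eq_abs]
        nlinarith
    calc ‖v - b‖ ≤ ‖v - zc‖ + ‖zc - b‖ := norm_sub_le_norm_sub_add_norm_sub _ _ _
      _ ≤ (2 * Λ + 4) * r := by rw [norm_sub_rev zc b]; linarith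
  have hbd := hloc β hβ hβ' zc.2 r ξ₀ ξ₁ hI p hp s₀ _ hS (sideAt M Ωp i j y) w
    (hW w hw).1 (hW w hw).2
  unfold coef brokenGradSize
  rw [hxs]
  set s := sideAt M Ωp i j y
  have hβs := weight_pos hβ hβ' s
  have hβt := weight_pos hβ hβ' true
  have hry := (hreg s w hw).2.1
  have hrx := (hreg s₀ z hz).2.2
  rw [hwy] at hry
  rw [hzx] at hrx
  refine flux_sq_le hβ hβ' (mul_nonneg hβs.le (gradSize_nonneg _ _)) ?_
  calc β s * gradSize (u i j s) y ≤ β s * (2 / c * gradSize (p s) w) :=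
        mul_le_mul_of_nonneg_left hry hβs.le
    _ = 2 / c * (β s * gradSize (p s) w) := by ring
    _ ≤ 2 / c * (Cl * β true * (Cg * gradSize (p s₀) z)) := by gcongr
    _ ≤ 2 / c * (Cl * β true * (Cg * (2 * L * gradSize (u i j s₀) x))) := by gcongr
    _ = A * (β true * gradSize (u i j s₀) x) := by rw [hA]; ring

/-- The branches of an IFE function are continuously differentiable on the element. -/
lemma ifeSpace_contDiffAt (hg : IsRegularJordanCurve 2 T g) {c L h₁ : ℝ}
    (tb : TubularBounds T g c L h₁) {M : RectMesh} (hs : IsSmall T c h₁ M.h) {β : Bool → ℝ}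
    {u : BrokenFun} (hu : u ∈ ifeSpace m T g M β) {i j : ℕ} (hi : i < M.nx) (hj : j < M.ny)
    (s : Bool) {x : ℝ × ℝ} (hx : x ∈ M.elem i j) : ContDiffAt ℝ 1 (u i j s) x := by
  have hh := M.h_pos
  obtain ⟨h1, h2⟩ := hu i hi j hj
  by_cases hK : M.IsInterfaceElem g i j
  · obtain ⟨ξ₀, ξ₁, p, hf, hp, hup⟩ := h2 hK
    obtain ⟨z, hz, hzx⟩ := exists_frenetElem hf hx
    rw [← hzx]
    exact (branch_regular hg tb ((abs_le_of_mem_Icc_neg hz.1.1).trans_lt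
      (by linarith [hs.le_h₁])) (tensorPoly_contDiff (hp.poly s))
      (eventually_nhds_of_nhdsSet (hup s) hz)).1
  · obtain ⟨p, hp, hup⟩ := h1 hK
    exact (tensorPoly_contDiff hp).contDiffAt.congr_of_eventuallyEq
      (eventually_nhds_of_nhdsSet (hup s) hx)

end GoodBox

/-! ### Bounded measurable functions on elements and edges -/

/-- `F` is bounded and Borel measurable on `s`. -/
def BddMeasOn (s : Set (ℝ × ℝ)) (F : ℝ × ℝ → ℝ) : Prop :=
  Measurable (s.indicator F) ∧ ∃ C, ∀ x ∈ s, |F x| ≤ C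

namespace BddMeasOn

variable {s t : Set (ℝ × ℝ)} {F G : ℝ × ℝ → ℝ}

lemma add (hF : BddMeasOn s F) (hG : BddMeasOn s G) : BddMeasOn s (fun x => F x + G x) := by
  obtain ⟨hF, C, hC⟩ := hF
  obtain ⟨hG, D, hD⟩ := hG
  refine ⟨?_, C + D, fun x hx => (abs_add_le _ _).trans (add_le_add (hC x hx) (hD x hx))⟩
  rw [indicator_add]
  exact hF.add hG

lemma mul (hF : BddMeasOn s F) (hG : BddMeasOn s G) : BddMeasOn s (fun x => F x * G x) := by
  obtain ⟨hF, C, hC⟩ := hF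
  obtain ⟨hG, D, hD⟩ := hG
  refine ⟨?_, C * D, fun x hx => ?_⟩
  · rw [indicator_mul]
    exact hF.mul hG
  · rw [abs_mul]
    exact mul_le_mul (hC x hx) (hD x hx) (abs_nonneg _) ((abs_nonneg _).trans (hC x hx))

lemma const (hs : MeasurableSet s) (a : ℝ) : BddMeasOn s (fun _ => a) :=
  ⟨measurable_const.indicator hs, |a|, fun _ _ => le_rfl⟩

lemma sub (hs : MeasurableSet s) (hF : BddMeasOn s F) (hG : BddMeasOn s G) :
    BddMeasOn s (fun x => F x - G x) := by
  have := hF.add ((const hs (-1)).mul hG)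
  simpa [sub_eq_add_neg] using this

lemma sq (hF : BddMeasOn s F) : BddMeasOn s (fun x => F x ^ 2) := by
  simpa [pow_two] using hF.mul hF

lemma mono (hF : BddMeasOn t F) (hs : MeasurableSet s) (hst : s ⊆ t) : BddMeasOn s F := by
  obtain ⟨hF, C, hC⟩ := hF
  refine ⟨?_, C, fun x hx => hC x (hst hx)⟩
  have : s.indicator F = s.indicator (t.indicator F) := by
    rw [indicator_indicator, inter_eq_left.mpr hst]
  rw [this]
  exact hF.indicator hs

lemma integrableOn (hF : BddMeasOn s F) (hs : MeasurableSet s) (hv : volume s ≠ ⊤) :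
    IntegrableOn F s := by
  obtain ⟨hF, C, hC⟩ := hF
  have h1 : IntegrableOn (s.indicator F) s := by
    refine Measure.integrableOn_of_bounded (M := C) hv hF.aestronglyMeasurable ?_
    rw [ae_restrict_iff' hs]
    exact Eventually.of_forall fun x hx => by rw [indicator_of_mem hx]; exact hC x hx
  exact h1.congr_fun (fun x hx => indicator_of_mem hx F) hs

lemma intervalIntegrable_vert {x a b : ℝ} (hab : a ≤ b)
    (hF : BddMeasOn ({x} ×ˢ Icc a b) F) : IntervalIntegrable (fun y => F (x, y)) volume a b := by
  obtain ⟨hF, C, hC⟩ := hF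
  rw [intervalIntegrable_iff_integrableOn_Icc_of_le hab]
  have hm : ∀ y ∈ Icc a b, (x, y) ∈ ({x} : Set ℝ) ×ˢ Icc a b := fun y hy => ⟨rfl, hy⟩
  have h1 : IntegrableOn (fun y => (({x} : Set ℝ) ×ˢ Icc a b).indicator F (x, y)) (Icc a b) := by
    refine Measure.integrableOn_of_bounded (M := C) (by simp)
      (hF.comp measurable_prodMk_left).aestronglyMeasurable ?_
    rw [ae_restrict_iff' measurableSet_Icc]
    exact Eventually.of_forall fun y hy => by
      rw [indicator_of_mem (hm y hy)]; exact hC _ (hm y hy)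
  exact h1.congr_fun (fun y hy => indicator_of_mem (hm y hy) F) measurableSet_Icc

lemma intervalIntegrable_horiz {y a b : ℝ} (hab : a ≤ b)
    (hF : BddMeasOn (Icc a b ×ˢ {y}) F) : IntervalIntegrable (fun x => F (x, y)) volume a b := by
  obtain ⟨hF, C, hC⟩ := hF
  rw [intervalIntegrable_iff_integrableOn_Icc_of_le hab]
  have hm : ∀ x ∈ Icc a b, (x, y) ∈ Icc a b ×ˢ ({y} : Set ℝ) := fun x hx => ⟨hx, rfl⟩
  have h1 : IntegrableOn (fun x => (Icc a b ×ˢ ({y} : Set ℝ)).indicator F (x, y)) (Icc a b) := by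
    refine Measure.integrableOn_of_bounded (M := C) (by simp)
      (hF.comp measurable_prodMk_right).aestronglyMeasurable ?_
    rw [ae_restrict_iff' measurableSet_Icc]
    exact Eventually.of_forall fun x hx => by
      rw [indicator_of_mem (hm x hx)]; exact hC _ (hm x hx)
  exact h1.congr_fun (fun x hx => indicator_of_mem (hm x hx) F) measurableSet_Icc

end BddMeasOn

lemma isOpen_forall_segment {U : Set (ℝ × ℝ)} (hU : IsOpen U) (c : ℝ × ℝ) (a b : ℝ) :
    IsOpen {x : ℝ × ℝ | ∀ t ∈ Icc a b, x + t • (c - x) ∈ U} := by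
  rw [isOpen_iff_mem_nhds]
  intro x hx
  refine IsCompact.eventually_forall_of_forall_eventually (isCompact_Icc (a := a) (b := b))
    (P := fun (x : ℝ × ℝ) (t : ℝ) => x + t • (c - x) ∈ U) fun t ht => ?_
  have hc : Continuous fun z : (ℝ × ℝ) × ℝ => z.1 + z.2 • (c - z.1) := by fun_prop
  exact hc.continuousAt.tendsto.eventually (hU.mem_nhds (hx t ht))

/-- The side is a germ condition at t → 0⁺. It is written as a countable union of countable
intersections of conditions over compact t-intervals, each of which is open in x by compactness. -/
lemma measurable_sideAt (M : RectMesh) {Ωp : Set (ℝ × ℝ)} (hΩ : IsOpen Ωp) (i j : ℕ) :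
    Measurable (sideAt M Ωp i j) := by
  refine measurable_to_bool ?_
  have : sideAt M Ωp i j ⁻¹' {true} = ⋃ N : ℕ, ⋂ k : ℕ,
      {x : ℝ × ℝ | ∀ t ∈ Icc (1 / ((k : ℝ) + 1)) (1 / ((N : ℝ) + 1)),
        x + t • (M.center i j - x) ∈ Ωp} := by
    ext x
    simp only [mem_preimage, mem_singleton_iff, sideAt_eq_true_iff, mem_iUnion, mem_iInter,
      mem_ofPred_eq]
    constructor
    · intro h
      obtain ⟨a, ha, hsub⟩ := mem_nhdsGT_iff_exists_Ioc_subset.mp h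
      obtain ⟨N, hN⟩ := exists_nat_one_div_lt (mem_Ioi.mp ha)
      exact ⟨N, fun k t ht => hsub ⟨lt_of_lt_of_le (by positivity) ht.1, ht.2.trans hN.le⟩⟩
    · rintro ⟨N, hN⟩
      refine mem_nhdsGT_iff_exists_Ioc_subset.mpr ⟨1 / ((N : ℝ) + 1),
        mem_Ioi.mpr (by positivity), fun t ht => ?_⟩
      obtain ⟨k, hk⟩ := exists_nat_one_div_lt ht.1
      exact hN k t ⟨hk.le, ht.2⟩
  rw [this]
  exact MeasurableSet.iUnion fun N => MeasurableSet.iInter fun k =>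
    (isOpen_forall_segment hΩ _ _ _).measurableSet

lemma bddMeasOn_branch (M : RectMesh) {Ωp : Set (ℝ × ℝ)} (hΩ : IsOpen Ωp) (i j : ℕ)
    {f : Bool → ℝ × ℝ → ℝ} (hf : ∀ s, ContinuousOn (f s) (M.elem i j)) :
    BddMeasOn (M.elem i j) (fun x => f (sideAt M Ωp i j x) x) := by
  have hK := M.measurableSet_elem i j
  constructor
  · have hm : ∀ s, Measurable ((M.elem i j).indicator (f s)) := fun s => by
      classical
      rw [← piecewise_eq_indicator]
      exact (hf s).measurable_piecewise continuousOn_const hK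
    have heq : (M.elem i j).indicator (fun x => f (sideAt M Ωp i j x) x) = fun x =>
        if sideAt M Ωp i j x = true then (M.elem i j).indicator (f true) x
          else (M.elem i j).indicator (f false) x := by
      funext x
      by_cases hx : x ∈ M.elem i j
      · simp only [indicator_of_mem hx]
        cases sideAt M Ωp i j x <;> simp
      · simp [indicator_of_notMem hx]
    rw [heq]
    exact Measurable.ite (measurable_sideAt M hΩ i j (measurableSet_singleton true))
      (hm true) (hm false)
  · obtain ⟨C, hC⟩ := (M.isCompact_elem i j).exists_bound_of_continuousOn (hf true)
    obtain ⟨D, hD⟩ := (M.isCompact_elem i j).exists_bound_of_continuousOn (hf false)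
    refine ⟨max C D, fun x hx => ?_⟩
    change |f (sideAt M Ωp i j x) x| ≤ max C D
    cases sideAt M Ωp i j x
    · exact (hD x hx).trans (le_max_right _ _)
    · exact (hC x hx).trans (le_max_left _ _)

lemma continuousAt_pd {f : ℝ × ℝ → ℝ} {x : ℝ × ℝ} (hf : ContDiffAt ℝ 1 f x) :
    ContinuousAt (pd1 f) x ∧ ContinuousAt (pd2 f) x := by
  have hev : ∀ᶠ y in 𝓝 x, DifferentiableAt ℝ f y :=
    (hf.eventually (by simp)).mono fun y hy => hy.differentiableAt (by norm_num)
  have hfd : ContinuousAt (fderiv ℝ f) x :=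
    (hf.fderiv_right (m := 0) (by norm_num)).continuousAt
  constructor
  · refine ContinuousAt.congr (f := fun y => fderiv ℝ f y (1, 0))
      (hfd.clm_apply continuousAt_const) ?_
    exact hev.mono fun y hy => (pd_eq_fderiv hy).1.symm
  · refine ContinuousAt.congr (f := fun y => fderiv ℝ f y (0, 1))
      (hfd.clm_apply continuousAt_const) ?_
    exact hev.mono fun y hy => (pd_eq_fderiv hy).2.symm

/-- The values, the coefficient and the gradient of a broken function are bounded and measurable on
an element. -/
structure IsTame (M : RectMesh) (Ωp : Set (ℝ × ℝ)) (β : Bool → ℝ) (u : BrokenFun) (i j : ℕ) :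
    Prop where
  val : BddMeasOn (M.elem i j) (val M Ωp u i j)
  coef : BddMeasOn (M.elem i j) (coef M Ωp β i j)
  grad_fst : BddMeasOn (M.elem i j) (fun x => (grad M Ωp u i j x).1)
  grad_snd : BddMeasOn (M.elem i j) (fun x => (grad M Ωp u i j x).2)

lemma isTame_of_contDiffAt {M : RectMesh} {Ωp : Set (ℝ × ℝ)} (hΩ : IsOpen Ωp) (β : Bool → ℝ)
    {u : BrokenFun} {i j : ℕ} (hu : ∀ s, ∀ x ∈ M.elem i j, ContDiffAt ℝ 1 (u i j s) x) :
    IsTame M Ωp β u i j where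
  val := bddMeasOn_branch M hΩ i j (f := fun s => u i j s)
    fun s x hx => (hu s x hx).continuousAt.continuousWithinAt
  coef := bddMeasOn_branch M hΩ i j (f := fun s _ => β s) fun _ => continuousOn_const
  grad_fst := bddMeasOn_branch M hΩ i j (f := fun s => pd1 (u i j s))
    fun s x hx => (continuousAt_pd (hu s x hx)).1.continuousWithinAt
  grad_snd := bddMeasOn_branch M hΩ i j (f := fun s => pd2 (u i j s))
    fun s x hx => (continuousAt_pd (hu s x hx)).2.continuousWithinAt

/-! ### The trace inequality -/

lemma euclLength_sq (v : ℝ × ℝ) : euclLength v ^ 2 = v.1 ^ 2 + v.2 ^ 2 :=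
  Real.sq_sqrt (by positivity)

lemma euclLength_grad_sq_le (M : RectMesh) (Ωp : Set (ℝ × ℝ)) (u : BrokenFun) (i j : ℕ)
    (x : ℝ × ℝ) : euclLength (grad M Ωp u i j x) ^ 2 ≤ brokenGradSize M Ωp u i j x ^ 2 := by
  rw [euclLength_sq]
  simp only [grad, brokenGradSize, gradSize]
  set a := pd1 (u i j (sideAt M Ωp i j x)) x
  set b := pd2 (u i j (sideAt M Ωp i j x)) x
  rw [← sq_abs a, ← sq_abs b]
  nlinarith [mul_nonneg (abs_nonneg a) (abs_nonneg b)]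

lemma brokenGradSize_sq_le (M : RectMesh) (Ωp : Set (ℝ × ℝ)) (u : BrokenFun) (i j : ℕ)
    (x : ℝ × ℝ) : brokenGradSize M Ωp u i j x ^ 2 ≤ 2 * euclLength (grad M Ωp u i j x) ^ 2 := by
  rw [euclLength_sq]
  simp only [grad, brokenGradSize, gradSize]
  set a := pd1 (u i j (sideAt M Ωp i j x)) x
  set b := pd2 (u i j (sideAt M Ωp i j x)) x
  rw [← sq_abs a, ← sq_abs b]
  nlinarith [sq_nonneg (|a| - |b|)]

section Trace

variable {M : RectMesh} {Ωp : Set (ℝ × ℝ)} {β : Bool → ℝ} {u : BrokenFun} {i j : ℕ}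

lemma IsTame.energy (h : IsTame M Ωp β u i j) : BddMeasOn (M.elem i j)
    (fun x => FrenetIFE.coef M Ωp β i j x * euclLength (grad M Ωp u i j x) ^ 2) := by
  simp only [euclLength_sq]
  exact h.coef.mul (h.grad_fst.sq.add h.grad_snd.sq)

lemma IsTame.flux_sq (h : IsTame M Ωp β u i j) : BddMeasOn (M.elem i j)
    (fun x => (FrenetIFE.coef M Ωp β i j x * euclLength (grad M Ωp u i j x)) ^ 2) := by
  simp only [mul_pow, euclLength_sq]
  exact h.coef.sq.mul (h.grad_fst.sq.add h.grad_snd.sq)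

lemma vert_mem_elem {x y : ℝ} (hx : x = M.gx i ∨ x = M.gx (i + 1))
    (hy : y ∈ Icc (M.gy j) (M.gy (j + 1))) : (x, y) ∈ M.elem i j := by
  have := M.gx_le_succ i
  rcases hx with rfl | rfl
  · exact ⟨⟨le_rfl, this⟩, hy⟩
  · exact ⟨⟨this, le_rfl⟩, hy⟩

lemma horiz_mem_elem {x y : ℝ} (hx : x ∈ Icc (M.gx i) (M.gx (i + 1)))
    (hy : y = M.gy j ∨ y = M.gy (j + 1)) : (x, y) ∈ M.elem i j := by
  have := M.gy_le_succ j
  rcases hy with rfl | rfl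
  · exact ⟨hx, ⟨le_rfl, this⟩⟩
  · exact ⟨hx, ⟨this, le_rfl⟩⟩

lemma bdryIntegral_le {F : ℝ × ℝ → ℝ} {B : ℝ} (hF : ∀ x ∈ M.elem i j, |F x| ≤ B) :
    bdryIntegral M i j F ≤ 4 * M.h * B := by
  have hB : 0 ≤ B := (abs_nonneg _).trans (hF _ (interior_subset (M.center_mem_interior i j)))
  have hv : ∀ x, x = M.gx i ∨ x = M.gx (i + 1) →
      ∫ y in (M.gy j)..(M.gy (j + 1)), F (x, y) ≤ M.h * B := by
    intro x hx
    refine (Real.le_norm_self _).trans ?_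
    have h1 := intervalIntegral.norm_integral_le_of_norm_le_const (a := M.gy j)
      (b := M.gy (j + 1)) (f := fun y => F (x, y)) (C := B) fun y hy => by
        rw [uIoc_of_le (M.gy_le_succ j)] at hy
        exact hF _ (vert_mem_elem hx (Ioc_subset_Icc_self hy))
    refine h1.trans ?_
    rw [M.gy_succ, add_sub_cancel_left, abs_of_pos M.hy_pos, mul_comm]
    exact mul_le_mul_of_nonneg_right M.hy_le_h hB
  have hh : ∀ y, y = M.gy j ∨ y = M.gy (j + 1) →
      ∫ x in (M.gx i)..(M.gx (i + 1)), F (x, y) ≤ M.h * B := by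
    intro y hy
    refine (Real.le_norm_self _).trans ?_
    have h1 := intervalIntegral.norm_integral_le_of_norm_le_const (a := M.gx i)
      (b := M.gx (i + 1)) (f := fun x => F (x, y)) (C := B) fun x hx => by
        rw [uIoc_of_le (M.gx_le_succ i)] at hx
        exact hF _ (horiz_mem_elem (Ioc_subset_Icc_self hx) hy)
    refine h1.trans ?_
    rw [M.gx_succ, add_sub_cancel_left, abs_of_pos M.hx_pos, mul_comm]
    exact mul_le_mul_of_nonneg_right M.hx_le_h hB
  unfold bdryIntegral
  linarith [hv _ (Or.inl rfl), hv _ (Or.inr rfl), hh _ (Or.inl rfl), hh _ (Or.inr rfl)]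

lemma volume_closedBall_plane (x : ℝ × ℝ) {r : ℝ} (hr : 0 ≤ r) :
    volume.real (Metric.closedBall x r) = (2 * r) ^ 2 := by
  rw [← closedBall_prod_same, Measure.volume_eq_prod, measureReal_prod_prod]
  rw [Real.volume_real_closedBall hr, Real.volume_real_closedBall hr]
  ring

lemma volume_elem_ne_top (M : RectMesh) (i j : ℕ) : volume (M.elem i j) ≠ ⊤ :=
  (M.isCompact_elem i j).measure_lt_top.ne

/-- The squared trace inequality on an element with a good box. -/
lemma trace_of_goodBox (hβ : 0 < β false) (hβ' : β false ≤ β true) (ht : IsTame M Ωp β u i j)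
    {C δ : ℝ} (hC : 1 ≤ C) (hδ : 0 < δ) (hbox : HasGoodBox M Ωp β u C δ i j) :
    bdryIntegral M i j (fun x => (coef M Ωp β i j x * euclLength (grad M Ωp u i j x)) ^ 2) ≤
      2 * C / δ ^ 2 * gam β / M.h *
        ∫ x in M.elem i j, coef M Ωp β i j x * euclLength (grad M Ωp u i j x) ^ 2 := by
  obtain ⟨xs, hxs⟩ := hbox
  have hh := M.h_pos
  have hγ := gam_pos hβ hβ'
  have hβs : ∀ x, 0 < coef M Ωp β i j x := fun x => weight_pos hβ hβ' _
  set E : ℝ × ℝ → ℝ := fun x => coef M Ωp β i j x * euclLength (grad M Ωp u i j x) ^ 2 with hE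
  have hE0 : ∀ x, 0 ≤ E x := fun x => mul_nonneg (hβs x).le (sq_nonneg _)
  have hEint : IntegrableOn E (M.elem i j) :=
    ht.energy.integrableOn (M.measurableSet_elem i j) (volume_elem_ne_top M i j)
  have hsub : Metric.closedBall xs (δ * M.h) ⊆ M.elem i j := fun x hx =>
    (hxs x (mem_closedBall_iff_norm.mp hx)).1
  have hpt : ∀ y ∈ M.elem i j, (coef M Ωp β i j y * euclLength (grad M Ωp u i j y)) ^ 2 ≤
      C * gam β / (2 * δ ^ 2 * M.h ^ 2) * ∫ x in M.elem i j, E x := by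
    intro y hy
    set Fy := (coef M Ωp β i j y * euclLength (grad M Ωp u i j y)) ^ 2 with hFy
    have h1 : ∀ x ∈ Metric.closedBall xs (δ * M.h), Fy / (2 * C * gam β) ≤ E x := by
      intro x hx
      have h2 := (hxs x (mem_closedBall_iff_norm.mp hx)).2 y hy
      rw [div_le_iff₀ (by positivity)]
      calc Fy = coef M Ωp β i j y ^ 2 * euclLength (grad M Ωp u i j y) ^ 2 := by rw [hFy]; ring
        _ ≤ coef M Ωp β i j y ^ 2 * brokenGradSize M Ωp u i j y ^ 2 :=
            mul_le_mul_of_nonneg_left (euclLength_grad_sq_le M Ωp u i j y) (sq_nonneg _)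
        _ = (coef M Ωp β i j y * brokenGradSize M Ωp u i j y) ^ 2 := by ring
        _ ≤ C * gam β * (coef M Ωp β i j x * brokenGradSize M Ωp u i j x ^ 2) := h2
        _ ≤ C * gam β * (coef M Ωp β i j x * (2 * euclLength (grad M Ωp u i j x) ^ 2)) := by
            have := brokenGradSize_sq_le M Ωp u i j x
            have := hβs x
            gcongr
        _ = E x * (2 * C * gam β) := by rw [hE]; ring
    -- In the sup norm the ball is a square of side 2δh.
    have h3 : (2 * (δ * M.h)) ^ 2 * (Fy / (2 * C * gam β)) ≤
        ∫ x in Metric.closedBall xs (δ * M.h), E x := by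
      have h4 := setIntegral_mono_on (μ := volume)
        (integrableOn_const (C := Fy / (2 * C * gam β))
          (isCompact_closedBall xs (δ * M.h)).measure_lt_top.ne)
        (hEint.mono_set hsub) Metric.isClosed_closedBall.measurableSet h1
      rw [setIntegral_const, smul_eq_mul, volume_closedBall_plane _ (by positivity)] at h4
      exact h4
    have h5 : ∫ x in Metric.closedBall xs (δ * M.h), E x ≤ ∫ x in M.elem i j, E x :=
      setIntegral_mono_set hEint (Eventually.of_forall hE0) hsub.eventuallyLE
    have h6 : Fy = C * gam β / (2 * δ ^ 2 * M.h ^ 2) *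
        ((2 * (δ * M.h)) ^ 2 * (Fy / (2 * C * gam β))) := by
      field_simp
    rw [h6]
    exact mul_le_mul_of_nonneg_left (h3.trans h5) (by positivity)
  refine (bdryIntegral_le (B := C * gam β / (2 * δ ^ 2 * M.h ^ 2) * ∫ x in M.elem i j, E x)
    fun x hx => ?_).trans_eq ?_
  · rw [abs_of_nonneg (sq_nonneg _)]
    exact hpt x hx
  · field_simp
    ring

end Trace

/-! ### Coercivity -/

/-! ### Averages and jumps on edges, and regrouping by elements -/

section Edges

variable {M : RectMesh} {i j : ℕ}

lemma vertEdge_subset {k : ℕ} (h : i = k ∨ i = k + 1) :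
    ({M.gx i} ×ˢ Icc (M.gy j) (M.gy (j + 1)) : Set (ℝ × ℝ)) ⊆ M.elem k j := by
  rintro ⟨x, y⟩ ⟨hx, hy⟩
  refine vert_mem_elem ?_ hy
  obtain rfl : x = M.gx i := hx
  rcases h with rfl | rfl
  · exact Or.inl rfl
  · exact Or.inr rfl

lemma horizEdge_subset {k : ℕ} (h : j = k ∨ j = k + 1) :
    (Icc (M.gx i) (M.gx (i + 1)) ×ˢ {M.gy j} : Set (ℝ × ℝ)) ⊆ M.elem i k := by
  rintro ⟨x, y⟩ ⟨hx, hy⟩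
  refine horiz_mem_elem hx ?_
  obtain rfl : y = M.gy j := hy
  rcases h with rfl | rfl
  · exact Or.inl rfl
  · exact Or.inr rfl

lemma measurableSet_vertEdge (M : RectMesh) (i j : ℕ) :
    MeasurableSet ({M.gx i} ×ˢ Icc (M.gy j) (M.gy (j + 1)) : Set (ℝ × ℝ)) :=
  (measurableSet_singleton _).prod measurableSet_Icc

lemma measurableSet_horizEdge (M : RectMesh) (i j : ℕ) :
    MeasurableSet (Icc (M.gx i) (M.gx (i + 1)) ×ˢ {M.gy j} : Set (ℝ × ℝ)) :=
  measurableSet_Icc.prod (measurableSet_singleton _)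

variable {w : ℕ → ℕ → ℝ × ℝ → ℝ}

lemma BddMeasOn.avg_jump_vert (hw : ∀ k < M.nx, BddMeasOn (M.elem k j) (w k j)) (hi : i ≤ M.nx) :
    BddMeasOn ({M.gx i} ×ˢ Icc (M.gy j) (M.gy (j + 1))) (avgV M w i j) ∧
    BddMeasOn ({M.gx i} ×ˢ Icc (M.gy j) (M.gy (j + 1))) (jumpV M w i j) := by
  have hm := measurableSet_vertEdge M i j
  have hn := M.nx_pos
  unfold avgV jumpV
  rcases Nat.eq_zero_or_pos i with rfl | hpos
  · have h0 := (hw 0 hn).mono hm (vertEdge_subset (Or.inl rfl))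
    simpa using h0
  · have h1 := (hw (i - 1) (by omega)).mono hm (vertEdge_subset (Or.inr (by omega)))
    have hi0 : i ≠ 0 := by omega
    by_cases hin : i = M.nx
    · simp only [hin, if_true]
      simp only [hin] at h1 hi0
      simpa [hi0] using h1
    · have h2 := (hw i (by omega)).mono hm (vertEdge_subset (Or.inl rfl))
      simp only [hi0, hin, if_false]
      refine ⟨?_, h1.sub hm h2⟩
      have := (BddMeasOn.const hm (1 / 2)).mul (h1.add h2)
      convert this using 2
      ring

lemma BddMeasOn.avg_jump_horiz (hw : ∀ k < M.ny, BddMeasOn (M.elem i k) (w i k))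
    (hj : j ≤ M.ny) :
    BddMeasOn (Icc (M.gx i) (M.gx (i + 1)) ×ˢ {M.gy j}) (avgH M w i j) ∧
    BddMeasOn (Icc (M.gx i) (M.gx (i + 1)) ×ˢ {M.gy j}) (jumpH M w i j) := by
  have hm := measurableSet_horizEdge M i j
  have hn := M.ny_pos
  unfold avgH jumpH
  rcases Nat.eq_zero_or_pos j with rfl | hpos
  · have h0 := (hw 0 hn).mono hm (horizEdge_subset (Or.inl rfl))
    simpa using h0
  · have h1 := (hw (j - 1) (by omega)).mono hm (horizEdge_subset (Or.inr (by omega)))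
    have hj0 : j ≠ 0 := by omega
    by_cases hjn : j = M.ny
    · simp only [hjn, if_true]
      simp only [hjn] at h1 hj0
      simpa [hj0] using h1
    · have h2 := (hw j (by omega)).mono hm (horizEdge_subset (Or.inl rfl))
      simp only [hj0, hjn, if_false]
      refine ⟨?_, h1.sub hm h2⟩
      have := (BddMeasOn.const hm (1 / 2)).mul (h1.add h2)
      convert this using 2
      ring

/-- The square of a mean is at most the sum of the squares, so each edge is charged to its adjacent
elements; the two conditionals remove the missing neighbour on the first and last grid lines. -/
lemma integral_avgV_sq_le {W : ℕ → ℕ → ℝ × ℝ → ℝ}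
    (hw : ∀ k < M.nx, BddMeasOn (M.elem k j) (w k j))
    (hWm : ∀ k < M.nx, BddMeasOn (M.elem k j) (W k j)) (hW : ∀ k x, w k j x ^ 2 ≤ W k j x)
    (hi : i ≤ M.nx) :
    ∫ y in (M.gy j)..(M.gy (j + 1)), avgV M w i j (M.gx i, y) ^ 2 ≤
      (if i < M.nx then ∫ y in (M.gy j)..(M.gy (j + 1)), W i j (M.gx i, y) else 0) +
      (if 0 < i then ∫ y in (M.gy j)..(M.gy (j + 1)), W (i - 1) j (M.gx i, y) else 0) := by
  have hn := M.nx_pos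
  have hm := measurableSet_vertEdge M i j
  have hle := M.gy_le_succ j
  have havg := ((BddMeasOn.avg_jump_vert hw hi).1.sq).intervalIntegrable_vert hle
  have hint : ∀ k < M.nx, i = k ∨ i = k + 1 →
      IntervalIntegrable (fun y => W k j (M.gx i, y)) volume (M.gy j) (M.gy (j + 1)) :=
    fun k hk h => ((hWm k hk).mono hm (vertEdge_subset h)).intervalIntegrable_vert hle
  rcases Nat.eq_zero_or_pos i with rfl | hpos
  · rw [if_pos hn, if_neg (lt_irrefl 0), add_zero]
    refine intervalIntegral.integral_mono_on hle havg (hint 0 hn (Or.inl rfl)) fun y _ => ?_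
    simpa [avgV] using hW 0 _
  · have hi0 : i ≠ 0 := by omega
    have hpred := hint (i - 1) (by omega) (Or.inr (by omega))
    rw [if_pos hpos]
    by_cases hin : i = M.nx
    · rw [if_neg (by omega), zero_add]
      refine intervalIntegral.integral_mono_on hle havg hpred fun y _ => ?_
      unfold avgV
      rw [if_neg hi0, if_pos hin]
      exact hW _ _
    · have hself := hint i (by omega) (Or.inl rfl)
      rw [if_pos (by omega), ← intervalIntegral.integral_add hself hpred]
      refine intervalIntegral.integral_mono_on hle havg (hself.add hpred) fun y _ => ?_
      unfold avgV
      rw [if_neg hi0, if_neg hin]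
      have h1 := hW (i - 1) (M.gx i, y)
      have h2 := hW i (M.gx i, y)
      nlinarith [sq_nonneg (w (i - 1) j (M.gx i, y) - w i j (M.gx i, y)),
        sq_nonneg (w (i - 1) j (M.gx i, y)), sq_nonneg (w i j (M.gx i, y))]

lemma integral_avgH_sq_le {W : ℕ → ℕ → ℝ × ℝ → ℝ}
    (hw : ∀ k < M.ny, BddMeasOn (M.elem i k) (w i k))
    (hWm : ∀ k < M.ny, BddMeasOn (M.elem i k) (W i k)) (hW : ∀ k x, w i k x ^ 2 ≤ W i k x)
    (hj : j ≤ M.ny) :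
    ∫ x in (M.gx i)..(M.gx (i + 1)), avgH M w i j (x, M.gy j) ^ 2 ≤
      (if j < M.ny then ∫ x in (M.gx i)..(M.gx (i + 1)), W i j (x, M.gy j) else 0) +
      (if 0 < j then ∫ x in (M.gx i)..(M.gx (i + 1)), W i (j - 1) (x, M.gy j) else 0) := by
  have hn := M.ny_pos
  have hm := measurableSet_horizEdge M i j
  have hle := M.gx_le_succ i
  have havg := ((BddMeasOn.avg_jump_horiz hw hj).1.sq).intervalIntegrable_horiz hle
  have hint : ∀ k < M.ny, j = k ∨ j = k + 1 →
      IntervalIntegrable (fun x => W i k (x, M.gy j)) volume (M.gx i) (M.gx (i + 1)) :=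
    fun k hk h => ((hWm k hk).mono hm (horizEdge_subset h)).intervalIntegrable_horiz hle
  rcases Nat.eq_zero_or_pos j with rfl | hpos
  · rw [if_pos hn, if_neg (lt_irrefl 0), add_zero]
    refine intervalIntegral.integral_mono_on hle havg (hint 0 hn (Or.inl rfl)) fun x _ => ?_
    simpa [avgH] using hW 0 _
  · have hj0 : j ≠ 0 := by omega
    have hpred := hint (j - 1) (by omega) (Or.inr (by omega))
    rw [if_pos hpos]
    by_cases hjn : j = M.ny
    · rw [if_neg (by omega), zero_add]
      refine intervalIntegral.integral_mono_on hle havg hpred fun x _ => ?_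
      unfold avgH
      rw [if_neg hj0, if_pos hjn]
      exact hW _ _
    · have hself := hint j (by omega) (Or.inl rfl)
      rw [if_pos (by omega), ← intervalIntegral.integral_add hself hpred]
      refine intervalIntegral.integral_mono_on hle havg (hself.add hpred) fun x _ => ?_
      unfold avgH
      rw [if_neg hj0, if_neg hjn]
      have h1 := hW (j - 1) (x, M.gy j)
      have h2 := hW j (x, M.gy j)
      nlinarith [sq_nonneg (w i (j - 1) (x, M.gy j) - w i j (x, M.gy j)),
        sq_nonneg (w i (j - 1) (x, M.gy j)), sq_nonneg (w i j (x, M.gy j))]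

/-- Grid line i is charged to the cell after it (A i) and the cell before it (B i); regrouping by
cells, cell i receives A i from its lower line and B (i + 1) from its upper one. -/
lemma sum_edges_to_elems (n : ℕ) (A B : ℕ → ℝ) :
    ∑ i ∈ Finset.range (n + 1), ((if i < n then A i else 0) + (if 0 < i then B i else 0)) =
      ∑ i ∈ Finset.range n, (A i + B (i + 1)) := by
  rw [Finset.sum_add_distrib, Finset.sum_add_distrib, Finset.sum_range_succ,
    Finset.sum_range_succ' (fun i => if 0 < i then B i else 0)]
  simp only [lt_irrefl, if_false, add_zero, Nat.succ_pos, if_true]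
  congr 1
  exact Finset.sum_congr rfl fun i hi => if_pos (Finset.mem_range.mp hi)

end Edges

/-! ### Young's inequality and the energy estimate -/

section Coercivity

variable {M : RectMesh} {Ωp : Set (ℝ × ℝ)} {β : Bool → ℝ} {u : BrokenFun}

lemma flux_fst_sq_le (x : ℝ × ℝ) (i j k : ℕ) :
    (coef M Ωp β i j x * ((grad M Ωp u i j x).1 * edgeSign k)) ^ 2 ≤
      (coef M Ωp β i j x * euclLength (grad M Ωp u i j x)) ^ 2 := by
  have hs : edgeSign k ^ 2 = 1 := by unfold edgeSign; split_ifs <;> norm_num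
  rw [mul_pow, mul_pow, mul_pow, hs, euclLength_sq, mul_one]
  exact mul_le_mul_of_nonneg_left (by nlinarith [sq_nonneg (grad M Ωp u i j x).2]) (sq_nonneg _)

lemma flux_snd_sq_le (x : ℝ × ℝ) (i j k : ℕ) :
    (coef M Ωp β i j x * ((grad M Ωp u i j x).2 * edgeSign k)) ^ 2 ≤
      (coef M Ωp β i j x * euclLength (grad M Ωp u i j x)) ^ 2 := by
  have hs : edgeSign k ^ 2 = 1 := by unfold edgeSign; split_ifs <;> norm_num
  rw [mul_pow, mul_pow, mul_pow, hs, euclLength_sq, mul_one]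
  exact mul_le_mul_of_nonneg_left (by nlinarith [sq_nonneg (grad M Ωp u i j x).1]) (sq_nonneg _)

/-- All branches of `u` are tame. -/
def AllTame (M : RectMesh) (Ωp : Set (ℝ × ℝ)) (β : Bool → ℝ) (u : BrokenFun) : Prop :=
  ∀ i < M.nx, ∀ j < M.ny, IsTame M Ωp β u i j

lemma AllTame.fluxV (ht : AllTame M Ωp β u) {j : ℕ} (hj : j < M.ny) (n : ℕ) :
    ∀ k < M.nx, BddMeasOn (M.elem k j)
      (fun x => coef M Ωp β k j x * ((grad M Ωp u k j x).1 * edgeSign n)) := fun k hk =>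
  (ht k hk j hj).coef.mul ((ht k hk j hj).grad_fst.mul
    (BddMeasOn.const (M.measurableSet_elem k j) _))

lemma AllTame.fluxH (ht : AllTame M Ωp β u) {i : ℕ} (hi : i < M.nx) (n : ℕ) :
    ∀ k < M.ny, BddMeasOn (M.elem i k)
      (fun x => coef M Ωp β i k x * ((grad M Ωp u i k x).2 * edgeSign n)) := fun k hk =>
  (ht i hi k hk).coef.mul ((ht i hi k hk).grad_snd.mul
    (BddMeasOn.const (M.measurableSet_elem i k) _))

/-- The fluxes on the edges are controlled by the fluxes on the boundaries of the elements. -/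
lemma edgeSum_avgFlux_sq_le (ht : AllTame M Ωp β u) :
    edgeSum M (fun i j x => avgFluxV M Ωp β u i j x ^ 2)
      (fun i j x => avgFluxH M Ωp β u i j x ^ 2) ≤
    ∑ i ∈ Finset.range M.nx, ∑ j ∈ Finset.range M.ny, bdryIntegral M i j
      (fun x => (coef M Ωp β i j x * euclLength (grad M Ωp u i j x)) ^ 2) := by
  set W : ℕ → ℕ → ℝ × ℝ → ℝ :=
    fun i j x => (coef M Ωp β i j x * euclLength (grad M Ωp u i j x)) ^ 2 with hW
  have hV : ∑ i ∈ Finset.range (M.nx + 1), ∑ j ∈ Finset.range M.ny,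
      ∫ y in (M.gy j)..(M.gy (j + 1)), avgFluxV M Ωp β u i j (M.gx i, y) ^ 2 ≤
      ∑ i ∈ Finset.range M.nx, ∑ j ∈ Finset.range M.ny,
        ((∫ y in (M.gy j)..(M.gy (j + 1)), W i j (M.gx i, y)) +
          ∫ y in (M.gy j)..(M.gy (j + 1)), W i j (M.gx (i + 1), y)) := by
    rw [Finset.sum_comm, Finset.sum_comm (s := Finset.range M.nx)]
    refine Finset.sum_le_sum fun j hj => ?_
    have hj' := Finset.mem_range.mp hj
    have h1 := sum_edges_to_elems M.nx
      (fun i => ∫ y in (M.gy j)..(M.gy (j + 1)), W i j (M.gx i, y))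
      (fun i => ∫ y in (M.gy j)..(M.gy (j + 1)), W (i - 1) j (M.gx i, y))
    simp only [Nat.add_sub_cancel] at h1
    rw [← h1]
    refine Finset.sum_le_sum fun i hi => ?_
    exact integral_avgV_sq_le (ht.fluxV hj' i) (fun k hk => (ht k hk j hj').flux_sq)
      (fun k x => flux_fst_sq_le x k j i) (Nat.lt_succ_iff.mp (Finset.mem_range.mp hi))
  have hH : ∑ i ∈ Finset.range M.nx, ∑ j ∈ Finset.range (M.ny + 1),
      ∫ x in (M.gx i)..(M.gx (i + 1)), avgFluxH M Ωp β u i j (x, M.gy j) ^ 2 ≤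
      ∑ i ∈ Finset.range M.nx, ∑ j ∈ Finset.range M.ny,
        ((∫ x in (M.gx i)..(M.gx (i + 1)), W i j (x, M.gy j)) +
          ∫ x in (M.gx i)..(M.gx (i + 1)), W i j (x, M.gy (j + 1))) := by
    refine Finset.sum_le_sum fun i hi => ?_
    have hi' := Finset.mem_range.mp hi
    have h1 := sum_edges_to_elems M.ny
      (fun j => ∫ x in (M.gx i)..(M.gx (i + 1)), W i j (x, M.gy j))
      (fun j => ∫ x in (M.gx i)..(M.gx (i + 1)), W i (j - 1) (x, M.gy j))
    simp only [Nat.add_sub_cancel] at h1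
    rw [← h1]
    refine Finset.sum_le_sum fun j hj => ?_
    exact integral_avgH_sq_le (ht.fluxH hi' j) (fun k hk => (ht i hi' k hk).flux_sq)
      (fun k x => flux_snd_sq_le x i k j) (Nat.lt_succ_iff.mp (Finset.mem_range.mp hj))
  unfold edgeSum
  refine (add_le_add hV hH).trans_eq ?_
  rw [← Finset.sum_add_distrib]
  refine Finset.sum_congr rfl fun i _ => ?_
  rw [← Finset.sum_add_distrib]
  refine Finset.sum_congr rfl fun j _ => ?_
  unfold bdryIntegral
  ring

/-- Young's inequality for the consistency terms on one edge. -/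
lemma edge_young {a b c : ℝ} (hab : a ≤ b) (hc : 0 < c) {A J : ℝ → ℝ}
    (hAA : IntervalIntegrable (fun t => A t ^ 2) volume a b)
    (hAJ : IntervalIntegrable (fun t => A t * J t) volume a b)
    (hJJ : IntervalIntegrable (fun t => J t ^ 2) volume a b) :
    ∫ t in a..b, (A t * J t + A t * J t - c * (J t * J t)) ≤
      4 / (3 * c) * (∫ t in a..b, A t ^ 2) - c / 4 * ∫ t in a..b, J t ^ 2 := by
  have hJJ' : IntervalIntegrable (fun t => c * (J t * J t)) volume a b := by
    simpa [pow_two] using hJJ.const_mul c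
  have h1 := hAA.const_mul (4 / (3 * c))
  have h2 := hJJ.const_mul (c / 4)
  rw [← intervalIntegral.integral_const_mul, ← intervalIntegral.integral_const_mul,
    ← intervalIntegral.integral_sub h1 h2]
  refine intervalIntegral.integral_mono_on hab ((hAJ.add hAJ).sub hJJ') (h1.sub h2) fun t _ => ?_
  -- The weight is chosen so that exactly c/4 of the penalty survives, as needed for the factor 1/4;
  -- the difference of the two sides is a perfect square.
  have h3 : 4 / (3 * c) * A t ^ 2 - c / 4 * J t ^ 2 -
      (A t * J t + A t * J t - c * (J t * J t)) =
      4 / (3 * c) * (A t - 3 * c / 4 * J t) ^ 2 := by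
    field_simp
    ring
  have h4 : 0 ≤ 4 / (3 * c) * (A t - 3 * c / 4 * J t) ^ 2 := by positivity
  linarith

lemma edgeSum_young (ht : AllTame M Ωp β u) {c : ℝ} (hc : 0 < c) :
    edgeSum M
      (fun i j x =>
        avgFluxV M Ωp β u i j x * jumpV M (val M Ωp u) i j x +
          avgFluxV M Ωp β u i j x * jumpV M (val M Ωp u) i j x -
          c * (jumpV M (val M Ωp u) i j x * jumpV M (val M Ωp u) i j x))
      (fun i j x =>
        avgFluxH M Ωp β u i j x * jumpH M (val M Ωp u) i j x +
          avgFluxH M Ωp β u i j x * jumpH M (val M Ωp u) i j x -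
          c * (jumpH M (val M Ωp u) i j x * jumpH M (val M Ωp u) i j x)) ≤
    4 / (3 * c) * edgeSum M (fun i j x => avgFluxV M Ωp β u i j x ^ 2)
        (fun i j x => avgFluxH M Ωp β u i j x ^ 2) -
      c / 4 * edgeSum M (fun i j x => jumpV M (val M Ωp u) i j x ^ 2)
        (fun i j x => jumpH M (val M Ωp u) i j x ^ 2) := by
  unfold edgeSum
  rw [mul_add, mul_add, add_sub_add_comm]
  simp only [Finset.mul_sum, ← Finset.sum_sub_distrib]
  refine add_le_add ?_ ?_
  · refine Finset.sum_le_sum fun i hi => Finset.sum_le_sum fun j hj => ?_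
    have hi' := Nat.lt_succ_iff.mp (Finset.mem_range.mp hi)
    have hj' := Finset.mem_range.mp hj
    have hle := M.gy_le_succ j
    have hA : BddMeasOn _ (avgFluxV M Ωp β u i j) :=
      (BddMeasOn.avg_jump_vert (ht.fluxV hj' i) hi').1
    have hJ := (BddMeasOn.avg_jump_vert (fun k hk => (ht k hk j hj').val) hi').2
    exact edge_young hle hc (hA.sq.intervalIntegrable_vert hle)
      ((hA.mul hJ).intervalIntegrable_vert hle) (hJ.sq.intervalIntegrable_vert hle)
  · refine Finset.sum_le_sum fun i hi => Finset.sum_le_sum fun j hj => ?_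
    have hj' := Nat.lt_succ_iff.mp (Finset.mem_range.mp hj)
    have hi' := Finset.mem_range.mp hi
    have hle := M.gx_le_succ i
    have hA : BddMeasOn _ (avgFluxH M Ωp β u i j) :=
      (BddMeasOn.avg_jump_horiz (ht.fluxH hi' j) hj').1
    have hJ := (BddMeasOn.avg_jump_horiz (fun k hk => (ht i hi' k hk).val) hj').2
    exact edge_young hle hc (hA.sq.intervalIntegrable_horiz hle)
      ((hA.mul hJ).intervalIntegrable_horiz hle) (hJ.sq.intervalIntegrable_horiz hle)

/-- Let X be the energy over the elements, e₂ and e₃ the sums over edges of squared jumps and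
squared mean fluxes, and c = σ₀γ/h. Young's inequality gives a_h ≥ X + (c/4)e₂ − (4/3)e₃/c. The
trace bound and Ct² < σ₀ give e₃/c ≤ X/4, so the loss 4/3 together with the 1/4 required for the
third norm term costs (19/12)·X/4, less than the available 3X/4. -/
lemma coercivity_of_trace (hβ : 0 < β false) (hβ' : β false ≤ β true) (ht : AllTame M Ωp β u)
    {Ct σ₀ : ℝ} (hσ : Ct ^ 2 < σ₀)
    (htr : ∀ i < M.nx, ∀ j < M.ny,
      bdryIntegral M i j (fun x => (coef M Ωp β i j x * euclLength (grad M Ωp u i j x)) ^ 2) ≤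
        Ct ^ 2 / 4 * gam β / M.h *
          ∫ x in M.elem i j, coef M Ωp β i j x * euclLength (grad M Ωp u i j x) ^ 2) :
    1 / 4 * energySq M Ωp β σ₀ u ≤ bilin M Ωp β σ₀ u u := by
  have hσ0 : 0 < σ₀ := (sq_nonneg Ct).trans_lt hσ
  have hγ := gam_pos hβ hβ'
  have hh := M.h_pos
  set c := σ₀ * gam β / M.h with hc
  have hc0 : 0 < c := by positivity
  set X := elemSum M (fun i j x => coef M Ωp β i j x * euclLength (grad M Ωp u i j x) ^ 2) with hX
  have hX0 : 0 ≤ X := Finset.sum_nonneg fun i _ => Finset.sum_nonneg fun j _ =>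
    integral_nonneg fun x => mul_nonneg (weight_pos hβ hβ' _).le (sq_nonneg _)
  set e₂ := edgeSum M (fun i j x => jumpV M (val M Ωp u) i j x ^ 2)
    (fun i j x => jumpH M (val M Ωp u) i j x ^ 2) with he₂
  set e₃ := edgeSum M (fun i j x => avgFluxV M Ωp β u i j x ^ 2)
    (fun i j x => avgFluxH M Ωp β u i j x ^ 2) with he₃
  have hyoung := edgeSum_young ht hc0
  rw [← he₂, ← he₃] at hyoung
  have he₃X : e₃ ≤ Ct ^ 2 / 4 * gam β / M.h * X := by
    refine (edgeSum_avgFlux_sq_le ht).trans ?_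
    rw [hX, elemSum, Finset.mul_sum]
    refine Finset.sum_le_sum fun i hi => ?_
    rw [Finset.mul_sum]
    exact Finset.sum_le_sum fun j hj => htr i (Finset.mem_range.mp hi) j (Finset.mem_range.mp hj)
  have hcX : 1 / c * e₃ ≤ 1 / 4 * X := by
    calc 1 / c * e₃ ≤ 1 / c * (Ct ^ 2 / 4 * gam β / M.h * X) :=
          mul_le_mul_of_nonneg_left he₃X (by positivity)
      _ = Ct ^ 2 / σ₀ * (1 / 4 * X) := by rw [hc]; field_simp
      _ ≤ 1 * (1 / 4 * X) :=
          mul_le_mul_of_nonneg_right ((div_le_one hσ0).mpr hσ.le) (by positivity)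
      _ = 1 / 4 * X := one_mul _
  have henergy : energySq M Ωp β σ₀ u = X + c * e₂ + 1 / c * e₃ := by
    unfold energySq normSq
    rw [← hX, ← he₂, ← he₃, hc]
    congr 1
    · ring
    · congr 1
      field_simp
  have hbilin : bilin M Ωp β σ₀ u u = X - edgeSum M
      (fun i j x =>
        avgFluxV M Ωp β u i j x * jumpV M (val M Ωp u) i j x +
          avgFluxV M Ωp β u i j x * jumpV M (val M Ωp u) i j x -
          c * (jumpV M (val M Ωp u) i j x * jumpV M (val M Ωp u) i j x))
      (fun i j x =>
        avgFluxH M Ωp β u i j x * jumpH M (val M Ωp u) i j x +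
          avgFluxH M Ωp β u i j x * jumpH M (val M Ωp u) i j x -
          c * (jumpH M (val M Ωp u) i j x * jumpH M (val M Ωp u) i j x)) := by
    unfold bilin
    rw [hX]
    simp only [euclLength_sq]
    simp only [pow_two]
    rfl
  rw [henergy, hbilin]
  have h43 : 4 / (3 * c) * e₃ = 4 / 3 * (1 / c * e₃) := by field_simp
  rw [h43] at hyoung
  linarith

lemma traceInequality_of_sq {m : ℕ} {T : ℝ} {g : ℝ → ℝ × ℝ} (hβ : 0 < β false) {C Ct : ℝ}
    (hCt : 0 ≤ Ct) (hCCt : C ≤ Ct ^ 2)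
    (htr : ∀ u ∈ ifeSpace m T g M β, ∀ i < M.nx, ∀ j < M.ny,
      bdryIntegral M i j (fun x => (coef M Ωp β i j x * euclLength (grad M Ωp u i j x)) ^ 2) ≤
        C * gam β / M.h *
          ∫ x in M.elem i j, coef M Ωp β i j x * euclLength (grad M Ωp u i j x) ^ 2)
    (hβ' : β false ≤ β true) : TraceInequality m T g M Ωp β Ct := by
  intro u hu i hi j hj
  have hγ := gam_pos hβ hβ'
  have hh := M.h_pos
  have hβt := hβ.trans_le hβ'
  set X := ∫ x in M.elem i j, coef M Ωp β i j x * euclLength (grad M Ωp u i j x) ^ 2 with hX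
  have hX0 : 0 ≤ X :=
    integral_nonneg fun x => mul_nonneg (weight_pos hβ hβ' _).le (sq_nonneg _)
  refine Real.sqrt_le_iff.mpr ⟨by positivity, (htr u hu i hi j hj).trans ?_⟩
  rw [mul_pow, mul_pow, mul_pow, div_pow, inv_pow, Real.sq_sqrt hβ.le, Real.sq_sqrt hh.le,
    Real.sq_sqrt hX0]
  unfold gam
  rw [div_eq_mul_inv _ M.h]
  have : 0 ≤ β true ^ 2 / β false := by positivity
  gcongr

end Coercivity

end FrenetIFE

end

open FrenetIFE

theorem theorem5 (m : ℕ) (T : ℝ) (g : ℝ → ℝ × ℝ)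
    (hg : FrenetIFE.IsRegularJordanCurve (max 2 (m + 1)) T g) (ϱ : ℝ) :
    ∃ Ct : ℝ, 0 < Ct ∧ ∃ h₀ : ℝ, 0 < h₀ ∧
      ∀ M : FrenetIFE.RectMesh, M.ShapeRegular ϱ → M.h < h₀ →
      ∀ Ωp Ωm : Set (ℝ × ℝ), M.IsSplit g Ωp Ωm →
      ∀ β : Bool → ℝ, 0 < β false → β false ≤ β true →
        FrenetIFE.TraceInequality m T g M Ωp β Ct ∧
        ∀ σ₀ : ℝ, Ct ^ 2 + 1 / 2 < σ₀ →
          ∀ u ∈ FrenetIFE.ifeSpace m T g M β,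
            1 / 4 * FrenetIFE.energySq M Ωp β σ₀ u ≤ FrenetIFE.bilin M Ωp β σ₀ u u := by
  have hg2 : IsRegularJordanCurve 2 T g := hg.of_le (le_max_left _ _)
  have hT := hg.period_pos
  obtain ⟨c, L, h₁, tb⟩ := exists_tubularBounds hg2
  have hc := tb.c_pos
  have hh₁ := tb.h₁_pos
  obtain ⟨C₁, δ₁, hC₁, hδ₁, hbox₁⟩ := exists_goodBox_of_interface hg ϱ tb
  obtain ⟨C₂, δ₂, hC₂, hδ₂, hbox₂⟩ := exists_goodBox_of_not_interface m g ϱ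
  set C := max C₁ C₂
  set δ := min δ₁ δ₂
  have hC : 1 ≤ C := le_max_of_le_left hC₁
  have hδ : 0 < δ := lt_min hδ₁ hδ₂
  set D := 2 * C / δ ^ 2
  have hD : 0 < D := by positivity
  have hsq : (2 * Real.sqrt D) ^ 2 = 4 * D := by rw [mul_pow, Real.sq_sqrt hD.le]; norm_num
  -- D is the constant of the squared trace inequality. Taking Ct² = 4D instead of D only weakens
  -- the trace inequality and provides the factor 1/4 used in the coercivity estimate. The three
  -- entries of h₀ are the conditions of `IsSmall`.
  refine ⟨2 * Real.sqrt D, by positivity, min (h₁ / 2) (min (c * T / 4) T), by positivity, ?_⟩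
  intro M hM hMh Ωp Ωm hΩ β hβ hβ'
  have hs : IsSmall T c h₁ M.h := by
    obtain ⟨a1, a2⟩ := lt_min_iff.mp hMh
    obtain ⟨a2, a3⟩ := lt_min_iff.mp a2
    exact ⟨by linarith, a2, a3.le⟩
  have htame : ∀ u ∈ ifeSpace m T g M β, AllTame M Ωp β u := fun u hu i hi j hj =>
    isTame_of_contDiffAt hΩ.isOpen_p β fun s x hx => ifeSpace_contDiffAt hg2 tb hs hu hi hj s hx
  have htr : ∀ u ∈ ifeSpace m T g M β, ∀ i < M.nx, ∀ j < M.ny,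
      bdryIntegral M i j (fun x => (coef M Ωp β i j x * euclLength (grad M Ωp u i j x)) ^ 2) ≤
        D * gam β / M.h *
          ∫ x in M.elem i j, coef M Ωp β i j x * euclLength (grad M Ωp u i j x) ^ 2 := by
    intro u hu i hi j hj
    refine trace_of_goodBox hβ hβ' (htame u hu i hi j hj) hC hδ ?_
    obtain ⟨h1, h2⟩ := hu i hi j hj
    by_cases hK : M.IsInterfaceElem g i j
    · exact (hbox₁ M hM hs Ωp Ωm hΩ β hβ hβ' u i hi j hj (h2 hK)).mono hβ hβ'
        (le_max_left _ _) (min_le_left _ _)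
    · exact (hbox₂ M hM Ωp Ωm hΩ β hβ hβ' u i hi j hj hK (h1 hK)).mono hβ hβ'
        (le_max_right _ _) (min_le_right _ _)
  refine ⟨traceInequality_of_sq hβ (by positivity) (by rw [hsq]; linarith) htr hβ', ?_⟩
  intro σ₀ hσ u hu
  refine coercivity_of_trace hβ hβ' (htame u hu) (Ct := 2 * Real.sqrt D) (by linarith) ?_
  rw [hsq, mul_div_cancel_left₀ D (by norm_num : (4 : ℝ) ≠ 0)]
  exact htr u hu
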